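/- Let $\mathbb X$ be a standard Borel space, $\alpha$ a $\sigma$-finite measure on $\mathbb X$, $p\in(0,1)$ and $c=p^{-1/2}-p^{1/2}$. Let $\mathcal C$ be the algebra of bounded measurable functions $\varphi:\mathbb X\to\mathbb C$ with $\alpha(\{\varphi\ne0\})<\infty$. Let $\mathbf N$ be the set of finite or countable sums of Dirac measures on $\mathbb X$ (including $0$), with the $\sigma$-algebra $\mathcal N$ generated by the maps $\eta\mapsto\eta(B)$, $B\subset\mathbb X$ measurable. Let $\rho_{p,\alpha}$ be the law of the Pascal point process, i.e. the unique probability measure on $\mathbf N$ under which the variables $\eta(B_1),\dots,\eta(B_k)$ are independent for pairwise disjoint measurable $B_1,\dots,B_k$, under which $$\rho_{p,\alpha}(\eta(B)=n)=(1-p)^{\alpha(B)}\frac{p^n}{n!}\,(\alpha(B))_n\qquad(n\in\mathbb N_0),\qquad (a)_n=a(a+1)\cdots(a+n-1),$$ if $0<\alpha(B)<\infty$, and under which $\eta(B)=0$ (resp. $\eta(B)=\infty$) almost surely if $\alpha(B)=0$ (resp. $\alpha(B)=\infty$). Write $\eta(\varphi)=\int\varphi\,d\eta$ and $\alpha(\varphi)=\int\varphi\,d\alpha$,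 and let $\mathbb D$ be the set of polynomials $F(\eta)=P(\eta(\varphi_1),\dots,\eta(\varphi_n))$ with complex coefficients and $\varphi_i\in\mathcal C$. For $\varphi\in\mathcal C$ and $F\in\mathbb D$ put \begin{align*} K^-(\varphi)F(\eta)&=\tfrac1c\Bigl(\int\overline{\varphi(x)}\,[F(\eta+\delta_x)-F(\eta)]\,(\alpha+\eta)(dx)+\int\overline{\varphi(x)}\,[F(\eta-\delta_x)-F(\eta)]\,\eta(dx)\Bigr),\\ K^+(\varphi)F(\eta)&=\tfrac1c\Bigl(p\int\varphi(x)F(\eta+\delta_x)\,(\eta+\alpha)(dx)+\tfrac1p\int\varphi(x)F(\eta-\delta_x)\,\eta(dx)\Bigr)-\tfrac1c\bigl(2\eta(\varphi)+\alpha(\varphi)\bigr)F(\eta),\\ K^0(\varphi)F(\eta)&=-\tfrac1c\Bigl(\sqrt p\int\varphi(x)[F(\eta+\delta_x)-F(\eta)](\alpha+\eta)(dx)+\tfrac1{\sqrt p}\int\varphi(x)[F(\eta-\delta_x)-F(\eta)]\,\eta(dx)\Bigr)+\tfrac12\alpha(\varphi)F(\eta). \end{align*} For $a>0$ let $\mathcal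 M_n(x;a,p)$, $n\in\mathbb N_0$, be the monic Meixner polynomials, i.e. the unique polynomials of degree $n$ with leading coefficient $1$ that are orthogonal with respect to the weights $(1-p)^a(a)_x\,p^x/x!$, $x\in\mathbb N_0$. Then every $F\in\mathbb D$ is square-integrable; for all $\varphi\in\mathcal C$ and $F\in\mathbb D$ the integrals above converge absolutely for $\rho_{p,\alpha}$-almost every $\eta$; and the formulas define linear operators $K^\pm(\varphi),K^0(\varphi):\mathbb D\to\mathbb D$, where $\mathbb D$ is regarded as a subspace of the Hilbert space $L^2(\mathbf N,\mathcal N,\rho_{p,\alpha})$ (functions are identified if they agree almost everywhere) with scalar product $\langle f,g\rangle=\int\overline f g\,d\rho_{p,\alpha}$. These operators form a Fock representation of the $su(1,1)$ current algebra with vacuum $\mathbf 1$ (the constant function $1$), that is: 1. $\mathbb D$ is dense in $L^2(\mathbf N,\mathcal N,\rho_{p,\alpha})$ and is mapped to itself by all the operators. 2. $K^+(\varphi)$ and $K^0(\varphi)$ are linear in $\varphi$, and $K^-(\varphi)$ is antilinear in $\varphi$. 3. For all $\varphi,\theta\in\mathcal C$: $[K^-(\varphi),K^+(\theta)]=2K^0(\overline\varphi\theta)$,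 $[K^0(\varphi),K^+(\theta)]=K^+(\varphi\theta)$, $[K^0(\varphi),K^-(\theta)]=-K^-(\overline\varphi\theta)$, and $[K^\#(\varphi),K^\#(\theta)]=0$ for $\#\in\{+,-,0\}$. 4. For all $f,g\in\mathbb D$ and $\varphi\in\mathcal C$: $\langle f,K^0(\varphi)g\rangle=\langle K^0(\overline\varphi)f,g\rangle$ and $\langle f,K^+(\varphi)g\rangle=\langle K^-(\varphi)f,g\rangle$. 5. $\mathbf 1\in\mathbb D$, $\|\mathbf 1\|=1$, and $K^-(\varphi)\mathbf 1=0$ for all $\varphi\in\mathcal C$. 6. The linear combinations of $\mathbf 1$ and the vectors $K^+(\varphi_1)\cdots K^+(\varphi_n)\mathbf 1$, $n\ge1$, $\varphi_i\in\mathcal C$, are dense in $L^2(\mathbf N,\mathcal N,\rho_{p,\alpha})$. Moreover, for all $\ell$, all pairwise disjoint measurable $B_1,\dots,B_\ell$ with $0<\alpha(B_j)<\infty$, and all $n_1,\dots,n_\ell\in\mathbb N_0$, $$K^+(\mathbf 1_{B_1})^{n_1}\cdots K^+(\mathbf 1_{B_\ell})^{n_\ell}\mathbf 1(\eta)=\prod_{j=1}^\ell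 c^{n_j}\,\mathcal M_{n_j}\bigl(\eta(B_j);\alpha(B_j),p\bigr)\qquad\text{for }\rho_{p,\alpha}\text{-almost every }\eta\in\mathbf N.$$ -/

import Mathlib

open MeasureTheory ProbabilityTheory Polynomial
open scoped ENNReal

noncomputable section

namespace PascalCurrent

variable {X : Type*} [MeasurableSpace X]

/-! Current algebra of `su(1,1)`: test functions and Fock representations. -/

/-- The algebra `𝒞` of bounded measurable functions `φ : X → ℂ` with `α {φ ≠ 0} < ∞`, with the
pointwise operations and `star φ` the complex conjugate of `φ`. -/
def TestFunctions (α : Measure X) : NonUnitalStarSubalgebra ℂ (X → ℂ) where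
  carrier := {φ | Measurable φ ∧ (∃ C : ℝ, ∀ x, ‖φ x‖ ≤ C) ∧ α {x | φ x ≠ 0} < ∞}
  zero_mem' := ⟨measurable_const, ⟨0, fun x => by simp⟩, by simp⟩
  add_mem' := by
    rintro φ ψ ⟨h1, ⟨C, hC⟩, h3⟩ ⟨h1', ⟨C', hC'⟩, h3'⟩
    refine ⟨h1.add h1', ⟨C + C', fun x => (norm_add_le _ _).trans (add_le_add (hC x) (hC' x))⟩,
      lt_of_le_of_lt (measure_mono ?_)
        (lt_of_le_of_lt (measure_union_le _ _) (ENNReal.add_lt_top.2 ⟨h3, h3'⟩))⟩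
    intro x hx
    by_contra hn
    simp only [Set.mem_union, Set.mem_ofPred_eq, not_or, not_not] at hn
    exact hx (by simp [hn.1, hn.2])
  mul_mem' := by
    rintro φ ψ ⟨h1, ⟨C, hC⟩, h3⟩ ⟨h1', ⟨C', hC'⟩, h3'⟩
    refine ⟨h1.mul h1', ⟨C * C', fun x => ?_⟩, lt_of_le_of_lt (measure_mono ?_) h3⟩
    · rw [Pi.mul_apply, norm_mul]
      exact mul_le_mul (hC x) (hC' x) (norm_nonneg _) ((norm_nonneg _).trans (hC x))
    · intro x hx hn
      exact hx (by simp [hn])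
  smul_mem' := by
    rintro c φ ⟨h1, ⟨C, hC⟩, h3⟩
    refine ⟨h1.const_smul c, ⟨‖c‖ * C, fun x => ?_⟩, lt_of_le_of_lt (measure_mono ?_) h3⟩
    · rw [Pi.smul_apply, norm_smul]
      exact mul_le_mul_of_nonneg_left (hC x) (norm_nonneg _)
    · intro x hx hn
      exact hx (by simp [hn])
  star_mem' := by
    rintro φ ⟨h1, ⟨C, hC⟩, h3⟩
    refine ⟨continuous_star.measurable.comp h1, ⟨C, fun x => ?_⟩,
      lt_of_le_of_lt (measure_mono ?_) h3⟩
    · rw [Pi.star_apply, norm_star]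
      exact hC x
    · intro x hx hn
      exact hx (by simp [hn])

/-- The indicator function of a measurable set of finite measure, as a test function. -/
def indicatorTest (α : Measure X) (B : Set X) (hB : MeasurableSet B) (hα : α B < ∞) :
    TestFunctions α :=
  ⟨B.indicator 1, measurable_one.indicator hB,
    ⟨1, fun x => by by_cases hx : x ∈ B <;> simp [hx]⟩,
    lt_of_le_of_lt (measure_mono fun x hx => by
      by_contra hn
      exact hx (by simp [hn])) hα⟩

/-- Families `k⁺(φ)`, `k⁻(φ)`, `k⁰(φ)`, `φ ∈ 𝒞`, of linear operators with common domain `D`, all of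
them mapping `D` to itself, form a Fock representation of the `su(1,1)` current algebra in the
Hilbert space `H` with vacuum `Ψ ∈ D`. Here `⁅A, B⁆ = A * B - B * A` is the commutator, and the
inner product is antilinear in its first argument. -/
structure IsFockRepresentation (α : Measure X) {H : Type*} [NormedAddCommGroup H]
    [InnerProductSpace ℂ H] [CompleteSpace H] (D : Submodule ℂ H)
    (kp km k0 : TestFunctions α → Module.End ℂ D) (Ψ : D) : Prop where
  dense_domain : Dense (D : Set H)
  kp_add : ∀ φ θ, kp (φ + θ) = kp φ + kp θ
  kp_smul : ∀ (z : ℂ) (φ), kp (z • φ) = z • kp φ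
  k0_add : ∀ φ θ, k0 (φ + θ) = k0 φ + k0 θ
  k0_smul : ∀ (z : ℂ) (φ), k0 (z • φ) = z • k0 φ
  km_add : ∀ φ θ, km (φ + θ) = km φ + km θ
  km_smul : ∀ (z : ℂ) (φ), km (z • φ) = (starRingEnd ℂ z) • km φ
  comm_km_kp : ∀ φ θ, ⁅km φ, kp θ⁆ = (2 : ℂ) • k0 (star φ * θ)
  comm_k0_kp : ∀ φ θ, ⁅k0 φ, kp θ⁆ = kp (φ * θ)
  comm_k0_km : ∀ φ θ, ⁅k0 φ, km θ⁆ = -km (star φ * θ)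
  comm_kp_kp : ∀ φ θ, ⁅kp φ, kp θ⁆ = 0
  comm_km_km : ∀ φ θ, ⁅km φ, km θ⁆ = 0
  comm_k0_k0 : ∀ φ θ, ⁅k0 φ, k0 θ⁆ = 0
  adjoint_k0 : ∀ φ (f g : D), inner ℂ (f : H) (k0 φ g : H) = inner ℂ (k0 (star φ) f : H) (g : H)
  adjoint_kp : ∀ φ (f g : D), inner ℂ (f : H) (kp φ g : H) = inner ℂ (km φ f : H) (g : H)
  norm_vacuum : ‖(Ψ : H)‖ = 1
  km_vacuum : ∀ φ, km φ Ψ = 0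
  cyclic : Dense (Submodule.span ℂ
    {v : H | ∃ l : List (TestFunctions α), v = ((l.map kp).prod Ψ : D)} : Set H)

/-! Point configurations and the Pascal point process. -/

variable (X) in
/-- The space `𝐍` of finite or countable sums of Dirac measures (including the zero measure). It
carries the σ-algebra generated by the counting variables `η ↦ η B`, `B` measurable, which is the
one that it inherits as a subtype of `Measure X`. -/
abbrev Config : Type _ :=
  {η : Measure X // ∃ (ι : Type) (_ : Countable ι) (x : ι → X),
    η = Measure.sum fun i => Measure.dirac (x i)}

/-- The configuration `η + δ_x`. -/
def Config.add (η : Config X) (x : X) : Config X :=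
  ⟨η.1 + Measure.dirac x, by
    obtain ⟨η, ι, _, y, rfl⟩ := η
    refine ⟨ι ⊕ Unit, inferInstance, Sum.elim y fun _ => x, ?_⟩
    ext s hs
    rw [Measure.add_apply, Measure.sum_apply _ hs, Measure.sum_apply _ hs,
      ENNReal.summable.tsum_sum ENNReal.summable]
    simp⟩

open scoped Classical in
/-- The configuration `η - δ_x`, that is, the only configuration `ξ` with `ξ + δ_x = η`. It exists
if and only if `x` belongs to the configuration `η`; otherwise `η` is the default value. -/
def Config.sub (η : Config X) (x : X) : Config X :=
  if h : ∃ ξ : Config X, ξ.add x = η then h.choose else η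

/-- `η - δ_x` is well defined: subtracting a point undoes adding it. -/
theorem Config.sub_add (η : Config X) (x : X) : (η.add x).sub x = η := by
  have h : ∃ ξ : Config X, ξ.add x = η.add x := ⟨η, rfl⟩
  rw [Config.sub, dif_pos h]
  have h2 := congrArg Subtype.val h.choose_spec
  apply Subtype.ext
  ext s hs
  have h3 : h.choose.1 s + Measure.dirac x s = η.1 s + Measure.dirac x s := by
    have := congrArg (fun μ : Measure X => μ s) h2
    simpa [Config.add] using this
  exact (ENNReal.add_left_inj (measure_ne_top _ _)).1 h3

/-- `η - δ_x` exists when `x` belongs to `η`. -/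
theorem Config.add_sub [MeasurableSingletonClass X] (η : Config X) (x : X)
    (hx : 1 ≤ η.1 {x}) : (η.sub x).add x = η := by
  have h : ∃ ξ : Config X, ξ.add x = η := by
    obtain ⟨η, ι, hι, y, rfl⟩ := η
    have hi : ∃ i, y i = x := by
      by_contra hn
      push Not at hn
      rw [Measure.sum_apply _ (measurableSet_singleton x)] at hx
      simp [hn] at hx
    obtain ⟨i, rfl⟩ := hi
    refine ⟨⟨Measure.sum fun j : ({i}ᶜ : Set ι) => Measure.dirac (y j), ({i}ᶜ : Set ι),
      inferInstance, fun j => y j, rfl⟩, Subtype.ext ?_⟩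
    change (_ + Measure.dirac (y i) : Measure X) = Measure.sum fun j => Measure.dirac (y j)
    rw [← Measure.sum_add_sum_compl {i} fun j => Measure.dirac (y j), add_comm]
    congr 1
    ext s hs
    rw [Measure.sum_apply _ hs, tsum_singleton i fun j => Measure.dirac (y j) s]
  rw [Config.sub, dif_pos h]
  exact h.choose_spec

/-- The weights `(1 - p)^a (a)_n p^n / n!` of the negative binomial law on `ℕ`, where
`(a)_n = a (a + 1) ⋯ (a + n - 1)`. -/
def negBinWeight (a p : ℝ) (n : ℕ) : ℝ :=
  (1 - p) ^ a * (p ^ n / n.factorial) * (ascPochhammer ℝ n).eval a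

/-- The probability measure `ρ` on `𝐍` is the law `ρ_{p,α}` of the Pascal point process: counting
variables of disjoint sets are independent, and `η B` has the negative binomial law with
parameters `α B` and `p`. -/
structure IsPascalLaw (p : ℝ) (α : Measure X) (ρ : Measure (Config X)) : Prop where
  isProbabilityMeasure : IsProbabilityMeasure ρ
  indep : ∀ (k : ℕ) (B : Fin k → Set X), (∀ i, MeasurableSet (B i)) →
    Pairwise (fun i j => Disjoint (B i) (B j)) →
    iIndepFun (fun i (η : Config X) => η.1 (B i)) ρ
  law : ∀ B : Set X, MeasurableSet B → 0 < α B → α B < ∞ → ∀ n : ℕ,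
    ρ {η : Config X | η.1 B = n} = ENNReal.ofReal (negBinWeight (α B).toReal p n)
  law_zero : ∀ B : Set X, MeasurableSet B → α B = 0 → ∀ᵐ η : Config X ∂ρ, η.1 B = 0
  law_top : ∀ B : Set X, MeasurableSet B → α B = ∞ → ∀ᵐ η : Config X ∂ρ, η.1 B = ∞

/-! Polynomials on configuration space and the difference operators. -/

/-- The algebra of functions `F(η) = P(η(φ₁), …, η(φₙ))` with `P` a polynomial with complex
coefficients, `φᵢ ∈ 𝒞`, and `η(φ) = ∫ φ dη`. -/
def polyFun (α : Measure X) : Subalgebra ℂ (Config X → ℂ) :=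
  (MvPolynomial.aeval
    (fun (φ : TestFunctions α) (η : Config X) => ∫ x, (φ : X → ℂ) x ∂η.1) :
      MvPolynomial (TestFunctions α) ℂ →ₐ[ℂ] (Config X → ℂ)).range

/-- The space `𝔻` of polynomials, as a subspace of `L²(𝐍, ρ)`. -/
def polyDomain (α : Measure X) (ρ : Measure (Config X)) : Submodule ℂ (Lp ℂ 2 ρ) where
  carrier := {f | ∃ F ∈ polyFun α, f =ᵐ[ρ] F}
  zero_mem' := ⟨0, zero_mem _, Lp.coeFn_zero _ _ _⟩
  add_mem' := by
    rintro f g ⟨F, hF, hf⟩ ⟨G, hG, hg⟩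
    exact ⟨F + G, add_mem hF hG, (Lp.coeFn_add f g).trans (hf.add hg)⟩
  smul_mem' := by
    rintro c f ⟨F, hF, hf⟩
    exact ⟨c • F, Subalgebra.smul_mem _ hF c, (Lp.coeFn_smul c f).trans (hf.const_smul c)⟩

/-- The constant function `1`, as an element of `𝔻`. -/
def vacuum (α : Measure X) (ρ : Measure (Config X)) [IsProbabilityMeasure ρ] : polyDomain α ρ :=
  ⟨Lp.const 2 ρ (1 : ℂ), 1, one_mem _, Lp.coeFn_const _ _ _⟩

/-- The constant `c = 1/√p - √p`. -/
def cConst (p : ℝ) : ℝ := (√p)⁻¹ - √p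

/-- The formula for the lowering operator `K⁻(φ)`. -/
def lowering (p : ℝ) (α : Measure X) (φ : X → ℂ) (F : Config X → ℂ) (η : Config X) : ℂ :=
  1 / (cConst p : ℂ) *
    ((∫ x, starRingEnd ℂ (φ x) * (F (η.add x) - F η) ∂(α + η.1)) +
      ∫ x, starRingEnd ℂ (φ x) * (F (η.sub x) - F η) ∂η.1)

/-- The formula for the raising operator `K⁺(φ)`. -/
def raising (p : ℝ) (α : Measure X) (φ : X → ℂ) (F : Config X → ℂ) (η : Config X) : ℂ :=
  1 / (cConst p : ℂ) *
      ((p : ℂ) * (∫ x, φ x * F (η.add x) ∂(η.1 + α)) +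
        1 / (p : ℂ) * ∫ x, φ x * F (η.sub x) ∂η.1) -
    1 / (cConst p : ℂ) * (2 * (∫ x, φ x ∂η.1) + ∫ x, φ x ∂α) * F η

/-- The formula for the neutral operator `K⁰(φ)`. -/
def neutral (p : ℝ) (α : Measure X) (φ : X → ℂ) (F : Config X → ℂ) (η : Config X) : ℂ :=
  -(1 / (cConst p : ℂ)) *
      ((√p : ℂ) * (∫ x, φ x * (F (η.add x) - F η) ∂(α + η.1)) +
        1 / (√p : ℂ) * ∫ x, φ x * (F (η.sub x) - F η) ∂η.1) +
    1 / 2 * (∫ x, φ x ∂α) * F η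

/-- The operators `K(φ) : 𝔻 → 𝔻` are given by the formula `T φ F`, for every polynomial `F`. -/
def GivenBy {α : Measure X} {ρ : Measure (Config X)}
    (K : TestFunctions α → Module.End ℂ (polyDomain α ρ))
    (T : (X → ℂ) → (Config X → ℂ) → Config X → ℂ) : Prop :=
  ∀ (φ : TestFunctions α) (f : polyDomain α ρ), ∀ F ∈ polyFun α,
    (f : Lp ℂ 2 ρ) =ᵐ[ρ] F → (K φ f : Lp ℂ 2 ρ) =ᵐ[ρ] T φ F

/-- All integrals in the formulas for `K⁺(φ) F`, `K⁻(φ) F`, `K⁰(φ) F` at `η` converge absolutely. -/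
structure IntegralsConverge (α : Measure X) (φ : X → ℂ) (F : Config X → ℂ) (η : Config X) :
    Prop where
  test_config : Integrable φ η.1
  test_ref : Integrable φ α
  add : Integrable (fun x => φ x * F (η.add x)) (α + η.1)
  sub : Integrable (fun x => φ x * F (η.sub x)) η.1

/-! Meixner polynomials. -/

/-- `M n`, `n ∈ ℕ`, are the Meixner polynomials `ℳ_n(·; a, p)`: of degree `n`, with leading
coefficient `1`, and orthogonal with respect to the negative binomial law. -/
structure IsMonicMeixner (a p : ℝ) (M : ℕ → ℝ[X]) : Prop where
  natDegree_eq : ∀ n, (M n).natDegree = n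
  monic : ∀ n, (M n).Monic
  orthogonal : ∀ m n, m ≠ n →
    HasSum (fun x : ℕ => negBinWeight a p x * ((M m).eval (x : ℝ) * (M n).eval (x : ℝ))) 0

end PascalCurrent

end

open PascalCurrent

open PascalCurrent

namespace PascalCurrent

section

/-! ### The negative binomial law -/

/-! Put A⁺(φ)F(η) = ∫ φ(x) F(η+δ_x) (α+η)(dx) and A⁻(φ)F(η) = ∫ φ(x) F(η-δ_x) η(dx), let M(φ) be
multiplication by η(φ), and N(φ) = 2M(φ) + α(φ). Then A^±(φ)M(ψ) = M(ψ)A^±(φ) ± A^±(φψ), while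
A⁺(φ)1 = α(φ) + η(φ) and A⁻(φ)1 = η(φ). The M(ψ) generate all polynomials from 1, so a commutation
identity need only be checked on 1 and propagated through M. This gives [A⁺(φ),A⁻(θ)] = N(φθ),
[A⁺(φ),N(θ)] = 2A⁺(φθ), [A⁻(φ),N(θ)] = -2A⁻(φθ), with A⁺, A⁻ and N each commuting among themselves.
The operators K^± and K⁰ are combinations xA⁺ + yA⁻ + zN, evaluated at the conjugate of φ for K⁻,
and the su(1,1) relations become identities between coefficient triples
(`IsShiftSystem.lie_current`).

The analytic input is the Mecke formula E[η(φ)G] = p E[A⁺(φ)G]. For one counting variable it is the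
recursion (n+1)w(n+1) = p(a+n)w(n) of the negative binomial weights. Independence extends it to
polynomials in counts of disjoint sets, hence to simple test functions, and dominated convergence to
all of them (`IsPascalLaw.mecke`). It follows that A⁻(φ) and pA⁺(φ) are transposes of each other
(`IsPascalLaw.integral_sub_mul`). This yields the adjoint relations and also shows that A^± respect
almost everywhere equality, so that they act on classes in L².

Density rests on exponential moments: if u is orthogonal to all polynomials, its positive and
negative parts, used as densities, give linear combinations of counts the same moments, hence by
analytic continuation the same characteristic functions, and so coincide. Cyclicity holds because
K⁺(φ) equals cM(φ) up to terms that do not raise the degree, and c ≠ 0.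

For an indicator of B, A^± act on polynomials in η(B) as weighted shifts, so K⁺ becomes a difference
operator that raises the degree. Its transpose for the negative binomial law lowers the degree;
hence the polynomials generated from 1 are orthogonal, and after normalisation they are the monic
Meixner polynomials. -/

theorem hasSum_ascPochhammer_mul_pow (a : ℝ) {q : ℝ} (hq0 : 0 ≤ q) (hq1 : q < 1) :
    HasSum (fun n : ℕ => q ^ n / n.factorial * (ascPochhammer ℝ n).eval a) ((1 - q) ^ (-a)) := by
  have hmem : q ∈ Metric.eball (0 : ℝ) 1 := by
    rw [Metric.mem_eball, edist_dist, dist_zero_right, Real.norm_eq_abs, abs_of_nonneg hq0]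
    exact ENNReal.ofReal_lt_one.2 hq1
  have h := (Real.one_div_one_sub_rpow_hasFPowerSeriesOnBall_zero a).hasSum hmem
  rw [zero_add, one_div, ← Real.rpow_neg (by linarith)] at h
  refine h.congr_fun fun n => ?_
  rw [FormalMultilinearSeries.ofScalars_apply_eq, ← Ring.multichoose_eq]
  have h2 := Ring.factorial_nsmul_multichoose_eq_ascPochhammer a n
  rw [ascPochhammer_smeval_eq_eval, nsmul_eq_mul] at h2
  have : (n.factorial : ℝ) ≠ 0 := by positivity
  rw [← h2, smul_eq_mul]
  field_simp

variable {a p : ℝ}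

theorem hasSum_negBinWeight (a : ℝ) (hp0 : 0 < p) (hp1 : p < 1) : HasSum (negBinWeight a p) 1 := by
  have h := (hasSum_ascPochhammer_mul_pow a hp0.le hp1).mul_left ((1 - p) ^ a)
  rw [← Real.rpow_add (by linarith), add_neg_cancel, Real.rpow_zero] at h
  exact h.congr_fun fun n => by rw [negBinWeight, mul_assoc]

/-- The factor e^{tn} only replaces p by p e^t in the binomial series. -/
theorem summable_negBinWeight_mul_exp (a : ℝ) (hp0 : 0 < p) {t : ℝ} (ht : p * Real.exp t < 1) :
    Summable fun n : ℕ => negBinWeight a p n * Real.exp (t * n) := by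
  have h := (hasSum_ascPochhammer_mul_pow a (by positivity) ht).summable.mul_left ((1 - p) ^ a)
  refine h.congr fun n => ?_
  rw [negBinWeight, mul_comm t, Real.exp_nat_mul, mul_pow]
  ring

theorem negBinWeight_pos (ha : 0 < a) (hp0 : 0 < p) (hp1 : p < 1) (n : ℕ) :
    0 < negBinWeight a p n := by
  have := ascPochhammer_pos n a ha
  have : 0 < 1 - p := by linarith
  unfold negBinWeight
  positivity

/-- At parameter 0 the law is the point mass at 0, which allows sets of reference measure zero to be
treated like the others. -/
theorem negBinWeight_zero_left (n : ℕ) : negBinWeight 0 p n = if n = 0 then 1 else 0 := by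
  rw [negBinWeight, ascPochhammer_eval_zero]
  split_ifs with h <;> simp [h]

theorem negBinWeight_nonneg (ha : 0 ≤ a) (hp0 : 0 < p) (hp1 : p < 1) (n : ℕ) :
    0 ≤ negBinWeight a p n := by
  rcases ha.eq_or_lt with rfl | ha
  · rw [negBinWeight_zero_left]
    split_ifs <;> simp
  · exact (negBinWeight_pos ha hp0 hp1 n).le

/-- This first-order recursion, from (a)_{n+1} = (a)_n (a+n), is the source of the Mecke formula and
thus of all adjoint relations. -/
theorem negBinWeight_succ (a p : ℝ) (n : ℕ) :
    negBinWeight a p (n + 1) * (n + 1) = p * ((a + n) * negBinWeight a p n) := by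
  have : (n.factorial : ℝ) ≠ 0 := by positivity
  rw [negBinWeight, negBinWeight, ascPochhammer_succ_eval, Nat.factorial_succ]
  push_cast
  field_simp
  ring

/-- A function is exponentially integrable for the negative binomial law. -/
theorem exists_pos_mul_exp_lt_one (hp0 : 0 < p) (hp1 : p < 1) : ∃ t > 0, p * Real.exp t < 1 := by
  -- With this t, p e^t is the square root of p.
  refine ⟨-Real.log p / 2, by linarith [Real.log_neg hp0 hp1], ?_⟩
  have : p = Real.exp (Real.log p) := (Real.exp_log hp0).symm
  nth_rewrite 1 [this]
  rw [← Real.exp_add, Real.exp_lt_one_iff]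
  linarith [Real.log_neg hp0 hp1]

/-- Summation by parts: the difference equation of the weights. -/
theorem tsum_negBinWeight_smul {E : Type*} [AddCommGroup E] [TopologicalSpace E] [Module ℝ E]
    (a p : ℝ) (g : ℕ → E) :
    ∑' n : ℕ, (negBinWeight a p n * n) • g n =
      ∑' n : ℕ, (p * ((a + n) * negBinWeight a p n)) • g (n + 1) := by
  simp_rw [← negBinWeight_succ]
  symm
  -- The term at 0 carries the factor n, so the support lies in the range of the successor map and
  -- no boundary term appears.
  have h := Nat.succ_injective.tsum_eq (f := fun n : ℕ => (negBinWeight a p n * n) • g n)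
    fun n hn => by
      rcases n with _ | n
      · simp at hn
      · exact ⟨n, rfl⟩
  simpa using h

theorem tsum_negBinWeight_mul (a p : ℝ) (g : ℝ → ℂ) :
    ∑' n : ℕ, negBinWeight a p n • ((n : ℂ) * g n) =
      p * ∑' n : ℕ, negBinWeight a p n • (((a : ℂ) + n) * g (n + 1)) := by
  have h := tsum_negBinWeight_smul a p fun n : ℕ => g n
  rw [← tsum_mul_left]
  refine (tsum_congr fun n => ?_).trans (h.trans (tsum_congr fun n => ?_))
  · simp only [Complex.real_smul]
    push_cast
    ring
  · simp only [Complex.real_smul]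
    push_cast
    ring

end

section

variable {X : Type*} [MeasurableSpace X] {α : Measure X} {p : ℝ} {ρ : Measure (Config X)}
  {B : Set X}

/-! ### Counting variables of the Pascal process -/

theorem measurable_count (hB : MeasurableSet B) : Measurable fun η : Config X => η.1 B :=
  (Measure.measurable_coe hB).comp measurable_subtype_coe

theorem IsPascalLaw.law_of_lt_top (hρ : IsPascalLaw p α ρ) (hB : MeasurableSet B) (hα : α B < ∞)
    (n : ℕ) : ρ {η : Config X | η.1 B = n} = ENNReal.ofReal (negBinWeight (α B).toReal p n) := by
  rcases eq_or_ne (α B) 0 with h | h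
  · have := hρ.isProbabilityMeasure
    have h0 := hρ.law_zero B hB h
    rw [h, ENNReal.toReal_zero, negBinWeight_zero_left]
    split_ifs with hn
    · subst hn
      rw [ENNReal.ofReal_one, ← measure_univ (μ := ρ)]
      refine measure_congr ?_
      filter_upwards [h0] with η hη
      exact eq_true (show η.1 B = ((0 : ℕ) : ℝ≥0∞) by rw [hη, Nat.cast_zero])
    · rw [ENNReal.ofReal_zero, measure_eq_zero_iff_ae_notMem]
      filter_upwards [h0] with η hη hη'
      replace hη' : η.1 B = (n : ℝ≥0∞) := hη'
      rw [hη] at hη'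
      exact hn (by exact_mod_cast hη'.symm)
  · exact hρ.law B hB (pos_iff_ne_zero.2 h) hα n

/-- The natural numbers already carry total mass 1, which leaves nothing for other values, in
particular for ∞. -/
theorem IsPascalLaw.ae_count_eq (hρ : IsPascalLaw p α ρ) (hp0 : 0 < p) (hp1 : p < 1)
    (hB : MeasurableSet B) (hα : α B < ∞) : ∀ᵐ η ∂ρ, ∃ n : ℕ, η.1 B = (n : ℝ≥0∞) := by
  have := hρ.isProbabilityMeasure
  have hms : ∀ n : ℕ, MeasurableSet {η : Config X | η.1 B = n} := fun n =>
    measurable_count hB (measurableSet_singleton _)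
  have h : ρ (⋃ n : ℕ, {η : Config X | η.1 B = n}) = 1 := by
    rw [measure_iUnion (fun i j hij => Set.disjoint_left.2 fun η h1 h2 => hij ?_) hms]
    · simp_rw [hρ.law_of_lt_top hB hα]
      rw [← ENNReal.ofReal_tsum_of_nonneg
        (fun n => negBinWeight_nonneg ENNReal.toReal_nonneg hp0 hp1 n)
        (hasSum_negBinWeight _ hp0 hp1).summable, (hasSum_negBinWeight _ hp0 hp1).tsum_eq,
        ENNReal.ofReal_one]
    · rw [Set.mem_ofPred_eq] at h1 h2
      rw [h1] at h2
      exact_mod_cast h2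
  have h2 := (prob_compl_eq_zero_iff (MeasurableSet.iUnion hms)).2 h
  filter_upwards [compl_mem_ae_iff.2 h2] with η hη
  simpa using hη

theorem IsPascalLaw.ae_count_lt_top (hρ : IsPascalLaw p α ρ) (hp0 : 0 < p) (hp1 : p < 1)
    (hB : MeasurableSet B) (hα : α B < ∞) : ∀ᵐ η ∂ρ, η.1 B < ∞ := by
  filter_upwards [hρ.ae_count_eq hp0 hp1 hB hα] with η ⟨n, hn⟩
  rw [hn]
  exact ENNReal.natCast_lt_top n

theorem measurable_count_toReal (hB : MeasurableSet B) :
    Measurable fun η : Config X => (η.1 B).toReal :=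
  (measurable_count hB).ennreal_toReal

/-- The law of a counting variable. -/
theorem IsPascalLaw.map_count (hρ : IsPascalLaw p α ρ) (hp0 : 0 < p) (hp1 : p < 1)
    (hB : MeasurableSet B) (hα : α B < ∞) :
    ρ.map (fun η => (η.1 B).toReal) = Measure.sum fun n : ℕ =>
      ENNReal.ofReal (negBinWeight (α B).toReal p n) • Measure.dirac (n : ℝ) := by
  ext E hE
  have hms : ∀ n : ℕ, MeasurableSet {η : Config X | η.1 B = n} := fun n =>
    measurable_count hB (measurableSet_singleton _)
  rw [Measure.map_apply (measurable_count_toReal hB) hE, Measure.sum_apply _ hE]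
  have h1 : (fun η : Config X => (η.1 B).toReal) ⁻¹' E =ᵐ[ρ]
      ⋃ n : ℕ, ({η : Config X | η.1 B = n} ∩ {_η : Config X | (n : ℝ) ∈ E} : Set (Config X)) := by
    filter_upwards [hρ.ae_count_eq hp0 hp1 hB hα] with η ⟨n, hn⟩
    refine propext ?_
    change (η.1 B).toReal ∈ E ↔ η ∈
      ⋃ n : ℕ, ({η : Config X | η.1 B = n} ∩ {_η : Config X | (n : ℝ) ∈ E} : Set (Config X))
    simp only [Set.mem_iUnion, Set.mem_inter_iff, Set.mem_ofPred_eq, hn]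
    simp
  rw [measure_congr h1, measure_iUnion]
  · refine tsum_congr fun n => ?_
    rw [Measure.smul_apply, Measure.dirac_apply' _ hE, ← hρ.law_of_lt_top hB hα, smul_eq_mul]
    by_cases h : (n : ℝ) ∈ E <;> simp [h]
  · intro i j hij
    refine Set.disjoint_left.2 fun η h1 h2 => hij ?_
    have h1 := h1.1
    have h2 := h2.1
    rw [Set.mem_ofPred_eq] at h1 h2
    rw [h1] at h2
    exact_mod_cast h2
  · exact fun n => (hms n).inter (MeasurableSet.const _)

theorem IsPascalLaw.integral_count (hρ : IsPascalLaw p α ρ) (hp0 : 0 < p) (hp1 : p < 1)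
    (hB : MeasurableSet B) (hα : α B < ∞) {g : ℝ → ℂ} (hg : Continuous g) :
    ∫ η, g (η.1 B).toReal ∂ρ = ∑' n : ℕ, negBinWeight (α B).toReal p n • g n := by
  rw [← integral_map (measurable_count_toReal hB).aemeasurable hg.aestronglyMeasurable,
    hρ.map_count hp0 hp1 hB hα, integral_sum_dirac fun n => ENNReal.ofReal_ne_top]
  refine tsum_congr fun n => ?_
  rw [ENNReal.toReal_ofReal (negBinWeight_nonneg ENNReal.toReal_nonneg hp0 hp1 n)]

/-- The Mecke formula for one counting variable. -/
theorem IsPascalLaw.integral_count_mul (hρ : IsPascalLaw p α ρ) (hp0 : 0 < p) (hp1 : p < 1)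
    (hB : MeasurableSet B) (hα : α B < ∞) {g : ℝ → ℂ} (hg : Continuous g) :
    ∫ η, ((η.1 B).toReal : ℂ) * g (η.1 B).toReal ∂ρ =
      p * ∫ η, (((α B).toReal : ℂ) + (η.1 B).toReal) * g ((η.1 B).toReal + 1) ∂ρ := by
  rw [hρ.integral_count hp0 hp1 hB hα (g := fun x => (x : ℂ) * g x) (by fun_prop),
    hρ.integral_count hp0 hp1 hB hα (g := fun x => (((α B).toReal : ℂ) + x) * g (x + 1))
      (by fun_prop)]
  exact_mod_cast tsum_negBinWeight_mul (α B).toReal p g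

/-- Counting variables have exponential moments. -/
theorem IsPascalLaw.exists_integrable_exp (hρ : IsPascalLaw p α ρ) (hp0 : 0 < p) (hp1 : p < 1)
    (hB : MeasurableSet B) (hα : α B < ∞) :
    ∃ t > 0, Integrable (fun η => Real.exp (t * (η.1 B).toReal)) ρ := by
  obtain ⟨t, ht, hpt⟩ := exists_pos_mul_exp_lt_one hp0 hp1
  refine ⟨t, ht, ?_⟩
  have hc : Continuous fun x : ℝ => Real.exp (t * x) := by fun_prop
  have h : Integrable (fun x : ℝ => Real.exp (t * x)) (ρ.map fun η => (η.1 B).toReal) := by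
    rw [hρ.map_count hp0 hp1 hB hα]
    refine integrable_sum_dirac (fun n => ENNReal.ofReal_ne_top) ?_
    refine (summable_negBinWeight_mul_exp (α B).toReal hp0 hpt).congr fun n => ?_
    rw [ENNReal.toReal_ofReal (negBinWeight_nonneg ENNReal.toReal_nonneg hp0 hp1 n),
      Real.norm_eq_abs, abs_of_pos (Real.exp_pos _)]
  exact h.comp_measurable (measurable_count_toReal hB)

theorem IsPascalLaw.integrable_one_add_count_pow (hρ : IsPascalLaw p α ρ) (hp0 : 0 < p)
    (hp1 : p < 1) (hB : MeasurableSet B) (hα : α B < ∞) (k : ℕ) :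
    Integrable (fun η => (1 + (η.1 B).toReal) ^ k) ρ := by
  have := hρ.isProbabilityMeasure
  obtain ⟨t, ht, h⟩ := hρ.exists_integrable_exp hp0 hp1 hB hα
  -- The exponentials at t and -t both have to be integrable: the first is an exponential moment,
  -- the second is bounded by 1.
  refine integrable_pow_of_integrable_exp_mul ht.ne' ?_ ?_ k
  · simp_rw [mul_add, Real.exp_add]
    exact h.const_mul _
  · refine Integrable.of_bound (C := 1) ?_ ?_
    · have := measurable_count_toReal hB
      exact Measurable.aestronglyMeasurable (by fun_prop)
    · refine Filter.Eventually.of_forall fun η => ?_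
      rw [Real.norm_eq_abs, abs_of_pos (Real.exp_pos _), Real.exp_le_one_iff]
      have : 0 ≤ (η.1 B).toReal := ENNReal.toReal_nonneg
      nlinarith

end

section

/-! ### Monic Meixner polynomials -/

theorem cConst_pos {p : ℝ} (hp0 : 0 < p) (hp1 : p < 1) : 0 < cConst p := by
  have h1 : 0 < √p := Real.sqrt_pos.2 hp0
  have h2 : √p < 1 := by rw [Real.sqrt_lt' one_pos]; simpa using hp1
  have : 1 < (√p)⁻¹ := (one_lt_inv₀ h1).2 h2
  unfold cConst
  linarith

theorem cConst_sq {p : ℝ} (hp0 : 0 < p) : cConst p ^ 2 = p + p⁻¹ - 2 := by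
  have h1 : √p ≠ 0 := (Real.sqrt_pos.2 hp0).ne'
  have h2 : √p ^ 2 = p := Real.sq_sqrt hp0.le
  rw [cConst, sub_sq, inv_pow, h2, mul_assoc, inv_mul_cancel₀ h1]
  ring

/-- The raising operator on polynomials in one counting variable, up to a constant factor. -/
noncomputable def raisePoly (a p : ℝ) (P : ℝ[X]) : ℝ[X] :=
  C p * ((X + C a) * taylor 1 P) + C p⁻¹ * (X * taylor (-1) P) - (C 2 * X + C a) * P

/-- The lowering operator on polynomials in one counting variable, up to a constant factor. -/
noncomputable def lowerPoly (a : ℝ) (P : ℝ[X]) : ℝ[X] :=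
  (X + C a) * taylor 1 P + X * taylor (-1) P - (C 2 * X + C a) * P

/-- The monic Meixner polynomials, generated by the raising operator. -/
noncomputable def meixner (a p : ℝ) : ℕ → ℝ[X]
  | 0 => 1
  | n + 1 => C (cConst p ^ 2)⁻¹ * raisePoly a p (meixner a p n)

theorem taylor_eval_one (P : ℝ[X]) (x : ℝ) : (taylor 1 P).eval x = P.eval (x + 1) := by
  rw [taylor_eval]

theorem degree_const_mul_le (r : ℝ) (P : ℝ[X]) : (C r * P).degree ≤ P.degree := by
  rw [← smul_eq_C_mul]
  exact degree_smul_le r P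

theorem degree_linear_mul_lt {P : ℝ[X]} {n : ℕ} (u v : ℝ) (hP : P.degree < n) :
    ((C u * X + C v) * P).degree < ((n + 1 : ℕ) : WithBot ℕ) := by
  rcases eq_or_ne P 0 with rfl | h
  · simp
  refine (degree_mul_le _ _).trans_lt ?_
  have h1 : (C u * X + C v : ℝ[X]).degree ≤ 1 := degree_linear_le
  rw [degree_eq_natDegree h] at hP ⊢
  refine (add_le_add_left h1 _).trans_lt ?_
  have : P.natDegree < n := by exact_mod_cast hP
  exact_mod_cast (by omega : 1 + P.natDegree < n + 1)

theorem degree_taylor_sub_lt (r : ℝ) {P : ℝ[X]} {n : ℕ}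
    (hP : P.degree < ((n + 1 : ℕ) : WithBot ℕ)) :
    (taylor r P - P).degree < n := by
  rcases eq_or_ne P 0 with rfl | h
  · simp
  have h1 : (taylor r P - P).degree < (taylor r P).degree :=
    degree_sub_lt_left (degree_taylor _ _) ((taylor_injective r).ne_iff' (map_zero _) |>.2 h)
      (leadingCoeff_taylor _ _)
  rw [degree_taylor] at h1
  refine h1.trans_le ?_
  rw [degree_eq_natDegree h] at hP ⊢
  have : P.natDegree < n + 1 := by exact_mod_cast hP
  exact_mod_cast (by omega : P.natDegree ≤ n)

/-- With Q(x) = P(x+1) - P(x) the operator is x (Q(x) - Q(x-1)) + a Q(x). The second difference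
loses two degrees and the factor x restores only one. -/
theorem degree_lowerPoly_lt (a : ℝ) {P : ℝ[X]} {n : ℕ} (hP : P.degree < ((n + 1 : ℕ) : WithBot ℕ)) :
    (lowerPoly a P).degree < n := by
  set Q := taylor 1 P - P with hQ
  have hQn : Q.degree < n := degree_taylor_sub_lt 1 hP
  have h : lowerPoly a P = (C 1 * X + C 0) * (Q - taylor (-1) Q) + C a * Q := by
    have : taylor (-1) Q = P - taylor (-1) P := by
      rw [hQ, map_sub, taylor_taylor]
      simp
    rw [this, hQ, lowerPoly]
    simp only [map_one, map_zero]
    have : (C (2 : ℝ)) = 2 := rfl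
    rw [this]
    ring
  rw [h]
  refine (degree_add_le _ _).trans_lt (max_lt ?_ ?_)
  · rcases n with _ | n
    · have : Q = 0 := by
        rw [← degree_eq_bot]
        simpa using hQn
      simp [this]
    · refine degree_linear_mul_lt 1 0 ?_
      rw [← degree_neg, neg_sub]
      exact degree_taylor_sub_lt (-1) hQn
  · exact (degree_const_mul_le _ _).trans_lt hQn

/-- The three terms contribute p, 1/p and -2 to the coefficient of X * P, in total c². All that
remains is a linear factor times a difference of P, or a multiple of P. -/
theorem raisePoly_monic {a p : ℝ} (hp0 : 0 < p) (hp1 : p < 1) {P : ℝ[X]} {n : ℕ} (hP : P.Monic)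
    (hn : P.natDegree = n) : (C (cConst p ^ 2)⁻¹ * raisePoly a p P).Monic ∧
      (C (cConst p ^ 2)⁻¹ * raisePoly a p P).natDegree = n + 1 := by
  have hc : cConst p ^ 2 ≠ 0 := (pow_pos (cConst_pos hp0 hp1) 2).ne'
  have key : C (cConst p ^ 2)⁻¹ * raisePoly a p P = X * P + C (cConst p ^ 2)⁻¹ *
      ((C p * X + C (p * a)) * (taylor 1 P - P) + (C p⁻¹ * X + C 0) * (taylor (-1) P - P)
        + C (p * a - a) * P) := by
    have h1 : (C (cConst p ^ 2)⁻¹ : ℝ[X]) * (C p + C p⁻¹ - C 2) = 1 := by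
      rw [← C_add, ← C_sub, ← C_mul, ← cConst_sq hp0, inv_mul_cancel₀ hc, C_1]
    simp only [raisePoly, C_mul, C_sub, C_0]
    linear_combination (X * P) * h1
  have hPd : P.degree < ((n + 1 : ℕ) : WithBot ℕ) := by
    rw [degree_eq_natDegree hP.ne_zero, hn]
    exact_mod_cast n.lt_succ_self
  have hlow : (C (cConst p ^ 2)⁻¹ *
      ((C p * X + C (p * a)) * (taylor 1 P - P) + (C p⁻¹ * X + C 0) * (taylor (-1) P - P)
        + C (p * a - a) * P)).degree < ((n + 1 : ℕ) : WithBot ℕ) := by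
    refine (degree_const_mul_le _ _).trans_lt ((degree_add_le _ _).trans_lt (max_lt
      ((degree_add_le _ _).trans_lt (max_lt ?_ ?_)) ?_))
    · exact degree_linear_mul_lt _ _ (degree_taylor_sub_lt 1 hPd)
    · exact degree_linear_mul_lt _ _ (degree_taylor_sub_lt (-1) hPd)
    · exact (degree_const_mul_le _ _).trans_lt hPd
  have hXP : (X * P).Monic := monic_X.mul hP
  have hXPn : (X * P).natDegree = n + 1 := by
    rw [monic_X.natDegree_mul hP, natDegree_X, hn, add_comm]
  have hlt : (C (cConst p ^ 2)⁻¹ *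
      ((C p * X + C (p * a)) * (taylor 1 P - P) + (C p⁻¹ * X + C 0) * (taylor (-1) P - P)
        + C (p * a - a) * P)).degree < (X * P).degree := by
    rwa [degree_eq_natDegree hXP.ne_zero, hXPn]
  rw [key]
  exact ⟨hXP.add_of_left hlt, by
    rw [natDegree_add_eq_left_of_degree_lt hlt, hXPn]⟩

theorem meixner_monic {a p : ℝ} (hp0 : 0 < p) (hp1 : p < 1) (n : ℕ) :
    (meixner a p n).Monic ∧ (meixner a p n).natDegree = n := by
  induction n with
  | zero => exact ⟨monic_one, natDegree_one⟩
  | succ n ih => exact raisePoly_monic hp0 hp1 ih.1 ih.2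

theorem summable_negBinWeight_mul_eval {a p : ℝ} (ha : 0 ≤ a) (hp0 : 0 < p) (hp1 : p < 1)
    (P : ℝ[X]) : Summable fun n : ℕ => negBinWeight a p n * P.eval (n : ℝ) := by
  induction P using Polynomial.induction_on' with
  | add P Q hP hQ => simpa only [eval_add, mul_add] using hP.add hQ
  | monomial k r =>
    obtain ⟨t, ht, hpt⟩ := exists_pos_mul_exp_lt_one hp0 hp1
    refine Summable.of_norm_bounded
      ((summable_negBinWeight_mul_exp a hp0 hpt).mul_left (|r| * (k.factorial / t ^ k)))
      fun n => ?_
    have h1 : (t * n) ^ k / k.factorial ≤ Real.exp (t * n) :=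
      Real.pow_div_factorial_le_exp _ (by positivity) k
    have hw := negBinWeight_nonneg ha hp0 hp1 n
    have h2 : (n : ℝ) ^ k ≤ k.factorial / t ^ k * Real.exp (t * n) := by
      rw [div_le_iff₀ (by positivity), mul_pow] at h1
      rw [div_mul_eq_mul_div, le_div_iff₀ (by positivity)]
      linarith
    rw [eval_monomial, norm_mul, norm_mul, Real.norm_eq_abs, Real.norm_eq_abs, Real.norm_eq_abs,
      abs_of_nonneg hw, abs_of_nonneg (show (0 : ℝ) ≤ (n : ℝ) ^ k by positivity)]
    calc negBinWeight a p n * (|r| * (n : ℝ) ^ k)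
        ≤ negBinWeight a p n * (|r| * (k.factorial / t ^ k * Real.exp (t * n))) := by gcongr
      _ = _ := by ring

/-- The expectation of a polynomial for the negative binomial law. -/
noncomputable def negBinMoment (a p : ℝ) (P : ℝ[X]) : ℝ :=
  ∑' n : ℕ, negBinWeight a p n * P.eval (n : ℝ)

section

variable {a p : ℝ}

theorem negBinMoment_add (ha : 0 ≤ a) (hp0 : 0 < p) (hp1 : p < 1) (P Q : ℝ[X]) :
    negBinMoment a p (P + Q) = negBinMoment a p P + negBinMoment a p Q := by
  simp only [negBinMoment, eval_add, mul_add]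
  exact (summable_negBinWeight_mul_eval ha hp0 hp1 P).tsum_add
    (summable_negBinWeight_mul_eval ha hp0 hp1 Q)

theorem negBinMoment_C_mul (r : ℝ) (P : ℝ[X]) :
    negBinMoment a p (C r * P) = r * negBinMoment a p P := by
  simp only [negBinMoment, eval_mul, eval_C, ← tsum_mul_left]
  exact tsum_congr fun n => by ring

/-- Summation by parts in polynomial form. Apart from convergence, it is all that is needed about
the weights to transpose `raisePoly`. -/
theorem negBinMoment_X_mul (P : ℝ[X]) :
    negBinMoment a p (X * P) = p * negBinMoment a p ((X + C a) * taylor 1 P) := by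
  have h := tsum_negBinWeight_smul a p fun n : ℕ => P.eval (n : ℝ)
  simp only [negBinMoment, ← tsum_mul_left, eval_mul, eval_X, eval_add, eval_C, taylor_eval_one]
  simp only [smul_eq_mul] at h
  refine (tsum_congr fun n => ?_).trans (h.trans (tsum_congr fun n => ?_))
  · ring
  · push_cast
    ring

/-- Summation by parts for P(x-1)Q(x) and for P(x)Q(x-1) turns the down-shift of P into the up-shift
of Q and conversely; the factors p and 1/p cancel, and the multiplication term is symmetric. -/
theorem negBinMoment_raisePoly_mul (ha : 0 ≤ a) (hp0 : 0 < p) (hp1 : p < 1) (P Q : ℝ[X]) :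
    negBinMoment a p (raisePoly a p P * Q) = negBinMoment a p (P * lowerPoly a Q) := by
  have h1 := negBinMoment_X_mul (a := a) (p := p) (taylor (-1) P * Q)
  have h2 := negBinMoment_X_mul (a := a) (p := p) (P * taylor (-1) Q)
  have hs : ∀ R : ℝ[X], taylor 1 (taylor (-1) R) = R := fun R => by
    rw [taylor_taylor]; simp
  rw [taylor_mul, hs] at h1 h2
  have e1 : raisePoly a p P * Q = C p * ((X + C a) * (taylor 1 P * Q)) +
      (C p⁻¹ * (X * (taylor (-1) P * Q)) + C (-1) * ((C 2 * X + C a) * P * Q)) := by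
    rw [raisePoly, C_neg, C_1]
    ring
  have e2 : P * lowerPoly a Q = (X + C a) * (P * taylor 1 Q) + (X * (P * taylor (-1) Q) +
      C (-1) * ((C 2 * X + C a) * P * Q)) := by
    rw [lowerPoly, C_neg, C_1]
    ring
  rw [e1, e2]
  simp only [negBinMoment_add ha hp0 hp1, negBinMoment_C_mul, h1, h2]
  field_simp
  ring

/-- Moved over to Q, the n raising steps become n lowering steps, which annihilate every polynomial
of degree less than n. -/
theorem negBinMoment_meixner_mul (ha : 0 ≤ a) (hp0 : 0 < p) (hp1 : p < 1) (n : ℕ) {Q : ℝ[X]}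
    (hQ : Q.degree < n) : negBinMoment a p (meixner a p n * Q) = 0 := by
  induction n generalizing Q with
  | zero =>
    have : Q = 0 := by
      rw [← degree_eq_bot]
      simpa using hQ
    simp [this, negBinMoment]
  | succ n ih =>
    rw [meixner, mul_assoc, negBinMoment_C_mul, negBinMoment_raisePoly_mul ha hp0 hp1,
      ih (degree_lowerPoly_lt a hQ), mul_zero]

theorem hasSum_negBinMoment (ha : 0 ≤ a) (hp0 : 0 < p) (hp1 : p < 1) (P Q : ℝ[X]) :
    HasSum (fun n : ℕ => negBinWeight a p n * (P.eval (n : ℝ) * Q.eval (n : ℝ)))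
      (negBinMoment a p (P * Q)) := by
  simp only [← eval_mul]
  exact (summable_negBinWeight_mul_eval ha hp0 hp1 _).hasSum

theorem isMonicMeixner_meixner (ha : 0 ≤ a) (hp0 : 0 < p) (hp1 : p < 1) :
    IsMonicMeixner a p (meixner a p) where
  natDegree_eq n := (meixner_monic hp0 hp1 n).2
  monic n := (meixner_monic hp0 hp1 n).1
  orthogonal m n hmn := by
    have hdeg : ∀ m n : ℕ, m < n → (meixner a p m).degree < n := fun m n h => by
      rw [degree_eq_natDegree (meixner_monic hp0 hp1 m).1.ne_zero, (meixner_monic hp0 hp1 m).2]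
      exact_mod_cast h
    have h := hasSum_negBinMoment ha hp0 hp1 (meixner a p m) (meixner a p n)
    rcases hmn.lt_or_gt with h1 | h1
    · rwa [mul_comm (meixner a p m), negBinMoment_meixner_mul ha hp0 hp1 n (hdeg m n h1)] at h
    · rwa [negBinMoment_meixner_mul ha hp0 hp1 m (hdeg n m h1)] at h

/-- The members of the family below index k span all polynomials of degree less than k. The bound k
is separate from n so that the induction can strip off one leading term at a time. -/
theorem IsMonicMeixner.negBinMoment_mul (ha : 0 ≤ a) (hp0 : 0 < p) (hp1 : p < 1) {M : ℕ → ℝ[X]}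
    (hM : IsMonicMeixner a p M) (n k : ℕ) (hk : k ≤ n) {Q : ℝ[X]} (hQ : Q.degree < k) :
    negBinMoment a p (M n * Q) = 0 := by
  induction k generalizing Q with
  | zero =>
    have : Q = 0 := by
      rw [← degree_eq_bot]
      simpa using hQ
    simp [this, negBinMoment]
  | succ k ih =>
    have h1 : (Q + C (-Q.coeff k) * M k).degree < k := by
      have hle : (Q + C (-Q.coeff k) * M k).degree ≤ k := by
        refine (degree_add_le _ _).trans (max_le ?_ ?_)
        · rcases eq_or_ne Q 0 with h | h
          · simp [h]
          · rw [degree_eq_natDegree h] at hQ ⊢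
            have : Q.natDegree < k + 1 := by exact_mod_cast hQ
            exact_mod_cast (by omega : Q.natDegree ≤ k)
        · refine (degree_const_mul_le _ _).trans ?_
          rw [degree_eq_natDegree (hM.monic k).ne_zero, hM.natDegree_eq]
      refine lt_of_le_of_ne hle fun h => ?_
      have h0 : (Q + C (-Q.coeff k) * M k).coeff k = 0 := by
        have := (hM.monic k).coeff_natDegree
        rw [hM.natDegree_eq] at this
        rw [coeff_add, coeff_C_mul, this]
        ring
      exact coeff_ne_zero_of_eq_degree h h0
    have h2 := ih (by omega) h1
    have h3 : negBinMoment a p (M n * M k) = 0 :=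
      (hasSum_negBinMoment ha hp0 hp1 _ _).unique (hM.orthogonal n k (by omega))
    rw [mul_add, mul_left_comm, negBinMoment_add ha hp0 hp1, negBinMoment_C_mul, h3, mul_zero,
      add_zero] at h2
    exact h2

/-- The difference of two monic candidates has degree below n, so it is orthogonal to both and hence
to itself. As the weights are positive, it vanishes at every natural number. -/
theorem IsMonicMeixner.eq_meixner (ha : 0 < a) (hp0 : 0 < p) (hp1 : p < 1) {M : ℕ → ℝ[X]}
    (hM : IsMonicMeixner a p M) : M = meixner a p := by
  funext n
  have hm := isMonicMeixner_meixner ha.le hp0 hp1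
  set D := M n - meixner a p n with hD
  have hdeg : D.degree < n := by
    have h := degree_sub_lt_left (p := M n) (q := meixner a p n) (by
      rw [degree_eq_natDegree (hM.monic n).ne_zero, degree_eq_natDegree (hm.monic n).ne_zero,
        hM.natDegree_eq, hm.natDegree_eq]) (hM.monic n).ne_zero
      (by rw [(hM.monic n).leadingCoeff, (hm.monic n).leadingCoeff])
    rwa [degree_eq_natDegree (hM.monic n).ne_zero, hM.natDegree_eq] at h
  have h1 := hM.negBinMoment_mul ha.le hp0 hp1 n n le_rfl hdeg
  have h2 := hm.negBinMoment_mul ha.le hp0 hp1 n n le_rfl hdeg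
  have h3 : negBinMoment a p (D * D) = 0 := by
    have : D * D = M n * D + C (-1) * (meixner a p n * D) := by
      rw [C_neg, C_1, hD]
      ring
    rw [this, negBinMoment_add ha.le hp0 hp1, negBinMoment_C_mul, h1, h2]
    ring
  have h4 := hasSum_negBinMoment ha.le hp0 hp1 D D
  rw [h3, hasSum_zero_iff_of_nonneg fun k => mul_nonneg (negBinWeight_pos ha hp0 hp1 k).le
    (mul_self_nonneg _)] at h4
  have h5 : D = 0 := by
    refine eq_zero_of_infinite_isRoot D ((Set.infinite_range_of_injective
      (Nat.cast_injective (R := ℝ))).mono ?_)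
    rintro _ ⟨k, rfl⟩
    have := congrFun h4 k
    simpa [(negBinWeight_pos ha hp0 hp1 k).ne'] using this
  exact sub_eq_zero.1 h5

end

end

section

/-! ### The algebra of shift and multiplication operators -/

/-- Linear families of operators on `D`: `Ap` and `Am` behave like integrals of the shifts that add
or remove a point, and `M` like multiplication by linear functionals of the configuration. -/
structure IsShiftSystem {𝒞 D : Type*} [NonUnitalCommRing 𝒞] [Module ℂ 𝒞] [AddCommGroup D]
    [Module ℂ D] (Ap Am M : 𝒞 →ₗ[ℂ] Module.End ℂ D) (a : 𝒞 →ₗ[ℂ] ℂ) (Ψ : D) : Prop where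
  add_mul : ∀ φ ψ v, Ap φ (M ψ v) = M ψ (Ap φ v) + Ap (φ * ψ) v
  sub_mul : ∀ φ ψ v, Am φ (M ψ v) = M ψ (Am φ v) - Am (φ * ψ) v
  mul_comm : ∀ φ ψ v, M φ (M ψ v) = M ψ (M φ v)
  add_vacuum : ∀ φ, Ap φ Ψ = a φ • Ψ + M φ Ψ
  sub_vacuum : ∀ φ, Am φ Ψ = M φ Ψ
  eq_top : ∀ W : Submodule ℂ D, Ψ ∈ W → (∀ φ, ∀ v ∈ W, M φ v ∈ W) → W = ⊤

namespace IsShiftSystem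

variable {𝒞 D : Type*} [NonUnitalCommRing 𝒞] [Module ℂ 𝒞] [AddCommGroup D] [Module ℂ D]
  {Ap Am M : 𝒞 →ₗ[ℂ] Module.End ℂ D} {a : 𝒞 →ₗ[ℂ] ℂ} {Ψ : D}

/-- Families of operators that vanish on the vacuum, and whose zeros are preserved by `M`, are
zero. -/
theorem eq_zero_of_vacuum (h : IsShiftSystem Ap Am M a Ψ) (C : 𝒞 → 𝒞 → Module.End ℂ D)
    (h0 : ∀ φ θ, C φ θ Ψ = 0)
    (hM : ∀ ψ v, (∀ φ θ, C φ θ v = 0) → ∀ φ θ, C φ θ (M ψ v) = 0) (φ θ : 𝒞) : C φ θ = 0 := by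
  -- The common kernel contains the vacuum and is stable under M. All pairs φ, θ are taken together
  -- because passing M ψ multiplies the arguments by ψ.
  have hW := h.eq_top (⨅ φ, ⨅ θ, LinearMap.ker (C φ θ)) (by simpa using h0) (by simpa using hM)
  ext v
  have : v ∈ (⨅ φ, ⨅ θ, LinearMap.ker (C φ θ)) := hW ▸ Submodule.mem_top
  simp only [Submodule.mem_iInf, LinearMap.mem_ker] at this
  exact this φ θ

/-- The multiplication operators `2 η(φ) + α(φ)`. -/
noncomputable def mulOp (M : 𝒞 →ₗ[ℂ] Module.End ℂ D) (a : 𝒞 →ₗ[ℂ] ℂ) : 𝒞 →ₗ[ℂ] Module.End ℂ D :=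
  (2 : ℂ) • M + a.smulRight 1

theorem mulOp_apply (φ : 𝒞) (v : D) : mulOp M a φ v = (2 : ℂ) • M φ v + a φ • v := by
  simp [mulOp]

/-- Passing M ψ through the commutator only produces commutators in which φ or θ is multiplied by ψ.
On the vacuum the two orders agree by symmetry. -/
theorem lie_add_add (h : IsShiftSystem Ap Am M a Ψ) (φ θ : 𝒞) : ⁅Ap φ, Ap θ⁆ = 0 := by
  refine h.eq_zero_of_vacuum (fun φ θ => ⁅Ap φ, Ap θ⁆) (fun φ θ => ?_) (fun ψ v hv φ θ => ?_) φ θ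
  · simp only [Ring.lie_def, LinearMap.sub_apply, Module.End.mul_apply, h.add_vacuum, map_add,
      map_smul, h.add_mul]
    rw [h.mul_comm φ θ, _root_.mul_comm φ θ]
    module
  · have h1 := hv (φ * ψ) θ
    have h2 := hv φ (θ * ψ)
    have h3 := congrArg (M ψ) (hv φ θ)
    simp only [Ring.lie_def, LinearMap.sub_apply, Module.End.mul_apply, map_add, map_sub,
      map_zero, h.add_mul] at h1 h2 h3 ⊢
    linear_combination (norm := module) h1 + h2 + h3

theorem lie_sub_sub (h : IsShiftSystem Ap Am M a Ψ) (φ θ : 𝒞) : ⁅Am φ, Am θ⁆ = 0 := by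
  refine h.eq_zero_of_vacuum (fun φ θ => ⁅Am φ, Am θ⁆) (fun φ θ => ?_) (fun ψ v hv φ θ => ?_) φ θ
  · simp only [Ring.lie_def, LinearMap.sub_apply, Module.End.mul_apply, h.sub_vacuum, h.sub_mul]
    rw [h.mul_comm φ θ, _root_.mul_comm φ θ]
    module
  · have h1 := hv (φ * ψ) θ
    have h2 := hv φ (θ * ψ)
    have h3 := congrArg (M ψ) (hv φ θ)
    simp only [Ring.lie_def, LinearMap.sub_apply, Module.End.mul_apply, map_sub,
      map_zero, h.sub_mul] at h1 h2 h3 ⊢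
    linear_combination (norm := module) h3 - h1 - h2

/-- On the vacuum, moving Ap and Am past M gives M(φθ) twice with the same sign, and Ap of the
vacuum gives a(φθ). When M ψ is passed through, the two extra commutators both equal the
multiplication operator of φθψ and cancel. -/
theorem lie_add_sub (h : IsShiftSystem Ap Am M a Ψ) (φ θ : 𝒞) :
    ⁅Ap φ, Am θ⁆ = mulOp M a (φ * θ) := by
  rw [← sub_eq_zero]
  refine h.eq_zero_of_vacuum (fun φ θ => ⁅Ap φ, Am θ⁆ - mulOp M a (φ * θ)) (fun φ θ => ?_)
    (fun ψ v hv φ θ => ?_) φ θ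
  · simp only [Ring.lie_def, LinearMap.sub_apply, Module.End.mul_apply, h.sub_vacuum,
      h.add_vacuum, map_add, map_smul, h.add_mul, h.sub_mul, mulOp_apply]
    rw [h.mul_comm φ θ, _root_.mul_comm φ θ]
    module
  · have h1 := hv (φ * ψ) θ
    have h2 := hv φ (θ * ψ)
    have h3 := congrArg (M ψ) (hv φ θ)
    have e1 : φ * ψ * θ = φ * θ * ψ := by rw [mul_assoc, _root_.mul_comm ψ, ← mul_assoc]
    simp only [Ring.lie_def, LinearMap.sub_apply, Module.End.mul_apply, map_add, map_sub,
      map_zero, map_smul, h.add_mul, h.sub_mul, mulOp_apply, ← mul_assoc, e1] at h1 h2 h3 ⊢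
    rw [h.mul_comm (φ * θ) ψ]
    linear_combination (norm := module) h3 + h1 - h2

theorem lie_add_mulOp (h : IsShiftSystem Ap Am M a Ψ) (φ θ : 𝒞) :
    ⁅Ap φ, mulOp M a θ⁆ = (2 : ℂ) • Ap (φ * θ) := by
  ext v
  simp only [Ring.lie_def, LinearMap.sub_apply, Module.End.mul_apply, map_add, map_smul,
    h.add_mul, mulOp_apply, LinearMap.smul_apply]
  module

theorem lie_sub_mulOp (h : IsShiftSystem Ap Am M a Ψ) (φ θ : 𝒞) :
    ⁅Am φ, mulOp M a θ⁆ = -(2 : ℂ) • Am (φ * θ) := by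
  ext v
  simp only [Ring.lie_def, LinearMap.sub_apply, Module.End.mul_apply, map_add, map_smul,
    h.sub_mul, mulOp_apply, LinearMap.smul_apply]
  module

theorem lie_mulOp_mulOp (h : IsShiftSystem Ap Am M a Ψ) (φ θ : 𝒞) :
    ⁅mulOp M a φ, mulOp M a θ⁆ = 0 := by
  ext v
  simp only [Ring.lie_def, LinearMap.sub_apply, Module.End.mul_apply, map_add, map_smul,
    mulOp_apply, LinearMap.zero_apply]
  rw [h.mul_comm φ θ]
  module

/-- The current `x Ap(φ) + y Am(φ) + z (2 M(φ) + a(φ))`. -/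
noncomputable def current (Ap Am M : 𝒞 →ₗ[ℂ] Module.End ℂ D) (a : 𝒞 →ₗ[ℂ] ℂ) (x y z : ℂ) :
    𝒞 →ₗ[ℂ] Module.End ℂ D :=
  x • Ap + y • Am + z • mulOp M a

theorem current_apply (x y z : ℂ) (φ : 𝒞) :
    current Ap Am M a x y z φ = x • Ap φ + y • Am φ + z • mulOp M a φ := rfl

/-- The currents form a current algebra. -/
theorem lie_current (h : IsShiftSystem Ap Am M a Ψ) (x y z x' y' z' : ℂ) (φ θ : 𝒞) :
    ⁅current Ap Am M a x y z φ, current Ap Am M a x' y' z' θ⁆ =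
      current Ap Am M a (2 * (x * z' - z * x')) (2 * (z * y' - y * z')) (x * y' - y * x')
        (φ * θ) := by
  have e1 := h.lie_add_add φ θ
  have e2 := h.lie_sub_sub φ θ
  have e3 := h.lie_mulOp_mulOp φ θ
  have e4 := h.lie_add_sub φ θ
  have e5 := h.lie_add_sub θ φ
  have e6 := h.lie_add_mulOp φ θ
  have e7 := h.lie_add_mulOp θ φ
  have e8 := h.lie_sub_mulOp φ θ
  have e9 := h.lie_sub_mulOp θ φ
  rw [_root_.mul_comm θ φ] at e5 e7 e9
  simp only [Ring.lie_def, current_apply, mul_add, _root_.add_mul, smul_mul_assoc,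
    mul_smul_comm] at e1 e2 e3 e4 e5 e6 e7 e8 e9 ⊢
  linear_combination (norm := module) (x * x') • e1 + (y * y') • e2 + (z * z') • e3 +
    (x * y') • e4 - (y * x') • e5 + (x * z') • e6 - (z * x') • e7 + (y * z') • e8 - (z * y') • e9

/-! ### Cyclicity of the vacuum -/

/-- The span of the products of at most `n` operators `M φ`, applied to the vacuum. -/
noncomputable def filtration (M : 𝒞 →ₗ[ℂ] Module.End ℂ D) (Ψ : D) : ℕ → Submodule ℂ D
  | 0 => Submodule.span ℂ {Ψ}
  | n + 1 => filtration M Ψ n ⊔ ⨆ φ, (filtration M Ψ n).map (M φ)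

theorem filtration_le_succ (M : 𝒞 →ₗ[ℂ] Module.End ℂ D) (Ψ : D) (n : ℕ) :
    filtration M Ψ n ≤ filtration M Ψ (n + 1) := le_sup_left

theorem mul_mem_filtration (M : 𝒞 →ₗ[ℂ] Module.End ℂ D) {Ψ : D} {n : ℕ} (φ : 𝒞) {v : D}
    (hv : v ∈ filtration M Ψ n) : M φ v ∈ filtration M Ψ (n + 1) :=
  (le_sup_right : _ ≤ filtration M Ψ (n + 1))
    (Submodule.mem_iSup_of_mem φ (Submodule.mem_map_of_mem hv))

theorem filtration_succ_le {n : ℕ} {W : Submodule ℂ D} (h1 : filtration M Ψ n ≤ W)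
    (h2 : ∀ φ, ∀ v ∈ filtration M Ψ n, M φ v ∈ W) : filtration M Ψ (n + 1) ≤ W :=
  sup_le h1 (iSup_le fun φ => Submodule.map_le_iff_le_comap.2 (h2 φ))

theorem iSup_filtration (h : IsShiftSystem Ap Am M a Ψ) : ⨆ n, filtration M Ψ n = ⊤ := by
  refine h.eq_top _ (Submodule.mem_iSup_of_mem 0 (Submodule.mem_span_singleton_self Ψ))
    fun φ v hv => ?_
  have h1 : (⨆ n, filtration M Ψ n) ≤ (⨆ n, filtration M Ψ n).comap (M φ) :=
    iSup_le fun n v hv => Submodule.mem_iSup_of_mem (n + 1) (mul_mem_filtration M φ hv)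
  exact h1 hv

/-- Moving Ap φ past M ψ costs only Ap (φ * ψ), which acts on one factor fewer; so Ap φ agrees with
M φ up to terms that do not raise the degree. -/
theorem add_sub_mul_mem (h : IsShiftSystem Ap Am M a Ψ) (n : ℕ) :
    ∀ v ∈ filtration M Ψ n, ∀ φ, Ap φ v - M φ v ∈ filtration M Ψ n := by
  suffices filtration M Ψ n ≤ ⨅ φ, (filtration M Ψ n).comap (Ap φ - M φ) by
    intro v hv φ
    exact (Submodule.mem_iInf _).1 (this hv) φ
  induction n with
  | zero =>
    refine (Submodule.span_singleton_le_iff_mem _ _).2 ((Submodule.mem_iInf _).2 fun φ => ?_)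
    rw [Submodule.mem_comap, LinearMap.sub_apply, h.add_vacuum, add_sub_cancel_right]
    exact Submodule.smul_mem _ _ (Submodule.mem_span_singleton_self Ψ)
  | succ n ih =>
    have ih' : ∀ v ∈ filtration M Ψ n, ∀ φ, Ap φ v - M φ v ∈ filtration M Ψ n :=
      fun v hv φ => (Submodule.mem_iInf _).1 (ih hv) φ
    refine filtration_succ_le (fun v hv => (Submodule.mem_iInf _).2 fun φ =>
      filtration_le_succ M Ψ n (ih' v hv φ)) fun ψ v hv => (Submodule.mem_iInf _).2 fun φ => ?_
    have e : (Ap φ - M φ) (M ψ v) =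
        M ψ (Ap φ v - M φ v) + ((Ap (φ * ψ) v - M (φ * ψ) v) + M (φ * ψ) v) := by
      rw [LinearMap.sub_apply, h.add_mul, h.mul_comm φ ψ, map_sub]
      abel
    rw [Submodule.mem_comap, e]
    exact add_mem (mul_mem_filtration M ψ (ih' v hv φ)) (add_mem
      (filtration_le_succ M Ψ n (ih' v hv _)) (mul_mem_filtration M _ hv))

theorem sub_sub_mul_mem (h : IsShiftSystem Ap Am M a Ψ) (n : ℕ) :
    ∀ v ∈ filtration M Ψ n, ∀ φ, Am φ v - M φ v ∈ filtration M Ψ n := by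
  suffices filtration M Ψ n ≤ ⨅ φ, (filtration M Ψ n).comap (Am φ - M φ) by
    intro v hv φ
    exact (Submodule.mem_iInf _).1 (this hv) φ
  induction n with
  | zero =>
    refine (Submodule.span_singleton_le_iff_mem _ _).2 ((Submodule.mem_iInf _).2 fun φ => ?_)
    rw [Submodule.mem_comap, LinearMap.sub_apply, h.sub_vacuum, sub_self]
    exact zero_mem _
  | succ n ih =>
    have ih' : ∀ v ∈ filtration M Ψ n, ∀ φ, Am φ v - M φ v ∈ filtration M Ψ n :=
      fun v hv φ => (Submodule.mem_iInf _).1 (ih hv) φ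
    refine filtration_succ_le (fun v hv => (Submodule.mem_iInf _).2 fun φ =>
      filtration_le_succ M Ψ n (ih' v hv φ)) fun ψ v hv => (Submodule.mem_iInf _).2 fun φ => ?_
    have e : (Am φ - M φ) (M ψ v) =
        M ψ (Am φ v - M φ v) - ((Am (φ * ψ) v - M (φ * ψ) v) + M (φ * ψ) v) := by
      rw [LinearMap.sub_apply, h.sub_mul, h.mul_comm φ ψ, map_sub]
      abel
    rw [Submodule.mem_comap, e]
    exact sub_mem (mul_mem_filtration M ψ (ih' v hv φ)) (add_mem
      (filtration_le_succ M Ψ n (ih' v hv _)) (mul_mem_filtration M _ hv))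

/-- To top order the three parts act as x, y and 2z times M φ; the term with a φ keeps the degree.
-/
theorem current_sub_mem (h : IsShiftSystem Ap Am M a Ψ) (x y z : ℂ) {n : ℕ} {v : D}
    (hv : v ∈ filtration M Ψ n) (φ : 𝒞) :
    current Ap Am M a x y z φ v - (x + y + 2 * z) • M φ v ∈ filtration M Ψ n := by
  have e : current Ap Am M a x y z φ v - (x + y + 2 * z) • M φ v =
      x • (Ap φ v - M φ v) + y • (Am φ v - M φ v) + (z * a φ) • v := by
    simp only [current_apply, LinearMap.add_apply, LinearMap.smul_apply, mulOp_apply]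
    module
  rw [e]
  exact add_mem (add_mem (Submodule.smul_mem _ _ (h.add_sub_mul_mem n v hv φ))
    (Submodule.smul_mem _ _ (h.sub_sub_mul_mem n v hv φ))) (Submodule.smul_mem _ _ hv)

/-- The words in a current that raises the degree generate everything from the vacuum. -/
theorem span_current_words (h : IsShiftSystem Ap Am M a Ψ) {x y z : ℂ} (hxyz : x + y + 2 * z ≠ 0) :
    Submodule.span ℂ {v : D | ∃ l : List 𝒞, v = (l.map (current Ap Am M a x y z)).prod Ψ} = ⊤ := by
  set W := Submodule.span ℂ {v : D | ∃ l : List 𝒞, v = (l.map (current Ap Am M a x y z)).prod Ψ}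
  have hW : ∀ φ, ∀ v ∈ W, current Ap Am M a x y z φ v ∈ W := by
    intro φ
    suffices W ≤ W.comap (current Ap Am M a x y z φ) from fun v hv => this hv
    refine Submodule.span_le.2 ?_
    rintro _ ⟨l, rfl⟩
    exact Submodule.subset_span ⟨φ :: l, rfl⟩
  rw [eq_top_iff, ← h.iSup_filtration]
  refine iSup_le fun n => ?_
  induction n with
  | zero =>
    exact (Submodule.span_singleton_le_iff_mem _ _).2 (Submodule.subset_span ⟨[], rfl⟩)
  | succ n ih =>
    refine filtration_succ_le ih fun φ v hv => ?_
    -- The leading coefficient is invertible, so M φ v is recovered from the current modulo the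
    -- previous filtration step, which the induction hypothesis covers.
    have e : M φ v = (x + y + 2 * z)⁻¹ • (current Ap Am M a x y z φ v -
        (current Ap Am M a x y z φ v - (x + y + 2 * z) • M φ v)) := by
      rw [sub_sub_cancel, smul_smul, inv_mul_cancel₀ hxyz, one_smul]
    rw [e]
    exact Submodule.smul_mem _ _ (sub_mem (hW φ v (ih hv)) (ih (h.current_sub_mem x y z hv φ)))

/-! ### Words in disjoint indicators -/

/-- For an idempotent the commutation rule reads Ap b M b = (M b + 1) Ap b, so Ap b passes a
polynomial in M b by shifting its variable. -/
theorem add_aeval (h : IsShiftSystem Ap Am M a Ψ) {b : 𝒞} (hb : b * b = b) (P : ℂ[X]) (v : D) :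
    Ap b (aeval (M b) P v) = aeval (M b) (taylor 1 P) (Ap b v) := by
  induction P using Polynomial.induction_on generalizing v with
  | C r => simp
  | add P Q hP hQ => simp only [map_add, LinearMap.add_apply, hP, hQ]
  | monomial n r ih =>
    rw [pow_succ, ← mul_assoc, map_mul, Module.End.mul_apply, aeval_X, ih, h.add_mul, hb,
      taylor_mul, map_mul, Module.End.mul_apply]
    simp [taylor_X]

theorem sub_aeval (h : IsShiftSystem Ap Am M a Ψ) {b : 𝒞} (hb : b * b = b) (P : ℂ[X]) (v : D) :
    Am b (aeval (M b) P v) = aeval (M b) (taylor (-1) P) (Am b v) := by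
  induction P using Polynomial.induction_on generalizing v with
  | C r => simp
  | add P Q hP hQ => simp only [map_add, LinearMap.add_apply, hP, hQ]
  | monomial n r ih =>
    rw [pow_succ, ← mul_assoc, map_mul, Module.End.mul_apply, aeval_X, ih, h.sub_mul, hb,
      taylor_mul, map_mul, Module.End.mul_apply]
    simp [taylor_X, sub_eq_add_neg]

/-- The corrections Ap(b b') and Am(b b') vanish: a point added or removed in one set does not
change the count of a disjoint one. -/
theorem current_commute (h : IsShiftSystem Ap Am M a Ψ) {b b' : 𝒞} (hb : b * b' = 0) (x y z : ℂ) :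
    Commute (current Ap Am M a x y z b) (M b') := by
  refine LinearMap.ext fun v => ?_
  simp only [current_apply, Module.End.mul_apply, LinearMap.add_apply, LinearMap.smul_apply,
    mulOp_apply, h.add_mul, h.sub_mul, hb, h.mul_comm b b', map_add, map_smul, map_zero,
    LinearMap.zero_apply, add_zero, sub_zero]

theorem commute_aeval {A : Type*} [Ring A] [Algebra ℂ A] {S T : A} (h : Commute S T) (P : ℂ[X]) :
    Commute S (aeval T P) := by
  induction P using Polynomial.induction_on' with
  | add P Q hP hQ => rw [map_add]; exact hP.add_right hQ
  | monomial n r =>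
    rw [aeval_monomial]
    exact (Algebra.commute_algebraMap_right r S).mul_right (h.pow_right n)

end IsShiftSystem

end

/-! ### Raising currents of idempotents and Meixner polynomials -/

section

namespace IsShiftSystem

variable {𝒞 D : Type*} [NonUnitalCommRing 𝒞] [Module ℂ 𝒞] [AddCommGroup D] [Module ℂ D]
  {Ap Am M : 𝒞 →ₗ[ℂ] Module.End ℂ D} {a : 𝒞 →ₗ[ℂ] ℂ} {Ψ : D}

/-- The raising current on polynomials in one idempotent. -/
theorem current_aeval (h : IsShiftSystem Ap Am M a Ψ) {b : 𝒞} (hb : b * b = b) {r p : ℝ}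
    (hr : a b = r) (c : ℂ) (P : ℝ[X]) :
    current Ap Am M a (c * p) (c * (p : ℂ)⁻¹) (-c) b (aeval (M b) (P.map Complex.ofRealHom) Ψ) =
      c • aeval (M b) ((raisePoly r p P).map Complex.ofRealHom) Ψ := by
  have hcomm : ∀ (Q : ℂ[X]) (v : D), aeval (M b) Q (M b v) = M b (aeval (M b) Q v) := fun Q v =>
    (LinearMap.congr_fun (commute_aeval (Commute.refl (M b)) Q).eq v).symm
  simp only [current_apply, LinearMap.add_apply, LinearMap.smul_apply, mulOp_apply,
    h.add_aeval hb, h.sub_aeval hb, h.add_vacuum, h.sub_vacuum, hr, raisePoly, Polynomial.map_sub,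
    Polynomial.map_add, Polynomial.map_mul, Polynomial.map_C, Polynomial.map_X,
    Polynomial.map_taylor,
    map_add, map_sub, map_mul, aeval_X, aeval_C, LinearMap.sub_apply, Module.End.mul_apply,
    Module.algebraMap_end_apply, map_smul, hcomm, smul_add, Complex.ofRealHom_eq_coe]
  push_cast
  module

theorem current_pow_vacuum (h : IsShiftSystem Ap Am M a Ψ) {b : 𝒞} (hb : b * b = b) {r p : ℝ}
    (hr : a b = r) (hp0 : 0 < p) (hp1 : p < 1) (n : ℕ) :
    (current Ap Am M a (1 / (cConst p : ℂ) * p) (1 / (cConst p : ℂ) * (p : ℂ)⁻¹)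
      (-(1 / (cConst p : ℂ))) b ^ n) Ψ =
      aeval (M b) ((C (cConst p ^ n) * meixner r p n).map Complex.ofRealHom) Ψ := by
  have hc : (cConst p : ℂ) ≠ 0 := by exact_mod_cast (cConst_pos hp0 hp1).ne'
  have hc' : cConst p ≠ 0 := (cConst_pos hp0 hp1).ne'
  induction n with
  | zero => simp [meixner]
  | succ n ih =>
    rw [pow_succ', Module.End.mul_apply, ih, h.current_aeval hb hr]
    -- The normalisation of `meixner` divides by c² at each step while the raising current divides
    -- only by c, so every step leaves a factor c.
    have e : raisePoly r p (C (cConst p ^ n) * meixner r p n) =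
        C (cConst p) * (C (cConst p ^ (n + 1)) * meixner r p (n + 1)) := by
      rw [meixner]
      have e2 : raisePoly r p (C (cConst p ^ n) * meixner r p n) =
          C (cConst p ^ n) * raisePoly r p (meixner r p n) := by
        simp only [raisePoly, taylor_mul, taylor_C]
        ring
      rw [e2, ← mul_assoc, ← mul_assoc, ← C_mul, ← C_mul]
      congr 2
      field_simp
      ring
    rw [e, Polynomial.map_mul, map_mul, Module.End.mul_apply, Polynomial.map_C, aeval_C,
      Module.algebraMap_end_apply, smul_smul, Complex.ofRealHom_eq_coe, one_div,
      inv_mul_cancel₀ hc, one_smul]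

/-- Words in the raising currents of disjoint indicators produce products of Meixner
polynomials. -/
theorem prod_current_pow_vacuum (h : IsShiftSystem Ap Am M a Ψ) {p : ℝ} (hp0 : 0 < p) (hp1 : p < 1)
    {l : ℕ} (b : Fin l → 𝒞) (hb : ∀ i, b i * b i = b i) (hbb : ∀ i j, i ≠ j → b i * b j = 0)
    (r : Fin l → ℝ) (hr : ∀ i, a (b i) = r i) (n : Fin l → ℕ) :
    (List.ofFn fun j => current Ap Am M a (1 / (cConst p : ℂ) * p) (1 / (cConst p : ℂ) * (p : ℂ)⁻¹)
      (-(1 / (cConst p : ℂ))) (b j) ^ n j).prod Ψ =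
    (List.ofFn fun j => aeval (M (b j))
      ((C (cConst p ^ n j) * meixner (r j) p (n j)).map Complex.ofRealHom)).prod Ψ := by
  induction l with
  | zero => simp
  | succ l ih =>
    rw [List.ofFn_succ, List.ofFn_succ, List.prod_cons, List.prod_cons, Module.End.mul_apply,
      Module.End.mul_apply, ih (fun i => b i.succ) (fun i => hb _)
        (fun i j hij => hbb _ _ (by simpa using hij)) (fun i => r i.succ) (fun i => hr _)]
    set T := (List.ofFn fun j : Fin l => aeval (M (b j.succ))
      ((C (cConst p ^ n j.succ) * meixner (r j.succ) p (n j.succ)).map Complex.ofRealHom)).prod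
      with hT
    -- Operators that commute with the other M (b j) commute with T, so the power belonging to b 0
    -- can be moved to act directly on the vacuum.
    have hcomm : ∀ S : Module.End ℂ D, (∀ j : Fin l, Commute S (M (b j.succ))) → Commute S T := by
      intro S hS
      refine Commute.list_prod_right _ _ fun y hy => ?_
      obtain ⟨j, rfl⟩ := (List.mem_ofFn' _ _).1 hy
      exact commute_aeval (hS j) _
    have h1 := (hcomm _ fun j => (h.current_commute (hbb 0 j.succ (Fin.succ_ne_zero j).symm)
      (1 / (cConst p : ℂ) * p) (1 / (cConst p : ℂ) * (p : ℂ)⁻¹)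
      (-(1 / (cConst p : ℂ)))).pow_left (n 0)).eq
    have h2 := (hcomm (aeval (M (b 0)) ((C (cConst p ^ n 0) * meixner (r 0) p (n 0)).map
      Complex.ofRealHom)) fun j => (commute_aeval (show Commute (M (b j.succ)) (M (b 0)) from
        LinearMap.ext fun v => h.mul_comm _ _ v) _).symm).eq
    rw [← Module.End.mul_apply, h1, Module.End.mul_apply,
      h.current_pow_vacuum (hb 0) (hr 0) hp0 hp1, ← Module.End.mul_apply, ← h2,
      Module.End.mul_apply]

end IsShiftSystem

end

section

variable {X : Type*} [MeasurableSpace X] {α : Measure X} {p : ℝ} {ρ : Measure (Config X)}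

/-! ### Test functions -/

namespace TestFunctions

theorem measurable (φ : TestFunctions α) : Measurable (φ : X → ℂ) := φ.2.1

theorem exists_bound (φ : TestFunctions α) : ∃ C : ℝ, 0 ≤ C ∧ ∀ x, ‖(φ : X → ℂ) x‖ ≤ C := by
  obtain ⟨C, hC⟩ := φ.2.2.1
  exact ⟨max C 0, le_max_right _ _, fun x => (hC x).trans (le_max_left _ _)⟩

theorem measurableSet_ne_zero (φ : TestFunctions α) : MeasurableSet {x | (φ : X → ℂ) x ≠ 0} :=
  (measurableSet_singleton (0 : ℂ)).compl.preimage (TestFunctions.measurable φ)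

theorem integrable_of_lt_top (φ : TestFunctions α) {S : Set X} {m : Measure X}
    (hS : ∀ x ∉ S, (φ : X → ℂ) x = 0) (hm : m S < ∞) : Integrable (φ : X → ℂ) m := by
  obtain ⟨C, -, hC⟩ := (TestFunctions.exists_bound φ)
  rw [← integrableOn_iff_integrable_of_support_subset (s := S)]
  · exact Measure.integrableOn_of_bounded hm.ne (TestFunctions.measurable φ).aestronglyMeasurable
      (Filter.Eventually.of_forall hC)
  · intro x hx
    by_contra h
    exact hx (hS x h)

theorem integrable (φ : TestFunctions α) : Integrable (φ : X → ℂ) α :=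
  TestFunctions.integrable_of_lt_top φ (S := {x | (φ : X → ℂ) x ≠ 0}) (by simp) φ.2.2.2

/-- φ is bounded and, almost surely, only finitely many points of η lie where it does not vanish. -/
theorem ae_integrable (φ : TestFunctions α) (hρ : IsPascalLaw p α ρ) (hp0 : 0 < p) (hp1 : p < 1) :
    ∀ᵐ η ∂ρ, Integrable (φ : X → ℂ) η.1 := by
  filter_upwards [hρ.ae_count_lt_top hp0 hp1 (TestFunctions.measurableSet_ne_zero φ) φ.2.2.2]
    with η hη
  exact TestFunctions.integrable_of_lt_top φ (S := {x | (φ : X → ℂ) x ≠ 0}) (by simp) hη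

theorem norm_integral_le (φ : TestFunctions α) {S : Set X} {m : Measure X} {C : ℝ}
    (hS : ∀ x ∉ S, (φ : X → ℂ) x = 0) (hm : m S < ∞) (hC : ∀ x, ‖(φ : X → ℂ) x‖ ≤ C) :
    ‖∫ x, (φ : X → ℂ) x ∂m‖ ≤ C * (m S).toReal := by
  rw [← setIntegral_eq_integral_of_forall_compl_eq_zero hS]
  exact norm_setIntegral_le_of_norm_le_const hm fun x _ => hC x

/-- Approximation of a test function by simple functions. -/
noncomputable def approx (φ : TestFunctions α) (n : ℕ) : TestFunctions α :=
  ⟨SimpleFunc.approxOn (φ : X → ℂ) (TestFunctions.measurable φ) Set.univ 0 (Set.mem_univ 0) n, by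
    have hb : ∀ x, ‖SimpleFunc.approxOn (φ : X → ℂ) (TestFunctions.measurable φ) Set.univ 0
        (Set.mem_univ 0) n x‖ ≤
        ‖(φ : X → ℂ) x‖ + ‖(φ : X → ℂ) x‖ := fun x =>
      SimpleFunc.norm_approxOn_zero_le (TestFunctions.measurable φ) (Set.mem_univ 0) x n
    obtain ⟨C, -, hC⟩ := (TestFunctions.exists_bound φ)
    refine ⟨SimpleFunc.measurable _, ⟨C + C, fun x => (hb x).trans (add_le_add (hC x) (hC x))⟩,
      (measure_mono (Set.ofPred_subset_ofPred.2 fun x hx hn => hx ?_)).trans_lt φ.2.2.2⟩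
    simpa [hn] using hb x⟩

theorem norm_approx_le (φ : TestFunctions α) (n : ℕ) (x : X) :
    ‖(TestFunctions.approx φ n : X → ℂ) x‖ ≤ ‖(φ : X → ℂ) x‖ + ‖(φ : X → ℂ) x‖ :=
  SimpleFunc.norm_approxOn_zero_le (TestFunctions.measurable φ) (Set.mem_univ 0) x n

theorem approx_eq_zero (φ : TestFunctions α) (n : ℕ) {x : X} (hx : (φ : X → ℂ) x = 0) :
    (TestFunctions.approx φ n : X → ℂ) x = 0 := by
  simpa [hx] using (TestFunctions.norm_approx_le φ) n x

theorem tendsto_approx (φ : TestFunctions α) (x : X) :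
    Filter.Tendsto (fun n => (TestFunctions.approx φ n : X → ℂ) x) Filter.atTop
      (nhds ((φ : X → ℂ) x)) :=
  SimpleFunc.tendsto_approxOn (TestFunctions.measurable φ) (Set.mem_univ 0) (by simp)

theorem finite_range_approx (φ : TestFunctions α) (n : ℕ) :
    (Set.range (TestFunctions.approx φ n : X → ℂ)).Finite :=
  (SimpleFunc.approxOn (φ : X → ℂ) (TestFunctions.measurable φ) Set.univ 0
    (Set.mem_univ 0) n).finite_range

theorem tendsto_integral_approx (φ : TestFunctions α) {m : Measure X}
    (h : Integrable (φ : X → ℂ) m) :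
    Filter.Tendsto (fun n => ∫ x, (TestFunctions.approx φ n : X → ℂ) x ∂m) Filter.atTop
      (nhds (∫ x, (φ : X → ℂ) x ∂m)) :=
  tendsto_integral_of_dominated_convergence (fun x => ‖(φ : X → ℂ) x‖ + ‖(φ : X → ℂ) x‖)
    (fun n => (TestFunctions.measurable (TestFunctions.approx φ n)).aestronglyMeasurable)
    (h.norm.add h.norm)
    (fun n => Filter.Eventually.of_forall ((TestFunctions.norm_approx_le φ) n))
    (Filter.Eventually.of_forall (TestFunctions.tendsto_approx φ))

/-- For a simple test function the integral is a finite combination of counts, and in general a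
limit of such. Both hold only almost everywhere, since the integral is 0 by convention at
configurations for which the function is not integrable. -/
theorem aestronglyMeasurable_integral (φ : TestFunctions α) (hρ : IsPascalLaw p α ρ) (hp0 : 0 < p)
    (hp1 : p < 1) :
    AEStronglyMeasurable (fun η : Config X => ∫ x, (φ : X → ℂ) x ∂η.1) ρ := by
  refine aestronglyMeasurable_of_tendsto_ae Filter.atTop
    (f := fun n (η : Config X) => ∫ x, (TestFunctions.approx φ n : X → ℂ) x ∂η.1) (fun n => ?_) ?_
  · set f := SimpleFunc.approxOn (φ : X → ℂ) (TestFunctions.measurable φ) Set.univ 0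
      (Set.mem_univ 0) n with hf
    have hm : Measurable fun η : Config X => ∑ y ∈ f.range, (η.1 (f ⁻¹' {y})).toReal • y :=
      Finset.measurable_fun_sum _ fun y _ =>
        (measurable_count_toReal (f.measurableSet_preimage _)).smul_const y
    refine hm.aestronglyMeasurable.congr ?_
    filter_upwards [(TestFunctions.ae_integrable (TestFunctions.approx φ n)) hρ hp0 hp1] with η hη
    exact (f.integral_eq_integral hη).symm.trans (f.integral_eq η.1) |>.symm
  · filter_upwards [(TestFunctions.ae_integrable φ) hρ hp0 hp1] with η hη
    exact (TestFunctions.tendsto_integral_approx φ) hη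

end TestFunctions

/-! ### Functions of polynomial growth -/

/-- The algebra of functions that are almost everywhere bounded by a power of a counting
variable. -/
def tempered (hρ : IsPascalLaw p α ρ) (hp0 : 0 < p) (hp1 : p < 1) :
    Subalgebra ℂ (Config X → ℂ) where
  carrier := {F | AEStronglyMeasurable F ρ ∧ ∃ S, MeasurableSet S ∧ α S < ∞ ∧ ∃ (C : ℝ) (k : ℕ),
    0 ≤ C ∧ ∀ᵐ η ∂ρ, ‖F η‖ ≤ C * (1 + (η.1 S).toReal) ^ k}
  algebraMap_mem' c := ⟨aestronglyMeasurable_const, ∅, MeasurableSet.empty, by simp, ‖c‖, 0,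
    norm_nonneg _, by simp⟩
  add_mem' := by
    rintro F G ⟨hF, S, hS, hα, C, k, hC, h⟩ ⟨hG, S', hS', hα', C', k', hC', h'⟩
    refine ⟨hF.add hG, S ∪ S', hS.union hS', (measure_union_le _ _).trans_lt
      (ENNReal.add_lt_top.2 ⟨hα, hα'⟩), C + C', k + k', by positivity, ?_⟩
    -- Finiteness of the count of the union matters: `toReal` sends ∞ to 0, which would break
    -- monotonicity.
    filter_upwards [h, h', hρ.ae_count_lt_top hp0 hp1 (hS.union hS')
      ((measure_union_le _ _).trans_lt (ENNReal.add_lt_top.2 ⟨hα, hα'⟩))] with η h1 h2 h3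
    have e1 : (η.1 S).toReal ≤ (η.1 (S ∪ S')).toReal :=
      ENNReal.toReal_mono h3.ne (measure_mono Set.subset_union_left)
    have e2 : (η.1 S').toReal ≤ (η.1 (S ∪ S')).toReal :=
      ENNReal.toReal_mono h3.ne (measure_mono Set.subset_union_right)
    have e0 : 1 ≤ 1 + (η.1 (S ∪ S')).toReal := by linarith [@ENNReal.toReal_nonneg (η.1 (S ∪ S'))]
    rw [add_mul]
    refine (norm_add_le _ _).trans (add_le_add (h1.trans ?_) (h2.trans ?_))
    · refine mul_le_mul_of_nonneg_left ?_ hC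
      exact (pow_le_pow_left₀ (by positivity) (by linarith) _).trans
        (pow_le_pow_right₀ e0 (by omega))
    · refine mul_le_mul_of_nonneg_left ?_ hC'
      exact (pow_le_pow_left₀ (by positivity) (by linarith) _).trans
        (pow_le_pow_right₀ e0 (by omega))
  mul_mem' := by
    rintro F G ⟨hF, S, hS, hα, C, k, hC, h⟩ ⟨hG, S', hS', hα', C', k', hC', h'⟩
    refine ⟨hF.mul hG, S ∪ S', hS.union hS', (measure_union_le _ _).trans_lt
      (ENNReal.add_lt_top.2 ⟨hα, hα'⟩), C * C', k + k', by positivity, ?_⟩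
    filter_upwards [h, h', hρ.ae_count_lt_top hp0 hp1 (hS.union hS')
      ((measure_union_le _ _).trans_lt (ENNReal.add_lt_top.2 ⟨hα, hα'⟩))] with η h1 h2 h3
    have e1 : (η.1 S).toReal ≤ (η.1 (S ∪ S')).toReal :=
      ENNReal.toReal_mono h3.ne (measure_mono Set.subset_union_left)
    have e2 : (η.1 S').toReal ≤ (η.1 (S ∪ S')).toReal :=
      ENNReal.toReal_mono h3.ne (measure_mono Set.subset_union_right)
    have h1' := h1.trans (mul_le_mul_of_nonneg_left
      (pow_le_pow_left₀ (by positivity) (add_le_add_right e1 1) k) hC)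
    have h2' := h2.trans (mul_le_mul_of_nonneg_left
      (pow_le_pow_left₀ (by positivity) (add_le_add_right e2 1) k') hC')
    rw [Pi.mul_apply, norm_mul, pow_add, mul_mul_mul_comm]
    exact mul_le_mul h1' h2' (norm_nonneg _) (by positivity)

section

variable {hρ : IsPascalLaw p α ρ} {hp0 : 0 < p} {hp1 : p < 1}

theorem memLp_of_mem_tempered {F : Config X → ℂ} (hF : F ∈ tempered hρ hp0 hp1) :
    MemLp F 2 ρ := by
  obtain ⟨hm, S, hS, hα, C, k, hC, h⟩ := hF
  rw [memLp_two_iff_integrable_sq_norm hm]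
  refine ((hρ.integrable_one_add_count_pow hp0 hp1 hS hα (k * 2)).const_mul (C ^ 2)).mono'
    (hm.norm.pow 2) ?_
  filter_upwards [h] with η hη
  rw [Real.norm_eq_abs, abs_of_nonneg (by positivity), pow_mul, ← mul_pow]
  exact pow_le_pow_left₀ (norm_nonneg _) hη 2

theorem integrable_of_mem_tempered {F : Config X → ℂ} (hF : F ∈ tempered hρ hp0 hp1) :
    Integrable F ρ := by
  have := hρ.isProbabilityMeasure
  exact (memLp_of_mem_tempered hF).integrable (by norm_num)

theorem integral_mem_tempered (φ : TestFunctions α) :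
    (fun η : Config X => ∫ x, (φ : X → ℂ) x ∂η.1) ∈ tempered hρ hp0 hp1 := by
  obtain ⟨C, hC0, hC⟩ := TestFunctions.exists_bound φ
  refine ⟨(TestFunctions.aestronglyMeasurable_integral φ) hρ hp0 hp1, {x | (φ : X → ℂ) x ≠ 0},
    (TestFunctions.measurableSet_ne_zero φ), φ.2.2.2, C, 1, hC0, ?_⟩
  filter_upwards [hρ.ae_count_lt_top hp0 hp1 (TestFunctions.measurableSet_ne_zero φ) φ.2.2.2]
    with η hη
  refine (TestFunctions.norm_integral_le φ (S := {x | (φ : X → ℂ) x ≠ 0}) (by simp) hη hC).trans ?_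
  rw [pow_one]
  exact mul_le_mul_of_nonneg_left (by linarith) hC0

theorem count_mem_tempered {B : Set X} (hB : MeasurableSet B) (hα : α B < ∞) :
    (fun η : Config X => ((η.1 B).toReal : ℂ)) ∈ tempered hρ hp0 hp1 := by
  refine ⟨((measurable_count_toReal hB).complex_ofReal).aestronglyMeasurable, B, hB, hα, 1, 1,
    zero_le_one, Filter.Eventually.of_forall fun η => ?_⟩
  rw [Complex.norm_real, Real.norm_eq_abs, abs_of_nonneg ENNReal.toReal_nonneg]
  linarith

/-- Both sides are algebras, so only the generators η(φ) need a bound. -/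
theorem polyFun_le_tempered (hρ : IsPascalLaw p α ρ) (hp0 : 0 < p) (hp1 : p < 1) :
    polyFun α ≤ tempered hρ hp0 hp1 := by
  rw [polyFun, ← Algebra.adjoin_range_eq_range_aeval]
  refine Algebra.adjoin_le ?_
  rintro _ ⟨φ, rfl⟩
  exact integral_mem_tempered φ

end

/-! ### Polynomials -/

theorem integral_mem_polyFun (φ : TestFunctions α) :
    (fun η : Config X => ∫ x, (φ : X → ℂ) x ∂η.1) ∈ polyFun α :=
  ⟨MvPolynomial.X φ, by simp⟩

theorem const_mem_polyFun (c : ℂ) : (fun _ : Config X => c) ∈ polyFun α :=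
  (polyFun α).algebraMap_mem c

/-- Polynomials are generated from constants by adding, and multiplying by linear functionals. -/
theorem polyFun_induction {P : (Config X → ℂ) → Prop} (const : ∀ c : ℂ, P fun _ => c)
    (add : ∀ F ∈ polyFun α, ∀ G ∈ polyFun α, P F → P G → P (F + G))
    (mul : ∀ F ∈ polyFun α, ∀ φ : TestFunctions α, P F →
      P (fun η => (∫ x, (φ : X → ℂ) x ∂η.1) * F η)) : ∀ F ∈ polyFun α, P F := by
  rintro _ ⟨Q, rfl⟩
  induction Q using MvPolynomial.induction_on with
  | C a => simpa [Pi.algebraMap_def] using const a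
  | add Q R hQ hR =>
    have h := add _ ⟨Q, rfl⟩ _ ⟨R, rfl⟩ hQ hR
    rwa [← map_add] at h
  | mul_X Q φ hQ =>
    have h := mul _ ⟨Q, rfl⟩ φ hQ
    convert h using 1
    funext η
    simp [mul_comm]

theorem star_mem_polyFun : ∀ F ∈ polyFun α, (fun η => starRingEnd ℂ (F η)) ∈ polyFun α := by
  refine polyFun_induction (fun c => const_mem_polyFun _) (fun F _ G _ hF hG => ?_)
    (fun F _ φ hF => ?_)
  · have h := add_mem hF hG
    convert h using 2 with η
    exact map_add _ _ _
  · have h := mul_mem (integral_mem_polyFun (star φ)) hF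
    convert h using 2 with η
    rw [map_mul, ← integral_conj]
    rfl

end

section

variable {X : Type*} [MeasurableSpace X] {α : Measure X} {p : ℝ} {ρ : Measure (Config X)}

/-! ### Integrals over shifted configurations -/

/-- `σ η x` arises from `η` by adding `s` points at `x`, for almost every `x` with respect to
`m η`. -/
structure IsShift (α : Measure X) (ρ : Measure (Config X)) (m : Config X → Measure X)
    (σ : Config X → X → Config X) (s : ℂ) : Prop where
  integrable : ∀ φ : TestFunctions α, ∀ᵐ η ∂ρ, Integrable (φ : X → ℂ) (m η)
  shift : ∀ φ : TestFunctions α, ∀ᵐ η ∂ρ, ∀ᵐ x ∂m η,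
    ∫ y, (φ : X → ℂ) y ∂(σ η x).1 = ∫ y, (φ : X → ℂ) y ∂η.1 + s * (φ : X → ℂ) x
  base : ∀ φ : TestFunctions α, ∃ G ∈ polyFun α, (fun η => ∫ x, (φ : X → ℂ) x ∂m η) =ᵐ[ρ] G

/-- The integral of `φ(x) F(σ η x)` with respect to `m η`. -/
noncomputable def shiftInt (m : Config X → Measure X) (σ : Config X → X → Config X) (φ : X → ℂ)
    (F : Config X → ℂ) (η : Config X) : ℂ :=
  ∫ x, φ x * F (σ η x) ∂m η

namespace IsShift

variable {m : Config X → Measure X} {σ : Config X → X → Config X} {s : ℂ}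

/-- For fixed η a linear functional of the shifted configuration is a constant plus s times a test
function of x, hence bounded and measurable; sums and products inherit this. -/
theorem ae_bounded (h : IsShift α ρ m σ s) : ∀ F ∈ polyFun α, ∀ᵐ η ∂ρ,
    AEStronglyMeasurable (fun x => F (σ η x)) (m η) ∧ ∃ C : ℝ, ∀ᵐ x ∂m η, ‖F (σ η x)‖ ≤ C := by
  refine polyFun_induction (fun c => ?_) (fun F _ G _ hF hG => ?_) (fun F _ φ hF => ?_)
  · exact Filter.Eventually.of_forall fun η => ⟨aestronglyMeasurable_const, ‖c‖, by simp⟩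
  · filter_upwards [hF, hG] with η ⟨h1, C, hC⟩ ⟨h2, C', hC'⟩
    refine ⟨h1.add h2, C + C', ?_⟩
    filter_upwards [hC, hC'] with x h3 h4
    exact (norm_add_le _ _).trans (add_le_add h3 h4)
  · obtain ⟨K, hK0, hK⟩ := TestFunctions.exists_bound φ
    filter_upwards [hF, h.shift φ] with η ⟨h1, C, hC⟩ h2
    constructor
    · refine AEStronglyMeasurable.mul ?_ h1
      refine AEStronglyMeasurable.congr (f := fun x => ∫ y, (φ : X → ℂ) y ∂η.1 + s * (φ : X → ℂ) x)
        ?_ ?_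
      · exact ((TestFunctions.measurable φ).const_mul s |>.const_add _).aestronglyMeasurable
      · filter_upwards [h2] with x hx using hx.symm
    · refine ⟨(‖∫ y, (φ : X → ℂ) y ∂η.1‖ + ‖s‖ * K) * C, ?_⟩
      filter_upwards [hC, h2] with x h3 h4
      rw [h4, norm_mul]
      refine mul_le_mul ((norm_add_le _ _).trans (add_le_add le_rfl ?_)) h3 (norm_nonneg _)
        (by positivity)
      rw [norm_mul]
      exact mul_le_mul_of_nonneg_left (hK x) (norm_nonneg _)

theorem ae_integrable (h : IsShift α ρ m σ s) (φ : TestFunctions α) {F : Config X → ℂ}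
    (hF : F ∈ polyFun α) : ∀ᵐ η ∂ρ, Integrable (fun x => (φ : X → ℂ) x * F (σ η x)) (m η) := by
  filter_upwards [h.integrable φ, h.ae_bounded F hF] with η h1 ⟨h2, C, hC⟩
  exact h1.mul_bdd h2 hC

theorem shiftInt_add (h : IsShift α ρ m σ s) (φ : TestFunctions α) {F G : Config X → ℂ}
    (hF : F ∈ polyFun α) (hG : G ∈ polyFun α) :
    shiftInt m σ φ (F + G) =ᵐ[ρ] shiftInt m σ φ F + shiftInt m σ φ G := by
  filter_upwards [h.ae_integrable φ hF, h.ae_integrable φ hG] with η h1 h2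
  simp only [shiftInt, Pi.add_apply, mul_add]
  exact integral_add h1 h2

theorem shiftInt_smul (φ : X → ℂ) (c : ℂ) (F : Config X → ℂ) :
    shiftInt m σ φ (c • F) = c • shiftInt m σ φ F := by
  funext η
  simp only [shiftInt, Pi.smul_apply, smul_eq_mul, ← integral_const_mul]
  congr 1 with x
  ring

theorem shiftInt_add_left (h : IsShift α ρ m σ s) (φ ψ : TestFunctions α) {F : Config X → ℂ}
    (hF : F ∈ polyFun α) :
    shiftInt m σ (φ + ψ : TestFunctions α) F =ᵐ[ρ] shiftInt m σ φ F + shiftInt m σ ψ F := by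
  filter_upwards [h.ae_integrable φ hF, h.ae_integrable ψ hF] with η h1 h2
  simp only [shiftInt, Pi.add_apply]
  rw [← integral_add h1 h2]
  congr 1 with x
  exact add_mul _ _ _

theorem shiftInt_smul_left (c : ℂ) (φ : TestFunctions α) (F : Config X → ℂ) :
    shiftInt m σ (c • φ : TestFunctions α) F = c • shiftInt m σ φ F := by
  funext η
  simp only [shiftInt, Pi.smul_apply, smul_eq_mul, ← integral_const_mul]
  congr 1 with x
  exact mul_assoc _ _ _

/-- The shifted functional is η(ψ) + sψ(x). Its first part leaves the integral, and ψ(x) is absorbed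
into the test function. -/
theorem shiftInt_mul (h : IsShift α ρ m σ s) (φ ψ : TestFunctions α) {F : Config X → ℂ}
    (hF : F ∈ polyFun α) :
    shiftInt m σ φ (fun η => (∫ x, (ψ : X → ℂ) x ∂η.1) * F η) =ᵐ[ρ] fun η =>
      (∫ x, (ψ : X → ℂ) x ∂η.1) * shiftInt m σ φ F η +
        s * shiftInt m σ (φ * ψ : TestFunctions α) F η := by
  filter_upwards [h.ae_integrable φ hF, h.ae_integrable (φ * ψ) hF, h.shift ψ] with η h1 h2 h3
  simp only [shiftInt]
  rw [← integral_const_mul, ← integral_const_mul, ← integral_add (h1.const_mul _) (h2.const_mul _)]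
  refine integral_congr_ae ?_
  filter_upwards [h3] with x hx
  rw [hx]
  change _ = (∫ y, (ψ : X → ℂ) y ∂η.1) * ((φ : X → ℂ) x * F (σ η x)) +
    s * ((φ : X → ℂ) x * (ψ : X → ℂ) x * F (σ η x))
  ring

/-- The test function is quantified inside the induction because multiplication by η(ψ) replaces φ
by φψ. -/
theorem exists_polyFun (h : IsShift α ρ m σ s) : ∀ F ∈ polyFun α, ∀ φ : TestFunctions α,
    ∃ G ∈ polyFun α, shiftInt m σ φ F =ᵐ[ρ] G := by
  refine polyFun_induction (fun c φ => ?_) (fun F hF G hG h1 h2 φ => ?_) (fun F hF ψ h1 φ => ?_)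
  · obtain ⟨G, hG, hφ⟩ := h.base φ
    refine ⟨c • G, (polyFun α).smul_mem hG c, ?_⟩
    filter_upwards [hφ] with η hη
    rw [Pi.smul_apply, ← hη, smul_eq_mul, shiftInt, integral_mul_const, mul_comm]
  · obtain ⟨F', hF', h3⟩ := h1 φ
    obtain ⟨G', hG', h4⟩ := h2 φ
    exact ⟨F' + G', add_mem hF' hG', (h.shiftInt_add φ hF hG).trans (h3.add h4)⟩
  · obtain ⟨F', hF', h3⟩ := h1 φ
    obtain ⟨G', hG', h4⟩ := h1 (φ * ψ)
    refine ⟨fun η => (∫ x, (ψ : X → ℂ) x ∂η.1) * F' η + s • G' η,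
      add_mem (mul_mem (integral_mem_polyFun ψ) hF') ((polyFun α).smul_mem hG' s), ?_⟩
    filter_upwards [h.shiftInt_mul φ ψ hF, h3, h4] with η h5 h6 h7
    rw [h5, h6, h7, smul_eq_mul]

end IsShift

section

variable [MeasurableSingletonClass X]

theorem Config.integral_add {η : Config X} {φ : X → ℂ} (h : Integrable φ η.1) (x : X) :
    ∫ y, φ y ∂(η.add x).1 = ∫ y, φ y ∂η.1 + φ x := by
  rw [Config.add, integral_add_measure h (integrable_dirac (by simp)), integral_dirac]

/-- Each Dirac summand is carried by its own point. Thus the default value of η - δ_x at points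
outside η never affects an integral against η. -/
theorem Config.ae_one_le (η : Config X) : ∀ᵐ x ∂η.1, 1 ≤ η.1 {x} := by
  obtain ⟨η, ι, _, y, rfl⟩ := η
  rw [Measure.ae_sum_iff]
  intro i
  rw [ae_dirac_eq]
  change 1 ≤ Measure.sum (fun i => Measure.dirac (y i)) {y i}
  rw [Measure.sum_apply _ (measurableSet_singleton _)]
  exact le_trans (by simp) (ENNReal.le_tsum i)

theorem Config.integral_sub {η : Config X} {φ : X → ℂ} (h : Integrable φ η.1) {x : X}
    (hx : 1 ≤ η.1 {x}) : ∫ y, φ y ∂(η.sub x).1 = ∫ y, φ y ∂η.1 - φ x := by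
  have h1 := Config.add_sub η x hx
  have h2 : Integrable φ (η.sub x).1 := by
    refine h.mono_measure ?_
    nth_rewrite 2 [← h1]
    exact Measure.le_add_right le_rfl
  have h3 := Config.integral_add h2 x
  rw [h1] at h3
  rw [h3, add_sub_cancel_right]

theorem isShift_add (hρ : IsPascalLaw p α ρ) (hp0 : 0 < p) (hp1 : p < 1) :
    IsShift α ρ (fun η => α + η.1) Config.add 1 where
  integrable φ := by
    filter_upwards [TestFunctions.ae_integrable φ hρ hp0 hp1] with η hη
    exact (TestFunctions.integrable φ).add_measure hη
  shift φ := by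
    filter_upwards [TestFunctions.ae_integrable φ hρ hp0 hp1] with η hη
    exact Filter.Eventually.of_forall fun x => by rw [Config.integral_add hη, one_mul]
  base φ := by
    refine ⟨fun η => ∫ x, (φ : X → ℂ) x ∂α + ∫ x, (φ : X → ℂ) x ∂η.1,
      add_mem (const_mem_polyFun _) (integral_mem_polyFun φ), ?_⟩
    filter_upwards [TestFunctions.ae_integrable φ hρ hp0 hp1] with η hη
    exact integral_add_measure (TestFunctions.integrable φ) hη

theorem isShift_sub (hρ : IsPascalLaw p α ρ) (hp0 : 0 < p) (hp1 : p < 1) :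
    IsShift α ρ (fun η => η.1) Config.sub (-1) where
  integrable φ := TestFunctions.ae_integrable φ hρ hp0 hp1
  shift φ := by
    filter_upwards [TestFunctions.ae_integrable φ hρ hp0 hp1] with η hη
    filter_upwards [η.ae_one_le] with x hx
    rw [Config.integral_sub hη hx]
    ring
  base φ := ⟨_, integral_mem_polyFun φ, Filter.EventuallyEq.rfl⟩

theorem ae_integralsConverge (hρ : IsPascalLaw p α ρ) (hp0 : 0 < p) (hp1 : p < 1)
    (φ : TestFunctions α) {F : Config X → ℂ} (hF : F ∈ polyFun α) :
    ∀ᵐ η ∂ρ, IntegralsConverge α φ F η := by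
  filter_upwards [TestFunctions.ae_integrable φ hρ hp0 hp1,
    (isShift_add hρ hp0 hp1).ae_integrable φ hF, (isShift_sub hρ hp0 hp1).ae_integrable φ hF]
    with η h1 h2 h3
  exact ⟨h1, TestFunctions.integrable φ, h2, h3⟩

end

end

section

variable {X : Type*} [MeasurableSpace X] {α : Measure X} {p : ℝ} {ρ : Measure (Config X)}

/-! ### The Mecke formula -/

theorem eval_mem_subalgebra {Ω J : Type*} (A : Subalgebra ℂ (Ω → ℂ)) {f : J → Ω → ℂ}
    (hf : ∀ i, f i ∈ A) (Q : MvPolynomial J ℂ) :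
    (fun ω => MvPolynomial.eval (fun i => f i ω) Q) ∈ A := by
  induction Q using MvPolynomial.induction_on with
  | C a =>
    simp only [MvPolynomial.eval_C]
    exact A.algebraMap_mem a
  | add Q R hQ hR => simpa using! add_mem hQ hR
  | mul_X Q i hQ => simpa using! mul_mem hQ (hf i)

theorem IsPascalLaw.iIndepFun_count (hρ : IsPascalLaw p α ρ) {J : Type*} [Fintype J]
    {C : J → Set X} (hC : ∀ j, MeasurableSet (C j))
    (hdisj : Pairwise fun i j => Disjoint (C i) (C j)) :
    iIndepFun (fun j (η : Config X) => (η.1 (C j)).toReal) ρ := by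
  let e := Fintype.equivFin J
  have h := hρ.indep _ (fun i => C (e.symm i)) (fun i => hC _)
    (fun i j hij => hdisj (e.symm.injective.ne hij))
  have h2 := h.precomp e.injective
  have h3 := h2.comp (fun _ => ENNReal.toReal) (fun _ => ENNReal.measurable_toReal)
  simpa [Function.comp_def] using h3

/-- The Mecke formula for polynomials in the counting variables of disjoint sets. -/
theorem IsPascalLaw.integral_count_mul_eval (hρ : IsPascalLaw p α ρ) (hp0 : 0 < p) (hp1 : p < 1)
    {J : Type*} [Fintype J] [DecidableEq J] {C : J → Set X} (hC : ∀ j, MeasurableSet (C j))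
    (hdisj : Pairwise fun i j => Disjoint (C i) (C j)) (hα : ∀ j, α (C j) < ∞) (j : J)
    (Q : MvPolynomial J ℂ) :
    ∫ η, ((η.1 (C j)).toReal : ℂ) * MvPolynomial.eval (fun i => ((η.1 (C i)).toReal : ℂ)) Q ∂ρ =
      p * ∫ η, (((α (C j)).toReal : ℂ) + (η.1 (C j)).toReal) *
        MvPolynomial.eval (fun i => ((η.1 (C i)).toReal : ℂ) + if i = j then 1 else 0) Q ∂ρ := by
  have hN : ∀ i, (fun η : Config X => ((η.1 (C i)).toReal : ℂ)) ∈ tempered hρ hp0 hp1 :=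
    fun i => count_mem_tempered (hC i) (hα i)
  have hc : ∀ c : ℂ, (fun _ : Config X => c) ∈ tempered hρ hp0 hp1 :=
    (tempered hρ hp0 hp1).algebraMap_mem
  have i1 : ∀ Q : MvPolynomial J ℂ, Integrable (fun η : Config X => ((η.1 (C j)).toReal : ℂ) *
      MvPolynomial.eval (fun i => ((η.1 (C i)).toReal : ℂ)) Q) ρ := fun Q =>
    integrable_of_mem_tempered (mul_mem (hN j) (eval_mem_subalgebra _ hN Q))
  have i2 : ∀ Q : MvPolynomial J ℂ, Integrable (fun η : Config X =>
      (((α (C j)).toReal : ℂ) + (η.1 (C j)).toReal) *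
      MvPolynomial.eval (fun i => ((η.1 (C i)).toReal : ℂ) + if i = j then 1 else 0) Q) ρ :=
    fun Q => integrable_of_mem_tempered (mul_mem (add_mem (hc _) (hN j))
      (eval_mem_subalgebra _ (fun i => add_mem (hN i) (hc _)) Q))
  -- For a monomial, independence factors both expectations over the sets; the factors other than
  -- the j-th agree, and the j-th is the one-variable Mecke formula.
  induction Q using MvPolynomial.induction_on' with
  | add Q R hQ hR =>
    simp only [map_add, mul_add _ (MvPolynomial.eval _ Q)]
    rw [integral_add (i1 Q) (i1 R), integral_add (i2 Q) (i2 R), hQ, hR, mul_add]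
  | monomial u c =>
    have hind := hρ.iIndepFun_count hC hdisj
    have hme : ∀ i, AEMeasurable (fun η : Config X => (η.1 (C i)).toReal) ρ := fun i =>
      (measurable_count_toReal (hC i)).aemeasurable
    let f : J → ℝ → ℂ := fun i x => if i = j then (x : ℂ) * (x : ℂ) ^ u i else (x : ℂ) ^ u i
    let g : J → ℝ → ℂ := fun i x => if i = j then
      (((α (C j)).toReal : ℂ) + x) * ((x : ℂ) + 1) ^ u i else (x : ℂ) ^ u i
    have hf : ∀ i, Continuous (f i) := fun i => by
      by_cases h : i = j
      · simp only [f, h, if_true]; fun_prop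
      · simp only [f, h, if_false]; fun_prop
    have hg : ∀ i, Continuous (g i) := fun i => by
      by_cases h : i = j
      · simp only [g, h, if_true]; fun_prop
      · simp only [g, h, if_false]; fun_prop
    have e1 : ∀ η : Config X, ((η.1 (C j)).toReal : ℂ) * MvPolynomial.eval
        (fun i => ((η.1 (C i)).toReal : ℂ)) (MvPolynomial.monomial u c) =
        c * ∏ i, f i (η.1 (C i)).toReal := by
      intro η
      rw [MvPolynomial.eval_monomial, Finsupp.prod_fintype _ _ (by simp), mul_left_comm]
      congr 1
      rw [← Finset.mul_prod_erase _ _ (Finset.mem_univ j),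
        ← Finset.mul_prod_erase _ _ (Finset.mem_univ j), ← mul_assoc]
      congr 1
      · simp [f]
      · refine Finset.prod_congr rfl fun i hi => ?_
        simp [f, Finset.ne_of_mem_erase hi]
    have e2 : ∀ η : Config X, (((α (C j)).toReal : ℂ) + (η.1 (C j)).toReal) * MvPolynomial.eval
        (fun i => ((η.1 (C i)).toReal : ℂ) + if i = j then 1 else 0) (MvPolynomial.monomial u c) =
        c * ∏ i, g i (η.1 (C i)).toReal := by
      intro η
      rw [MvPolynomial.eval_monomial, Finsupp.prod_fintype _ _ (by simp), mul_left_comm]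
      congr 1
      rw [← Finset.mul_prod_erase _ _ (Finset.mem_univ j),
        ← Finset.mul_prod_erase _ _ (Finset.mem_univ j), ← mul_assoc]
      congr 1
      · simp [g]
      · refine Finset.prod_congr rfl fun i hi => ?_
        simp [g, Finset.ne_of_mem_erase hi]
    simp_rw [e1, e2, integral_const_mul]
    rw [hind.integral_fun_prod_comp hme fun i => (hf i).aestronglyMeasurable,
      hind.integral_fun_prod_comp hme fun i => (hg i).aestronglyMeasurable,
      ← Finset.mul_prod_erase _ _ (Finset.mem_univ j),
      ← Finset.mul_prod_erase _ _ (Finset.mem_univ j)]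
    have h1 : ∫ η : Config X, f j (η.1 (C j)).toReal ∂ρ =
        p * ∫ η : Config X, g j (η.1 (C j)).toReal ∂ρ := by
      have := hρ.integral_count_mul hp0 hp1 (hC j) (hα j) (g := fun x => (x : ℂ) ^ u j)
        (by fun_prop)
      simpa [f, g] using this
    have h2 : ∏ i ∈ Finset.univ.erase j, ∫ η : Config X, f i (η.1 (C i)).toReal ∂ρ =
        ∏ i ∈ Finset.univ.erase j, ∫ η : Config X, g i (η.1 (C i)).toReal ∂ρ :=
      Finset.prod_congr rfl fun i hi => by simp [f, g, Finset.ne_of_mem_erase hi]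
    rw [h1, h2]
    ring

/-- The integrand is a finite combination of indicators of level sets of Θ. The level 0, which may
have infinite measure, drops out because h 0 = 0. -/
theorem integral_comp_of_finite_range {V : Type*} [MeasurableSpace V] [MeasurableSingletonClass V]
    [Zero V] {Θ : X → V} (hΘ : Measurable Θ) {J : Finset V} (hJ : ∀ x, Θ x ≠ 0 → Θ x ∈ J)
    (hJ0 : (0 : V) ∉ J) {μ : Measure X} (hμ : ∀ v ∈ J, μ (Θ ⁻¹' {v}) < ∞) {h : V → ℂ}
    (h0 : h 0 = 0) :
    ∫ x, h (Θ x) ∂μ = ∑ v : J, h v * ((μ (Θ ⁻¹' {(v : V)})).toReal : ℂ) := by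
  classical
  have e : ∀ x, h (Θ x) = ∑ v : J, (Θ ⁻¹' {(v : V)}).indicator (fun _ => h v) x := by
    intro x
    by_cases hx : Θ x = 0
    · rw [hx, h0, Finset.sum_eq_zero]
      rintro ⟨v, hv⟩ -
      refine Set.indicator_of_notMem (fun hx' => hJ0 ?_) _
      rw [Set.mem_preimage, Set.mem_singleton_iff, hx] at hx'
      exact hx' ▸ hv
    · rw [Finset.sum_eq_single ⟨Θ x, hJ x hx⟩]
      · simp
      · rintro ⟨v, hv⟩ - hne
        refine Set.indicator_of_notMem (fun hx' => hne (Subtype.ext ?_)) _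
        exact (Set.mem_singleton_iff.1 hx').symm
      · simp
  have hm : ∀ v : V, MeasurableSet (Θ ⁻¹' {v}) := fun v => hΘ (measurableSet_singleton v)
  simp_rw [e]
  rw [integral_finsetSum]
  · refine Finset.sum_congr rfl fun v _ => ?_
    rw [integral_indicator_const _ (hm v), Complex.real_smul, mul_comm]
    rfl
  · exact fun v _ => (integrable_indicator_iff (hm v)).2 (integrableOn_const (hμ v v.2).ne)

/-- The integral of a product of linear functionals, after adding a point. -/
noncomputable def addPointInt (α : Measure X) {k : ℕ} (ψ : Fin (k + 1) → X → ℂ)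
    (η : Config X) : ℂ :=
  ∫ x, ψ 0 x * ∏ i : Fin k, (∫ y, ψ i.succ y ∂η.1 + ψ i.succ x) ∂(α + η.1)

/-- The joint level sets of the ψ i are disjoint cells on which all of them are constant, so both
sides become sums over cells of the Mecke formula for counts. -/
theorem IsPascalLaw.mecke_of_finite_range (hρ : IsPascalLaw p α ρ) (hp0 : 0 < p) (hp1 : p < 1)
    {k : ℕ} (ψ : Fin (k + 1) → TestFunctions α) (hψ : ∀ i, (Set.range (ψ i : X → ℂ)).Finite) :
    ∫ η, ∏ i, ∫ x, (ψ i : X → ℂ) x ∂η.1 ∂ρ =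
      p * ∫ η, addPointInt α (fun i => (ψ i : X → ℂ)) η ∂ρ := by
  classical
  let Θ : X → Fin (k + 1) → ℂ := fun x i => (ψ i : X → ℂ) x
  have hΘ : Measurable Θ := measurable_pi_lambda _ fun i => TestFunctions.measurable (ψ i)
  have hfin : (Set.range Θ).Finite := by
    refine (Set.Finite.pi' hψ).subset ?_
    rintro _ ⟨x, rfl⟩ i
    exact ⟨x, rfl⟩
  let J : Finset (Fin (k + 1) → ℂ) := hfin.toFinset.erase 0
  have hJ : ∀ x, Θ x ≠ 0 → Θ x ∈ J := fun x hx => by simp [J, hx]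
  have hJ0 : (0 : Fin (k + 1) → ℂ) ∉ J := by simp [J]
  let C : J → Set X := fun v => Θ ⁻¹' {(v : Fin (k + 1) → ℂ)}
  have hC : ∀ v, MeasurableSet (C v) := fun v => hΘ (measurableSet_singleton _)
  have hdisj : Pairwise fun i j => Disjoint (C i) (C j) := fun v w hvw =>
    Set.disjoint_left.2 fun x hv hw => hvw (Subtype.ext
      ((Set.mem_singleton_iff.1 hv).symm.trans (Set.mem_singleton_iff.1 hw)))
  have hα : ∀ v, α (C v) < ∞ := by
    rintro ⟨v, hv⟩
    have hv0 : v ≠ 0 := by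
      rintro rfl
      exact hJ0 hv
    obtain ⟨i, hi⟩ := Function.ne_iff.1 hv0
    refine (measure_mono ?_).trans_lt (ψ i).2.2.2
    intro x hx
    have : Θ x = v := hx
    change Θ x i ≠ 0
    rw [this]
    exact hi
  have hα' : ∀ v ∈ J, α (Θ ⁻¹' {v}) < ∞ := fun v hv => hα ⟨v, hv⟩
  have hη : ∀ᵐ η ∂ρ, ∀ v : J, η.1 (C v) < ∞ :=
    ae_all_iff.2 fun v => hρ.ae_count_lt_top hp0 hp1 (hC v) (hα v)
  let N : J → Config X → ℂ := fun v η => ((η.1 (C v)).toReal : ℂ)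
  -- Q expresses the product of the remaining functionals through the cell counts; adding a point in
  -- the cell of v shifts the variable of v by one.
  let Q : MvPolynomial J ℂ := ∏ i : Fin k,
    ∑ v : J, MvPolynomial.C ((v : Fin (k + 1) → ℂ) i.succ) * MvPolynomial.X v
  have hlin : ∀ η : Config X, (∀ v : J, η.1 (C v) < ∞) → ∀ i,
      ∫ x, (ψ i : X → ℂ) x ∂η.1 = ∑ v : J, (v : Fin (k + 1) → ℂ) i * N v η := fun η h i =>
    integral_comp_of_finite_range hΘ hJ hJ0 (fun v hv => h ⟨v, hv⟩)
      (h := fun v : Fin (k + 1) → ℂ => v i) rfl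
  have hN : ∀ v, N v ∈ tempered hρ hp0 hp1 := fun v => count_mem_tempered (hC v) (hα v)
  have hc : ∀ c : ℂ, (fun _ : Config X => c) ∈ tempered hρ hp0 hp1 :=
    (tempered hρ hp0 hp1).algebraMap_mem
  have e1 : (fun η : Config X => ∏ i, ∫ x, (ψ i : X → ℂ) x ∂η.1) =ᵐ[ρ] fun η =>
      ∑ v : J, (v : Fin (k + 1) → ℂ) 0 *
        (N v η * MvPolynomial.eval (fun w => N w η) Q) := by
    filter_upwards [hη] with η h
    rw [Fin.prod_univ_succ, hlin η h 0, Finset.sum_mul]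
    refine Finset.sum_congr rfl fun v _ => ?_
    rw [mul_assoc]
    congr 2
    simp only [Q, map_prod, map_sum, map_mul, MvPolynomial.eval_C, MvPolynomial.eval_X]
    exact Finset.prod_congr rfl fun i _ => hlin η h i.succ
  have e2 : addPointInt α (fun i => (ψ i : X → ℂ)) =ᵐ[ρ] fun η =>
      ∑ v : J, (v : Fin (k + 1) → ℂ) 0 * ((((α (C v)).toReal : ℂ) + N v η) *
        MvPolynomial.eval (fun w => N w η + if w = v then 1 else 0) Q) := by
    filter_upwards [hη] with η h
    have h2 := integral_comp_of_finite_range (μ := α + η.1) hΘ hJ hJ0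
      (fun v hv => by
        rw [Measure.add_apply]
        exact ENNReal.add_lt_top.2 ⟨hα' v hv, h ⟨v, hv⟩⟩)
      (h := fun v : Fin (k + 1) → ℂ =>
        v 0 * ∏ i : Fin k, (∫ y, (ψ i.succ : X → ℂ) y ∂η.1 + v i.succ)) (by simp)
    refine h2.trans (Finset.sum_congr rfl fun v _ => ?_)
    rw [Measure.add_apply, ENNReal.toReal_add (hα v).ne (h v).ne, mul_assoc,
      mul_comm (((α (C v)).toReal : ℂ) + N v η)]
    push_cast
    congr 2
    simp only [Q, map_prod, map_sum, map_mul, MvPolynomial.eval_C, MvPolynomial.eval_X]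
    refine Finset.prod_congr rfl fun i _ => ?_
    rw [hlin η h i.succ]
    simp [mul_add, Finset.sum_add_distrib]
  rw [integral_congr_ae e1, integral_congr_ae e2, integral_finsetSum, integral_finsetSum,
    Finset.mul_sum]
  · refine Finset.sum_congr rfl fun v _ => ?_
    rw [integral_const_mul, integral_const_mul,
      hρ.integral_count_mul_eval hp0 hp1 hC hdisj hα v Q, mul_left_comm]
  · exact fun v _ => (integrable_of_mem_tempered (mul_mem (add_mem (hc _) (hN v))
      (eval_mem_subalgebra _ (fun i => add_mem (hN i) (hc _)) Q))).const_mul _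
  · exact fun v _ => (integrable_of_mem_tempered
      (mul_mem (hN v) (eval_mem_subalgebra _ hN Q))).const_mul _

end

/-! ### The Mecke formula: from simple to general test functions -/

section

variable {X : Type*} [MeasurableSpace X] {α : Measure X} {p : ℝ} {ρ : Measure (Config X)}

/-- With N = η(S), the integrand is at most K (K(1+N))^k and S has mass α(S) + N. The bound depends
on the functions only through K and S, as dominated convergence requires. -/
theorem norm_addPointInt_le {k : ℕ} (ψ : Fin (k + 1) → TestFunctions α) {S : Set X} {K : ℝ}
    (hK0 : 0 ≤ K) (hK : ∀ i x, ‖(ψ i : X → ℂ) x‖ ≤ K) (hS : ∀ i, ∀ x ∉ S, (ψ i : X → ℂ) x = 0)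
    (hα : α S < ∞) {η : Config X} (hη : η.1 S < ∞) :
    ‖addPointInt α (fun i => (ψ i : X → ℂ)) η‖ ≤
      K ^ (k + 1) * ((α S).toReal + 1) * (1 + (η.1 S).toReal) ^ (k + 1) := by
  have hm : (α + η.1) S < ∞ := by
    rw [Measure.add_apply]
    exact ENNReal.add_lt_top.2 ⟨hα, hη⟩
  have h1 : ∀ x ∉ S, (ψ 0 : X → ℂ) x *
      ∏ i : Fin k, (∫ y, (ψ i.succ : X → ℂ) y ∂η.1 + (ψ i.succ : X → ℂ) x) = 0 := fun x hx => by
    rw [hS 0 x hx, zero_mul]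
  have hs0 : 0 ≤ (η.1 S).toReal := ENNReal.toReal_nonneg
  have ha0 : 0 ≤ (α S).toReal := ENNReal.toReal_nonneg
  have h2 : ∀ x, ‖(ψ 0 : X → ℂ) x *
      ∏ i : Fin k, (∫ y, (ψ i.succ : X → ℂ) y ∂η.1 + (ψ i.succ : X → ℂ) x)‖ ≤
      K * (K * (1 + (η.1 S).toReal)) ^ k := fun x => by
    rw [norm_mul, norm_prod]
    refine mul_le_mul (hK 0 x) ?_ (by positivity) hK0
    refine (Finset.prod_le_prod (fun _ _ => norm_nonneg _) fun i _ =>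
      (norm_add_le _ _).trans (add_le_add (TestFunctions.norm_integral_le (ψ i.succ) (hS _) hη
        (hK _)) (hK i.succ x))).trans ?_
    rw [Finset.prod_const, Finset.card_univ, Fintype.card_fin]
    refine le_of_eq ?_
    ring
  rw [addPointInt, ← setIntegral_eq_integral_of_forall_compl_eq_zero h1]
  refine (norm_setIntegral_le_of_norm_le_const hm fun x _ => h2 x).trans ?_
  rw [Measure.real, Measure.add_apply, ENNReal.toReal_add hα.ne hη.ne, mul_pow, pow_succ, pow_succ]
  have : (α S).toReal + (η.1 S).toReal ≤ ((α S).toReal + 1) * (1 + (η.1 S).toReal) := by nlinarith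
  calc _ = K ^ k * K * (1 + (η.1 S).toReal) ^ k * ((α S).toReal + (η.1 S).toReal) := by ring
    _ ≤ K ^ k * K * (1 + (η.1 S).toReal) ^ k * (((α S).toReal + 1) * (1 + (η.1 S).toReal)) := by
      gcongr
    _ = _ := by ring

theorem tendsto_addPointInt {k : ℕ} (ψ : Fin (k + 1) → TestFunctions α) {η : Config X}
    (hη : ∀ i, Integrable (ψ i : X → ℂ) η.1) :
    Filter.Tendsto (fun n => addPointInt α (fun i => (TestFunctions.approx (ψ i) n : X → ℂ)) η)
      Filter.atTop (nhds (addPointInt α (fun i => (ψ i : X → ℂ)) η)) := by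
  have hint : Integrable (ψ 0 : X → ℂ) (α + η.1) :=
    (TestFunctions.integrable (ψ 0)).add_measure (hη 0)
  choose K hK0 hK using fun i => TestFunctions.exists_bound (ψ i)
  have hlim : ∀ i, Filter.Tendsto (fun n => ∫ y, (TestFunctions.approx (ψ i) n : X → ℂ) y ∂η.1)
      Filter.atTop (nhds (∫ y, (ψ i : X → ℂ) y ∂η.1)) := fun i =>
    TestFunctions.tendsto_integral_approx (ψ i) (hη i)
  choose R hR using fun i => (Metric.isBounded_range_of_tendsto _ (hlim i)).exists_norm_le
  refine tendsto_integral_of_dominated_convergence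
    (fun x => (‖(ψ 0 : X → ℂ) x‖ + ‖(ψ 0 : X → ℂ) x‖) *
      ∏ i : Fin k, (R i.succ + (K i.succ + K i.succ))) (fun n => ?_)
    ((hint.norm.add hint.norm).mul_const _) (fun n => Filter.Eventually.of_forall fun x => ?_)
    (Filter.Eventually.of_forall fun x => ?_)
  · refine Measurable.aestronglyMeasurable ((TestFunctions.measurable _).mul
      (Finset.measurable_fun_prod _ fun i _ => (TestFunctions.measurable _).const_add _))
  · rw [norm_mul, norm_prod]
    refine mul_le_mul (TestFunctions.norm_approx_le (ψ 0) n x) ?_ (by positivity) (by positivity)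
    refine Finset.prod_le_prod (fun _ _ => norm_nonneg _) fun i _ => (norm_add_le _ _).trans
      (add_le_add (hR i.succ _ ⟨n, rfl⟩) ?_)
    exact (TestFunctions.norm_approx_le _ n x).trans (add_le_add (hK _ x) (hK _ x))
  · exact (TestFunctions.tendsto_approx (ψ 0) x).mul (tendsto_finsetProd _ fun i _ =>
      (hlim i.succ).add (TestFunctions.tendsto_approx (ψ i.succ) x))

theorem prod_mem_polyFun {k : ℕ} (ψ : Fin k → TestFunctions α) :
    (fun η : Config X => ∏ i, ∫ x, (ψ i : X → ℂ) x ∂η.1) ∈ polyFun α := by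
  have h := prod_mem (S := polyFun α) (t := Finset.univ) (f := fun i (η : Config X) =>
    ∫ x, (ψ i : X → ℂ) x ∂η.1) fun i _ => integral_mem_polyFun (ψ i)
  convert h using 1
  funext η
  rw [Finset.prod_apply]

section

variable [MeasurableSingletonClass X]

theorem shiftInt_prod (hρ : IsPascalLaw p α ρ) (hp0 : 0 < p) (hp1 : p < 1) {k : ℕ}
    (ψ : Fin (k + 1) → TestFunctions α) :
    shiftInt (fun η => α + η.1) Config.add (ψ 0)
      (fun η => ∏ i : Fin k, ∫ x, (ψ i.succ : X → ℂ) x ∂η.1) =ᵐ[ρ]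
      addPointInt α fun i => (ψ i : X → ℂ) := by
  filter_upwards [ae_all_iff.2 fun i : Fin k =>
    TestFunctions.ae_integrable (ψ i.succ) hρ hp0 hp1] with η hη
  simp only [shiftInt, addPointInt]
  congr 1 with x
  congr 1
  exact Finset.prod_congr rfl fun i _ => Config.integral_add (hη i) x

theorem IsPascalLaw.mecke_prod (hρ : IsPascalLaw p α ρ) (hp0 : 0 < p) (hp1 : p < 1) {k : ℕ}
    (ψ : Fin (k + 1) → TestFunctions α) :
    ∫ η, ∏ i, ∫ x, (ψ i : X → ℂ) x ∂η.1 ∂ρ =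
      p * ∫ η, addPointInt α (fun i => (ψ i : X → ℂ)) η ∂ρ := by
  choose K hK0 hK using fun i => TestFunctions.exists_bound (ψ i)
  let S : Set X := ⋃ i, {x | (ψ i : X → ℂ) x ≠ 0}
  have hSm : MeasurableSet S := MeasurableSet.iUnion fun i => TestFunctions.measurableSet_ne_zero _
  have hSα : α S < ∞ := (measure_iUnion_fintype_le α _).trans_lt
    (ENNReal.sum_lt_top.2 fun i _ => (ψ i).2.2.2)
  -- The simple approximations are bounded only by twice the bound of ψ i; the sum over i serves all
  -- indices at once.
  let L : ℝ := ∑ i, (K i + K i)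
  have hL0 : 0 ≤ L := Finset.sum_nonneg fun i _ => add_nonneg (hK0 i) (hK0 i)
  have hL : ∀ n i x, ‖(TestFunctions.approx (ψ i) n : X → ℂ) x‖ ≤ L := fun n i x =>
    ((TestFunctions.norm_approx_le _ n x).trans (add_le_add (hK i x) (hK i x))).trans
      (Finset.single_le_sum (f := fun i => K i + K i)
        (fun i _ => add_nonneg (hK0 i) (hK0 i)) (Finset.mem_univ i))
  have hS : ∀ n i, ∀ x ∉ S, (TestFunctions.approx (ψ i) n : X → ℂ) x = 0 := fun n i x hx => by
    refine TestFunctions.approx_eq_zero _ n ?_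
    by_contra h
    exact hx (Set.mem_iUnion.2 ⟨i, h⟩)
  have hint : ∀ᵐ η ∂ρ, ∀ i, Integrable (ψ i : X → ℂ) η.1 :=
    ae_all_iff.2 fun i => TestFunctions.ae_integrable (ψ i) hρ hp0 hp1
  have hbd := hρ.integrable_one_add_count_pow hp0 hp1 hSm hSα (k + 1)
  have l1 : Filter.Tendsto
      (fun n => ∫ η : Config X, ∏ i, ∫ x, (TestFunctions.approx (ψ i) n : X → ℂ) x ∂η.1 ∂ρ)
      Filter.atTop (nhds (∫ η, ∏ i, ∫ x, (ψ i : X → ℂ) x ∂η.1 ∂ρ)) := by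
    refine tendsto_integral_of_dominated_convergence
      (fun η => L ^ (k + 1) * (1 + (η.1 S).toReal) ^ (k + 1)) (fun n => ?_) (hbd.const_mul _)
      (fun n => ?_) ?_
    · exact (polyFun_le_tempered hρ hp0 hp1 (prod_mem_polyFun _)).1
    · filter_upwards [hρ.ae_count_lt_top hp0 hp1 hSm hSα] with η hη
      rw [norm_prod, ← mul_pow]
      refine (Finset.prod_le_prod (fun _ _ => norm_nonneg _) fun i _ =>
        (TestFunctions.norm_integral_le _ (hS n i) hη (hL n i)).trans
          (mul_le_mul_of_nonneg_left (show _ ≤ 1 + (η.1 S).toReal by linarith) hL0)).trans ?_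
      rw [Finset.prod_const, Finset.card_univ, Fintype.card_fin]
    · filter_upwards [hint] with η hη
      exact tendsto_finsetProd _ fun i _ => TestFunctions.tendsto_integral_approx (ψ i) (hη i)
  have l2 : Filter.Tendsto (fun n => ∫ η : Config X,
      addPointInt α (fun i => (TestFunctions.approx (ψ i) n : X → ℂ)) η ∂ρ)
      Filter.atTop (nhds (∫ η, addPointInt α (fun i => (ψ i : X → ℂ)) η ∂ρ)) := by
    refine tendsto_integral_of_dominated_convergence
      (fun η => L ^ (k + 1) * ((α S).toReal + 1) * (1 + (η.1 S).toReal) ^ (k + 1)) (fun n => ?_)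
      (hbd.const_mul _) (fun n => ?_) ?_
    · obtain ⟨G, hG, hG'⟩ := (isShift_add hρ hp0 hp1).exists_polyFun _
        (prod_mem_polyFun fun i : Fin k => TestFunctions.approx (ψ i.succ) n)
        (TestFunctions.approx (ψ 0) n)
      exact (polyFun_le_tempered hρ hp0 hp1 hG).1.congr
        (hG'.symm.trans (shiftInt_prod hρ hp0 hp1 fun i => TestFunctions.approx (ψ i) n))
    · filter_upwards [hρ.ae_count_lt_top hp0 hp1 hSm hSα] with η hη
      exact norm_addPointInt_le _ hL0 (hL n) (hS n) hSα hη
    · filter_upwards [hint] with η hη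
      exact tendsto_addPointInt ψ hη
  refine tendsto_nhds_unique l1 ((l2.const_mul (p : ℂ)).congr fun n => ?_)
  exact (hρ.mecke_of_finite_range hp0 hp1 _
    fun i => TestFunctions.finite_range_approx (ψ i) n).symm

/-- The Mecke formula for polynomials. -/
theorem IsPascalLaw.mecke (hρ : IsPascalLaw p α ρ) (hp0 : 0 < p) (hp1 : p < 1)
    (φ : TestFunctions α) {G : Config X → ℂ} (hG : G ∈ polyFun α) :
    ∫ η, (∫ x, (φ : X → ℂ) x ∂η.1) * G η ∂ρ =
      p * ∫ η, shiftInt (fun η => α + η.1) Config.add φ G η ∂ρ := by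
  have hsh := isShift_add (α := α) hρ hp0 hp1
  -- The statement carries along a product of linear functionals: a factor η(φ) of G is moved into
  -- that product, until a constant G leaves the product formula.
  have key : ∀ G ∈ polyFun α, ∀ (k : ℕ) (ψ : Fin (k + 1) → TestFunctions α),
      ∫ η, (∫ x, (ψ 0 : X → ℂ) x ∂η.1) *
        (G η * ∏ i : Fin k, ∫ x, (ψ i.succ : X → ℂ) x ∂η.1) ∂ρ =
      p * ∫ η, shiftInt (fun η => α + η.1) Config.add (ψ 0)
        (fun η => G η * ∏ i : Fin k, ∫ x, (ψ i.succ : X → ℂ) x ∂η.1) η ∂ρ := by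
    refine polyFun_induction (fun c k ψ => ?_) (fun F hF G hG h1 h2 k ψ => ?_)
      (fun F hF φ h1 k ψ => ?_)
    · have e1 := IsShift.shiftInt_smul (m := fun η : Config X => α + η.1) (σ := Config.add)
        (ψ 0 : X → ℂ) c (fun η => ∏ i : Fin k, ∫ x, (ψ i.succ : X → ℂ) x ∂η.1)
      have e2 := hρ.mecke_prod hp0 hp1 ψ
      rw [← integral_congr_ae (shiftInt_prod hρ hp0 hp1 ψ)] at e2
      change _ = p * ∫ η, shiftInt (fun η => α + η.1) Config.add (ψ 0)
        (c • (fun η => ∏ i : Fin k, ∫ x, (ψ i.succ : X → ℂ) x ∂η.1)) η ∂ρ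
      simp only [e1, Pi.smul_apply, smul_eq_mul, integral_const_mul]
      rw [mul_left_comm, ← e2, ← integral_const_mul]
      congr 1 with η
      rw [Fin.prod_univ_succ]
      ring
    · have hP := prod_mem_polyFun fun i : Fin k => ψ i.succ
      have e1 := hsh.shiftInt_add (ψ 0) (mul_mem hF hP) (mul_mem hG hP)
      have e2 : (fun η => (F + G) η * ∏ i : Fin k, ∫ x, (ψ i.succ : X → ℂ) x ∂η.1) =
          (F * fun η => ∏ i : Fin k, ∫ x, (ψ i.succ : X → ℂ) x ∂η.1) +
          (G * fun η => ∏ i : Fin k, ∫ x, (ψ i.succ : X → ℂ) x ∂η.1) := by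
        funext η
        exact add_mul _ _ _
      have hi : ∀ F ∈ polyFun α, Integrable (fun η : Config X => (∫ x, (ψ 0 : X → ℂ) x ∂η.1) *
          (F η * ∏ i : Fin k, ∫ x, (ψ i.succ : X → ℂ) x ∂η.1)) ρ := fun F hF =>
        integrable_of_mem_tempered (polyFun_le_tempered hρ hp0 hp1
          (mul_mem (integral_mem_polyFun _) (mul_mem hF hP)))
      have hi' : ∀ F ∈ polyFun α, Integrable (shiftInt (fun η => α + η.1) Config.add (ψ 0) F) ρ :=
        fun F hF => by
          obtain ⟨G, hG, h⟩ := hsh.exists_polyFun F hF (ψ 0)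
          exact (integrable_of_mem_tempered (polyFun_le_tempered hρ hp0 hp1 hG)).congr h.symm
      rw [e2, integral_congr_ae e1]
      simp only [Pi.add_apply, add_mul, mul_add]
      rw [integral_add (hi F hF) (hi G hG), integral_add (hi' _ (mul_mem hF hP))
        (hi' _ (mul_mem hG hP)), mul_add, h1, h2]
      rfl
    · have h := h1 (k + 1) (Fin.cons (ψ 0) (Fin.cons φ fun i => ψ i.succ))
      simp only [Fin.cons_zero, Fin.cons_succ, Fin.prod_univ_succ] at h
      have e : ∀ η : Config X, (∫ x, (φ : X → ℂ) x ∂η.1) * F η *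
          ∏ i : Fin k, ∫ x, (ψ i.succ : X → ℂ) x ∂η.1 = F η * ((∫ x, (φ : X → ℂ) x ∂η.1) *
          ∏ i : Fin k, ∫ x, (ψ i.succ : X → ℂ) x ∂η.1) := fun η => by ring
      simpa only [e] using h
  simpa using key G hG 0 fun _ => φ

end

end

section

variable {X : Type*} [MeasurableSpace X] {α : Measure X} {p : ℝ} {ρ : Measure (Config X)}

/-! ### Adjointness of adding and removing points -/

theorem shiftInt_conj (m : Config X → Measure X) (σ : Config X → X → Config X)
    (φ : TestFunctions α) (F : Config X → ℂ) (η : Config X) :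
    shiftInt m σ φ (fun η => starRingEnd ℂ (F η)) η =
      starRingEnd ℂ (shiftInt m σ (star φ : TestFunctions α) F η) := by
  rw [shiftInt, shiftInt, ← integral_conj]
  congr 1 with x
  rw [map_mul]
  change _ = starRingEnd ℂ (starRingEnd ℂ ((φ : X → ℂ) x)) * _
  rw [Complex.conj_conj]

theorem eq_zero_of_integral_conj_mul {F : Config X → ℂ} (hF : MemLp F 2 ρ)
    (h : ∫ η, starRingEnd ℂ (F η) * F η ∂ρ = 0) : F =ᵐ[ρ] 0 := by
  have h1 : ∀ η, starRingEnd ℂ (F η) * F η = ((‖F η‖ ^ 2 : ℝ) : ℂ) := fun η => by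
    rw [mul_comm, Complex.mul_conj, Complex.normSq_eq_norm_sq]
  simp_rw [h1] at h
  rw [integral_complex_ofReal, Complex.ofReal_eq_zero, integral_eq_zero_iff_of_nonneg
    (fun η => by positivity) ((memLp_two_iff_integrable_sq_norm hF.1).1 hF)] at h
  filter_upwards [h] with η hη
  simpa using hη

theorem IsShift.mem_tempered {m : Config X → Measure X} {σ : Config X → X → Config X} {s : ℂ}
    (h : IsShift α ρ m σ s) (hρ : IsPascalLaw p α ρ) (hp0 : 0 < p) (hp1 : p < 1)
    (φ : TestFunctions α) {F : Config X → ℂ} (hF : F ∈ polyFun α) :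
    shiftInt m σ φ F ∈ tempered hρ hp0 hp1 := by
  obtain ⟨G, hG, hG'⟩ := h.exists_polyFun F hF φ
  obtain ⟨h1, S, hS, hα, C, k, hC, h2⟩ := polyFun_le_tempered hρ hp0 hp1 hG
  refine ⟨h1.congr hG'.symm, S, hS, hα, C, k, hC, ?_⟩
  filter_upwards [h2, hG'] with η h3 h4
  rwa [h4]

section

variable [MeasurableSingletonClass X]

/-- The operator that removes points of `φ` is, up to a factor, the transpose of the operator that
adds points of `φ`. -/
theorem IsPascalLaw.integral_sub_mul (hρ : IsPascalLaw p α ρ) (hp0 : 0 < p) (hp1 : p < 1) :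
    ∀ F ∈ polyFun α, ∀ (φ : TestFunctions α), ∀ G ∈ polyFun α,
      ∫ η, shiftInt (fun η => η.1) Config.sub φ F η * G η ∂ρ =
        p * ∫ η, F η * shiftInt (fun η => α + η.1) Config.add φ G η ∂ρ := by
  have ha := isShift_add (α := α) hρ hp0 hp1
  have hs := isShift_sub (α := α) hρ hp0 hp1
  have hmem := polyFun_le_tempered (α := α) hρ hp0 hp1
  have i1 : ∀ F ∈ polyFun α, ∀ (φ : TestFunctions α), ∀ G ∈ polyFun α,
      Integrable (fun η => shiftInt (fun η => η.1) Config.sub φ F η * G η) ρ :=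
    fun F hF φ G hG => integrable_of_mem_tempered
      (mul_mem (hs.mem_tempered hρ hp0 hp1 φ hF) (hmem hG))
  have i2 : ∀ F ∈ polyFun α, ∀ (φ : TestFunctions α), ∀ G ∈ polyFun α,
      Integrable (fun η => F η * shiftInt (fun η => α + η.1) Config.add φ G η) ρ :=
    fun F hF φ G hG => integrable_of_mem_tempered
      (mul_mem (hmem hF) (ha.mem_tempered hρ hp0 hp1 φ hG))
  -- For constant F this is the Mecke formula. A factor η(ψ) of F is moved over to G; the term
  -- -A⁻(φψ)F this produces cancels the term A⁺(φψ)G in A⁺(φ)(η(ψ)G).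
  refine polyFun_induction (fun c φ G hG => ?_) (fun F hF F' hF' h1 h2 φ G hG => ?_)
    (fun F hF ψ h1 φ G hG => ?_)
  · have h := hρ.mecke hp0 hp1 φ hG
    simp only [shiftInt] at h ⊢
    simp only [integral_mul_const, integral_const_mul]
    rw [mul_left_comm, ← h, ← integral_const_mul]
    congr 1 with η
    ring
  · have e : (fun η => shiftInt (fun η => η.1) Config.sub φ (F + F') η * G η) =ᵐ[ρ] fun η =>
        shiftInt (fun η => η.1) Config.sub φ F η * G η +
          shiftInt (fun η => η.1) Config.sub φ F' η * G η := by
      filter_upwards [hs.shiftInt_add φ hF hF'] with η h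
      rw [h, Pi.add_apply, add_mul]
    rw [integral_congr_ae e, integral_add (i1 F hF φ G hG) (i1 F' hF' φ G hG), h1 φ G hG,
      h2 φ G hG, ← mul_add, ← integral_add (i2 F hF φ G hG) (i2 F' hF' φ G hG)]
    simp only [Pi.add_apply, add_mul]
  · have hψG : (fun η : Config X => (∫ x, (ψ : X → ℂ) x ∂η.1) * G η) ∈ polyFun α :=
      mul_mem (integral_mem_polyFun ψ) hG
    have hψF : (fun η : Config X => (∫ x, (ψ : X → ℂ) x ∂η.1) * F η) ∈ polyFun α :=
      mul_mem (integral_mem_polyFun ψ) hF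
    have e1 : (fun η => shiftInt (fun η => η.1) Config.sub φ
        (fun η => (∫ x, (ψ : X → ℂ) x ∂η.1) * F η) η * G η) =ᵐ[ρ] fun η =>
        shiftInt (fun η => η.1) Config.sub φ F η * ((∫ x, (ψ : X → ℂ) x ∂η.1) * G η) -
          shiftInt (fun η => η.1) Config.sub (φ * ψ : TestFunctions α) F η * G η := by
      filter_upwards [hs.shiftInt_mul φ ψ hF] with η h
      rw [h]
      ring
    have e2 : (fun η => F η * shiftInt (fun η => α + η.1) Config.add φ
        (fun η => (∫ x, (ψ : X → ℂ) x ∂η.1) * G η) η) =ᵐ[ρ] fun η =>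
        (∫ x, (ψ : X → ℂ) x ∂η.1) * F η * shiftInt (fun η => α + η.1) Config.add φ G η +
          F η * shiftInt (fun η => α + η.1) Config.add (φ * ψ : TestFunctions α) G η := by
      filter_upwards [ha.shiftInt_mul φ ψ hG] with η h
      rw [h]
      ring
    rw [integral_congr_ae e1, integral_sub (i1 F hF φ _ hψG) (i1 F hF _ G hG), h1 φ _ hψG,
      h1 (φ * ψ) G hG, integral_congr_ae e2,
      integral_add (i2 _ hψF φ G hG) (i2 F hF _ G hG)]
    ring

/-- Adding a point might lead into the null set where F does not vanish, so there is no pointwise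
argument. Instead, if the polynomial G represents A⁺(φ)F, transposition turns E|G|² into an integral
against F, which is zero. -/
theorem shiftInt_add_eq_zero (hρ : IsPascalLaw p α ρ) (hp0 : 0 < p) (hp1 : p < 1)
    (φ : TestFunctions α) {F : Config X → ℂ} (hF : F ∈ polyFun α) (h0 : F =ᵐ[ρ] 0) :
    shiftInt (fun η => α + η.1) Config.add φ F =ᵐ[ρ] 0 := by
  obtain ⟨G, hG, h⟩ := (isShift_add hρ hp0 hp1).exists_polyFun F hF φ
  refine h.trans (eq_zero_of_integral_conj_mul
    (memLp_of_mem_tempered (polyFun_le_tempered hρ hp0 hp1 hG)) ?_)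
  have h1 := hρ.integral_sub_mul hp0 hp1 _ (star_mem_polyFun G hG) φ F hF
  have e1 : ∫ η, shiftInt (fun η => η.1) Config.sub φ (fun η => starRingEnd ℂ (G η)) η * F η ∂ρ =
      0 := by
    rw [← integral_zero (Config X) ℂ (μ := ρ)]
    refine integral_congr_ae ?_
    filter_upwards [h0] with η hη
    rw [hη, Pi.zero_apply, mul_zero]
  have e2 : ∫ η, starRingEnd ℂ (G η) * shiftInt (fun η => α + η.1) Config.add φ F η ∂ρ =
      ∫ η, starRingEnd ℂ (G η) * G η ∂ρ := by
    refine integral_congr_ae ?_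
    filter_upwards [h] with η hη
    rw [hη]
  rw [e1, e2, eq_comm, mul_eq_zero] at h1
  exact h1.resolve_left (by exact_mod_cast hp0.ne')

theorem shiftInt_sub_eq_zero (hρ : IsPascalLaw p α ρ) (hp0 : 0 < p) (hp1 : p < 1)
    (φ : TestFunctions α) {F : Config X → ℂ} (hF : F ∈ polyFun α) (h0 : F =ᵐ[ρ] 0) :
    shiftInt (fun η => η.1) Config.sub φ F =ᵐ[ρ] 0 := by
  obtain ⟨G, hG, h⟩ := (isShift_sub hρ hp0 hp1).exists_polyFun F hF φ
  refine h.trans (eq_zero_of_integral_conj_mul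
    (memLp_of_mem_tempered (polyFun_le_tempered hρ hp0 hp1 hG)) ?_)
  have h1 := hρ.integral_sub_mul hp0 hp1 F hF φ _ (star_mem_polyFun G hG)
  have e1 : ∫ η, F η * shiftInt (fun η => α + η.1) Config.add φ
      (fun η => starRingEnd ℂ (G η)) η ∂ρ = 0 := by
    rw [← integral_zero (Config X) ℂ (μ := ρ)]
    refine integral_congr_ae ?_
    filter_upwards [h0] with η hη
    rw [hη, Pi.zero_apply, zero_mul]
  have e2 : ∫ η, shiftInt (fun η => η.1) Config.sub φ F η * starRingEnd ℂ (G η) ∂ρ =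
      ∫ η, starRingEnd ℂ (G η) * G η ∂ρ := by
    refine integral_congr_ae ?_
    filter_upwards [h] with η hη
    rw [hη, mul_comm]
  rw [e1, e2, mul_zero] at h1
  exact h1

end

/-! ### Operators on the space of polynomials -/

theorem polyDomain_ext {f g : polyDomain α ρ} {F : Config X → ℂ} (hf : (f : Lp ℂ 2 ρ) =ᵐ[ρ] F)
    (hg : (g : Lp ℂ 2 ρ) =ᵐ[ρ] F) : f = g :=
  Subtype.ext (Lp.ext (hf.trans hg.symm))

theorem coeFn_polyDomain_add (f g : polyDomain α ρ) :
    ((f + g : polyDomain α ρ) : Lp ℂ 2 ρ) =ᵐ[ρ] (f : Lp ℂ 2 ρ) + (g : Lp ℂ 2 ρ) :=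
  Lp.coeFn_add _ _

theorem coeFn_polyDomain_smul (c : ℂ) (f : polyDomain α ρ) :
    ((c • f : polyDomain α ρ) : Lp ℂ 2 ρ) =ᵐ[ρ] c • ((f : Lp ℂ 2 ρ) : Config X → ℂ) :=
  Lp.coeFn_smul _ _

theorem exists_polyDomain (hρ : IsPascalLaw p α ρ) (hp0 : 0 < p) (hp1 : p < 1) {F G : Config X → ℂ}
    (hG : G ∈ polyFun α) (h : F =ᵐ[ρ] G) : ∃ f : polyDomain α ρ, (f : Lp ℂ 2 ρ) =ᵐ[ρ] F := by
  have hm := memLp_of_mem_tempered (polyFun_le_tempered hρ hp0 hp1 hG)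
  exact ⟨⟨hm.toLp, G, hG, hm.coeFn_toLp⟩, hm.coeFn_toLp.trans h.symm⟩

/-- The transformation `T φ` of polynomials induces a linear operator on classes of polynomials. -/
def Represents (K : TestFunctions α →ₗ[ℂ] Module.End ℂ (polyDomain α ρ))
    (T : TestFunctions α → (Config X → ℂ) → Config X → ℂ) : Prop :=
  ∀ (φ : TestFunctions α) (f : polyDomain α ρ), ∀ F ∈ polyFun α,
    (f : Lp ℂ 2 ρ) =ᵐ[ρ] F → (K φ f : Lp ℂ 2 ρ) =ᵐ[ρ] T φ F

/-- A formula on functions descends to classes once it respects almost everywhere equality; by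
linearity it suffices that null polynomials go to null functions. -/
theorem exists_represents (hρ : IsPascalLaw p α ρ) (hp0 : 0 < p) (hp1 : p < 1)
    {T : TestFunctions α → (Config X → ℂ) → Config X → ℂ}
    (hT : ∀ φ, ∀ F ∈ polyFun α, ∃ G ∈ polyFun α, T φ F =ᵐ[ρ] G)
    (hadd : ∀ φ, ∀ F ∈ polyFun α, ∀ G ∈ polyFun α, T φ (F + G) =ᵐ[ρ] T φ F + T φ G)
    (hsmul : ∀ φ (c : ℂ), ∀ F ∈ polyFun α, T φ (c • F) =ᵐ[ρ] c • T φ F)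
    (hadd' : ∀ φ ψ, ∀ F ∈ polyFun α, T (φ + ψ) F =ᵐ[ρ] T φ F + T ψ F)
    (hsmul' : ∀ (c : ℂ) φ, ∀ F ∈ polyFun α, T (c • φ) F =ᵐ[ρ] c • T φ F)
    (h0 : ∀ φ, ∀ F ∈ polyFun α, F =ᵐ[ρ] 0 → T φ F =ᵐ[ρ] 0) :
    ∃ K : TestFunctions α →ₗ[ℂ] Module.End ℂ (polyDomain α ρ), Represents K T := by
  have hcongr : ∀ φ, ∀ F ∈ polyFun α, ∀ G ∈ polyFun α, F =ᵐ[ρ] G → T φ F =ᵐ[ρ] T φ G := by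
    intro φ F hF G hG h
    have hG' := (polyFun α).smul_mem hG (-1 : ℂ)
    have h1 : F + (-1 : ℂ) • G =ᵐ[ρ] 0 := by
      filter_upwards [h] with η hη
      simp [hη]
    filter_upwards [h0 φ _ (add_mem hF hG') h1, hadd φ F hF _ hG', hsmul φ (-1) G hG]
      with η h2 h3 h4
    rw [h3, Pi.add_apply, h4] at h2
    simpa [← sub_eq_add_neg, sub_eq_zero] using h2
  choose rep hrep hrep' using fun f : polyDomain α ρ => f.2
  have hex : ∀ φ (f : polyDomain α ρ), ∃ g : polyDomain α ρ, (g : Lp ℂ 2 ρ) =ᵐ[ρ] T φ (rep f) :=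
    fun φ f => by
      obtain ⟨G, hG, h⟩ := hT φ _ (hrep f)
      exact exists_polyDomain hρ hp0 hp1 hG h
  choose K hK using hex
  have hK' : ∀ φ (f : polyDomain α ρ), ∀ F ∈ polyFun α, (f : Lp ℂ 2 ρ) =ᵐ[ρ] F →
      (K φ f : Lp ℂ 2 ρ) =ᵐ[ρ] T φ F := fun φ f F hF h =>
    (hK φ f).trans (hcongr φ _ (hrep f) _ hF ((hrep' f).symm.trans h))
  refine ⟨{
    toFun := fun φ => { toFun := K φ, map_add' := fun f g => ?_, map_smul' := fun c f => ?_ }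
    map_add' := fun φ ψ => LinearMap.ext fun f => ?_
    map_smul' := fun c φ => LinearMap.ext fun f => ?_ }, hK'⟩
  · refine polyDomain_ext (hK' φ _ _ (add_mem (hrep f) (hrep g))
      ((coeFn_polyDomain_add f g).trans ((hrep' f).add (hrep' g)))) ?_
    exact (coeFn_polyDomain_add _ _).trans (((hK φ f).add (hK φ g)).trans
      (hadd φ _ (hrep f) _ (hrep g)).symm)
  · refine polyDomain_ext (hK' φ _ _ ((polyFun α).smul_mem (hrep f) c)
      ((coeFn_polyDomain_smul c f).trans ((hrep' f).const_smul c))) ?_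
    exact (coeFn_polyDomain_smul _ _).trans (((hK φ f).const_smul c).trans
      (hsmul φ c _ (hrep f)).symm)
  · refine polyDomain_ext (hK (φ + ψ) f) ?_
    exact (coeFn_polyDomain_add _ _).trans (((hK φ f).add (hK ψ f)).trans
      (hadd' φ ψ _ (hrep f)).symm)
  · refine polyDomain_ext (hK (c • φ) f) ?_
    exact (coeFn_polyDomain_smul _ _).trans (((hK φ f).const_smul c).trans
      (hsmul' c φ _ (hrep f)).symm)

end

section

variable {X : Type*} [MeasurableSpace X] {α : Measure X} {p : ℝ} {ρ : Measure (Config X)}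

/-! ### The operators of adding, removing and counting points -/

/-- The linear functional `φ ↦ ∫ φ dα`. -/
noncomputable def refInt (α : Measure X) : TestFunctions α →ₗ[ℂ] ℂ where
  toFun φ := ∫ x, (φ : X → ℂ) x ∂α
  map_add' φ ψ := integral_add (TestFunctions.integrable φ) (TestFunctions.integrable ψ)
  map_smul' c _ := integral_const_mul c _

theorem refInt_star (φ : TestFunctions α) : refInt α (star φ) = starRingEnd ℂ (refInt α φ) :=
  integral_conj

/-- Multiplication by the linear functional `η(φ)`. -/
noncomputable def countMul (φ : TestFunctions α) (F : Config X → ℂ) (η : Config X) : ℂ :=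
  (∫ x, (φ : X → ℂ) x ∂η.1) * F η

theorem countMul_mem (φ : TestFunctions α) {F : Config X → ℂ} (hF : F ∈ polyFun α) :
    countMul φ F ∈ polyFun α :=
  mul_mem (integral_mem_polyFun φ) hF

theorem exists_countMul (hρ : IsPascalLaw p α ρ) (hp0 : 0 < p) (hp1 : p < 1) :
    ∃ M : TestFunctions α →ₗ[ℂ] Module.End ℂ (polyDomain α ρ), Represents M countMul := by
  refine exists_represents hρ hp0 hp1
    (fun φ F hF => ⟨_, countMul_mem φ hF, Filter.EventuallyEq.rfl⟩)
    (fun φ F _ G _ => Filter.Eventually.of_forall fun η => mul_add _ _ _)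
    (fun φ c F _ => Filter.Eventually.of_forall fun η => mul_left_comm _ _ _)
    (fun φ ψ F _ => ?_) (fun c φ F _ => Filter.Eventually.of_forall fun η => ?_)
    (fun φ F _ h => ?_)
  · filter_upwards [TestFunctions.ae_integrable φ hρ hp0 hp1,
      TestFunctions.ae_integrable ψ hρ hp0 hp1] with η h1 h2
    rw [Pi.add_apply, countMul, countMul, countMul, ← add_mul, ← integral_add h1 h2]
    rfl
  · change (∫ x, c * (φ : X → ℂ) x ∂η.1) * F η = c * ((∫ x, (φ : X → ℂ) x ∂η.1) * F η)
    rw [integral_const_mul, mul_assoc]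
  · filter_upwards [h] with η hη
    rw [countMul, hη, Pi.zero_apply, mul_zero]

theorem IsShift.exists_represents {m : Config X → Measure X} {σ : Config X → X → Config X} {s : ℂ}
    (h : IsShift α ρ m σ s) (hρ : IsPascalLaw p α ρ) (hp0 : 0 < p) (hp1 : p < 1)
    (h0 : ∀ φ : TestFunctions α, ∀ F ∈ polyFun α, F =ᵐ[ρ] 0 → shiftInt m σ φ F =ᵐ[ρ] 0) :
    ∃ K : TestFunctions α →ₗ[ℂ] Module.End ℂ (polyDomain α ρ),
      Represents K fun φ => shiftInt m σ φ :=
  PascalCurrent.exists_represents hρ hp0 hp1 (fun φ F hF => h.exists_polyFun F hF φ)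
    (fun φ F hF G hG => h.shiftInt_add φ hF hG)
    (fun φ c F _ => by rw [IsShift.shiftInt_smul])
    (fun φ ψ F hF => h.shiftInt_add_left φ ψ hF)
    (fun c φ F _ => by rw [IsShift.shiftInt_smul_left]) h0

theorem coeFn_vacuum [IsProbabilityMeasure ρ] :
    ((vacuum α ρ : polyDomain α ρ) : Lp ℂ 2 ρ) =ᵐ[ρ] fun _ => (1 : ℂ) :=
  Lp.coeFn_const _ _ _

theorem one_mem_polyFun : (fun _ : Config X => (1 : ℂ)) ∈ polyFun α := const_mem_polyFun 1

theorem inner_eq_integral {f g : polyDomain α ρ} {F G : Config X → ℂ}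
    (hf : (f : Lp ℂ 2 ρ) =ᵐ[ρ] F) (hg : (g : Lp ℂ 2 ρ) =ᵐ[ρ] G) :
    inner ℂ (f : Lp ℂ 2 ρ) (g : Lp ℂ 2 ρ) = ∫ η, starRingEnd ℂ (F η) * G η ∂ρ := by
  rw [L2.inner_def]
  refine integral_congr_ae ?_
  filter_upwards [hf, hg] with η h1 h2
  rw [h1, h2, RCLike.inner_apply, mul_comm]

theorem inner_countMul {M : TestFunctions α →ₗ[ℂ] Module.End ℂ (polyDomain α ρ)}
    (hM : Represents M countMul) (φ : TestFunctions α)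
    (f g : polyDomain α ρ) :
    inner ℂ (f : Lp ℂ 2 ρ) (M φ g : Lp ℂ 2 ρ) =
      inner ℂ (M (star φ) f : Lp ℂ 2 ρ) (g : Lp ℂ 2 ρ) := by
  obtain ⟨F, hF, hf⟩ := f.2
  obtain ⟨G, hG, hg⟩ := g.2
  rw [inner_eq_integral hf (hM φ g G hG hg), inner_eq_integral (hM (star φ) f F hF hf) hg]
  congr 1 with η
  simp only [countMul]
  rw [map_mul, ← integral_conj]
  have h2 : ∫ x, starRingEnd ℂ (((star φ : TestFunctions α) : X → ℂ) x) ∂η.1 =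
      ∫ x, (φ : X → ℂ) x ∂η.1 := by
    congr 1 with x
    exact Complex.conj_conj _
  rw [h2]
  ring

section

variable [MeasurableSingletonClass X]
  {Ap Am M : TestFunctions α →ₗ[ℂ] Module.End ℂ (polyDomain α ρ)}

theorem isShiftSystem [IsProbabilityMeasure ρ] (hρ : IsPascalLaw p α ρ) (hp0 : 0 < p) (hp1 : p < 1)
    (hAp : Represents Ap fun φ => shiftInt (fun η => α + η.1) Config.add φ)
    (hAm : Represents Am fun φ => shiftInt (fun η => η.1) Config.sub φ)
    (hM : Represents M countMul) :
    IsShiftSystem Ap Am M (refInt α) (vacuum α ρ) where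
  add_mul φ ψ v := by
    obtain ⟨F, hF, hv⟩ := v.2
    -- M is known only on polynomial representatives, so the shifted integral is first replaced by
    -- one.
    obtain ⟨G, hG, hFG⟩ := (isShift_add hρ hp0 hp1).exists_polyFun F hF φ
    refine polyDomain_ext (hAp φ _ _ (countMul_mem ψ hF) (hM ψ v F hF hv)) ?_
    refine (coeFn_polyDomain_add _ _).trans ?_
    filter_upwards [hM ψ _ G hG ((hAp φ v F hF hv).trans hFG), hAp (φ * ψ) v F hF hv, hFG,
      (isShift_add hρ hp0 hp1).shiftInt_mul φ ψ hF] with η h1 h2 h3 h4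
    rw [Pi.add_apply, h1, h2]
    refine Eq.trans ?_ h4.symm
    rw [countMul, ← h3, one_mul]
  sub_mul φ ψ v := by
    obtain ⟨F, hF, hv⟩ := v.2
    obtain ⟨G, hG, hFG⟩ := (isShift_sub hρ hp0 hp1).exists_polyFun F hF φ
    refine polyDomain_ext (hAm φ _ _ (countMul_mem ψ hF) (hM ψ v F hF hv)) ?_
    refine (Lp.coeFn_sub _ _).trans ?_
    filter_upwards [hM ψ _ G hG ((hAm φ v F hF hv).trans hFG), hAm (φ * ψ) v F hF hv, hFG,
      (isShift_sub hρ hp0 hp1).shiftInt_mul φ ψ hF] with η h1 h2 h3 h4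
    rw [Pi.sub_apply, h1, h2]
    refine Eq.trans ?_ h4.symm
    rw [countMul, ← h3]
    ring
  mul_comm φ ψ v := by
    obtain ⟨F, hF, hv⟩ := v.2
    refine polyDomain_ext (hM φ _ _ (countMul_mem ψ hF) (hM ψ v F hF hv))
      ((hM ψ _ _ (countMul_mem φ hF) (hM φ v F hF hv)).trans
        (Filter.Eventually.of_forall fun η => ?_))
    exact mul_left_comm _ _ _
  add_vacuum φ := by
    refine polyDomain_ext (hAp φ _ _ one_mem_polyFun coeFn_vacuum) ?_
    refine (coeFn_polyDomain_add _ _).trans ?_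
    filter_upwards [coeFn_polyDomain_smul (refInt α φ) (vacuum α ρ),
      hM φ _ _ one_mem_polyFun coeFn_vacuum, coeFn_vacuum (α := α) (ρ := ρ),
      TestFunctions.ae_integrable φ hρ hp0 hp1] with η h1 h2 h3 h4
    rw [Pi.add_apply, h1, h2, Pi.smul_apply, h3, shiftInt, countMul]
    simp only [mul_one, smul_eq_mul]
    exact (integral_add_measure (TestFunctions.integrable φ) h4).symm
  sub_vacuum φ := by
    refine polyDomain_ext (hAm φ _ _ one_mem_polyFun coeFn_vacuum)
      ((hM φ _ _ one_mem_polyFun coeFn_vacuum).trans (Filter.Eventually.of_forall fun η => ?_))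
    simp only [countMul, shiftInt, mul_one]
  eq_top W h1 hW := by
    suffices ∀ F ∈ polyFun α, ∀ f : polyDomain α ρ, (f : Lp ℂ 2 ρ) =ᵐ[ρ] F → f ∈ W by
      rw [eq_top_iff]
      intro f _
      obtain ⟨F, hF, hf⟩ := f.2
      exact this F hF f hf
    refine polyFun_induction (fun c f hf => ?_) (fun F hF G hG h2 h3 f hf => ?_)
      (fun F hF φ h2 f hf => ?_)
    · have : f = c • vacuum α ρ := by
        refine polyDomain_ext hf ((coeFn_polyDomain_smul _ _).trans ?_)
        filter_upwards [coeFn_vacuum (α := α) (ρ := ρ)] with η h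
        rw [Pi.smul_apply, h, smul_eq_mul, mul_one]
      rw [this]
      exact W.smul_mem c h1
    · obtain ⟨f', hf'⟩ := exists_polyDomain hρ hp0 hp1 hF Filter.EventuallyEq.rfl
      obtain ⟨g', hg'⟩ := exists_polyDomain hρ hp0 hp1 hG Filter.EventuallyEq.rfl
      rw [polyDomain_ext hf ((coeFn_polyDomain_add f' g').trans (hf'.add hg'))]
      exact W.add_mem (h2 f' hf') (h3 g' hg')
    · obtain ⟨f', hf'⟩ := exists_polyDomain hρ hp0 hp1 hF Filter.EventuallyEq.rfl
      rw [polyDomain_ext hf (hM φ f' F hF hf')]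
      exact hW φ f' (h2 f' hf')

theorem inner_add (hρ : IsPascalLaw p α ρ) (hp0 : 0 < p) (hp1 : p < 1)
    (hAp : Represents Ap fun φ => shiftInt (fun η => α + η.1) Config.add φ)
    (hAm : Represents Am fun φ => shiftInt (fun η => η.1) Config.sub φ)
    (φ : TestFunctions α) (f g : polyDomain α ρ) :
    inner ℂ (f : Lp ℂ 2 ρ) (Ap φ g : Lp ℂ 2 ρ) =
      (p : ℂ)⁻¹ * inner ℂ (Am (star φ) f : Lp ℂ 2 ρ) (g : Lp ℂ 2 ρ) := by
  obtain ⟨F, hF, hf⟩ := f.2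
  obtain ⟨G, hG, hg⟩ := g.2
  rw [inner_eq_integral hf (hAp φ g G hG hg), inner_eq_integral (hAm (star φ) f F hF hf) hg]
  have h := hρ.integral_sub_mul hp0 hp1 _ (star_mem_polyFun F hF) φ G hG
  simp_rw [shiftInt_conj] at h
  rw [h, inv_mul_cancel_left₀ (by exact_mod_cast hp0.ne')]

theorem inner_sub (hρ : IsPascalLaw p α ρ) (hp0 : 0 < p) (hp1 : p < 1)
    (hAp : Represents Ap fun φ => shiftInt (fun η => α + η.1) Config.add φ)
    (hAm : Represents Am fun φ => shiftInt (fun η => η.1) Config.sub φ)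
    (φ : TestFunctions α) (f g : polyDomain α ρ) :
    inner ℂ (f : Lp ℂ 2 ρ) (Am φ g : Lp ℂ 2 ρ) =
      p * inner ℂ (Ap (star φ) f : Lp ℂ 2 ρ) (g : Lp ℂ 2 ρ) := by
  have h := inner_add hρ hp0 hp1 hAp hAm (star φ) g f
  rw [star_star] at h
  rw [← inner_conj_symm, ← inner_conj_symm (Ap (star φ) f : Lp ℂ 2 ρ), h, map_mul, map_inv₀,
    Complex.conj_ofReal, mul_inv_cancel_left₀ (by exact_mod_cast hp0.ne')]

/-- The adjoint of a current with real coefficients. -/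
theorem inner_current (hρ : IsPascalLaw p α ρ) (hp0 : 0 < p) (hp1 : p < 1)
    (hAp : Represents Ap fun φ => shiftInt (fun η => α + η.1) Config.add φ)
    (hAm : Represents Am fun φ => shiftInt (fun η => η.1) Config.sub φ)
    (hM : Represents M countMul) (x y z : ℝ) (φ : TestFunctions α) (f g : polyDomain α ρ) :
    inner ℂ (f : Lp ℂ 2 ρ) (IsShiftSystem.current Ap Am M (refInt α) x y z φ g : Lp ℂ 2 ρ) =
      inner ℂ (IsShiftSystem.current Ap Am M (refInt α) (p * y) ((p : ℂ)⁻¹ * x) z (star φ) f :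
        Lp ℂ 2 ρ) (g : Lp ℂ 2 ρ) := by
  simp only [IsShiftSystem.current_apply, LinearMap.add_apply, LinearMap.smul_apply,
    IsShiftSystem.mulOp_apply, Submodule.coe_add, Submodule.coe_smul, inner_add_left,
    inner_add_right, inner_smul_left, inner_smul_right, inner_add hρ hp0 hp1 hAp hAm,
    inner_sub hρ hp0 hp1 hAp hAm, inner_countMul hM, refInt_star, map_mul, map_inv₀,
    Complex.conj_ofReal, Complex.conj_conj, map_ofNat]
  ring

end

end

section

/-! ### Determinacy of moments -/

section

variable {Ω : Type*} [MeasurableSpace Ω] {ρ : Measure Ω} {u v Y : Ω → ℝ} {t : ℝ}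

theorem integral_withDensity_ofReal (hv : Measurable v) {E : Type*} [NormedAddCommGroup E]
    [NormedSpace ℝ E] (f : Ω → E) :
    ∫ ω, f ω ∂ρ.withDensity (fun ω => ENNReal.ofReal (v ω)) = ∫ ω, max (v ω) 0 • f ω ∂ρ := by
  rw [integral_withDensity_eq_integral_toReal_smul hv.ennreal_ofReal
    (Filter.Eventually.of_forall fun _ => ENNReal.ofReal_lt_top)]
  simp_rw [ENNReal.toReal_ofReal']

theorem integrable_withDensity_ofReal (hv : Measurable v) {E : Type*} [NormedAddCommGroup E]
    [NormedSpace ℝ E] {f : Ω → E} :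
    Integrable f (ρ.withDensity fun ω => ENNReal.ofReal (v ω)) ↔
      Integrable (fun ω => max (v ω) 0 • f ω) ρ := by
  rw [integrable_withDensity_iff_integrable_smul' hv.ennreal_ofReal
    (Filter.Eventually.of_forall fun _ => ENNReal.ofReal_lt_top)]
  simp_rw [ENNReal.toReal_ofReal']

/-- Half of the available exponent is spent on square integrability, so that products with a
square-integrable density remain integrable. -/
theorem memLp_exp_of_abs_le (hY : Measurable Y)
    (hexp : Integrable (fun ω => Real.exp (t * |Y ω|)) ρ) {s : ℝ} (hs : |s| ≤ t / 2) :
    MemLp (fun ω => Real.exp (s * Y ω)) 2 ρ := by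
  have hm : Measurable fun ω => Real.exp (s * Y ω) := by fun_prop
  rw [memLp_two_iff_integrable_sq hm.aestronglyMeasurable]
  refine hexp.mono' (hm.pow_const 2).aestronglyMeasurable (Filter.Eventually.of_forall fun ω => ?_)
  rw [Real.norm_eq_abs, abs_of_nonneg (by positivity), ← Real.exp_nat_mul, Real.exp_le_exp]
  have h1 : s * Y ω ≤ |s| * |Y ω| := by rw [← abs_mul]; exact le_abs_self _
  have h2 := mul_le_mul_of_nonneg_right hs (abs_nonneg (Y ω))
  push_cast
  linarith

theorem mem_interior_integrableExpSet (hv : Measurable v) (hv2 : MemLp v 2 ρ) (hY : Measurable Y)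
    (hexp : Integrable (fun ω => Real.exp (t * |Y ω|)) ρ) {s : ℝ} (hs : |s| < t / 2) :
    s ∈ interior (integrableExpSet Y (ρ.withDensity fun ω => ENNReal.ofReal (v ω))) := by
  refine mem_interior.2 ⟨Set.Ioo (-(t / 2)) (t / 2), fun r hr => ?_, isOpen_Ioo, abs_lt.1 hs⟩
  rw [integrableExpSet, Set.mem_ofPred_eq, integrable_withDensity_ofReal hv]
  have h1 : MemLp (fun ω => max (v ω) 0) 2 ρ := by
    refine hv2.mono (hv.max measurable_const).aestronglyMeasurable
      (Filter.Eventually.of_forall fun ω => ?_)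
    rw [Real.norm_eq_abs, Real.norm_eq_abs, abs_of_nonneg (le_max_right _ _)]
    exact max_le (le_abs_self _) (abs_nonneg _)
  exact h1.integrable_mul (memLp_exp_of_abs_le hY hexp (abs_lt.2 hr).le)

/-- Both transforms are analytic on the strip |Re z| < t/2 and have equal derivatives at 0, namely
the moments. The identity theorem carries equality along the strip to i, where they give the
characteristic functions at 1. -/
theorem complexMGF_eq_of_moments [IsProbabilityMeasure ρ] (hu : Measurable u) (hu2 : MemLp u 2 ρ)
    (hY : Measurable Y) (ht : 0 < t) (hexp : Integrable (fun ω => Real.exp (t * |Y ω|)) ρ)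
    (hmom : ∀ n : ℕ, ∫ ω, Y ω ^ n * u ω ∂ρ = 0) :
    complexMGF Y (ρ.withDensity fun ω => ENNReal.ofReal (u ω)) Complex.I =
      complexMGF Y (ρ.withDensity fun ω => ENNReal.ofReal (-u ω)) Complex.I := by
  have hu' : Measurable fun ω => -u ω := hu.neg
  set μ := ρ.withDensity fun ω => ENNReal.ofReal (u ω) with hμ
  set ν := ρ.withDensity fun ω => ENNReal.ofReal (-u ω) with hν
  have h1 : ∀ s : ℝ, |s| < t / 2 → s ∈ interior (integrableExpSet Y μ) := fun s hs =>
    mem_interior_integrableExpSet hu hu2 hY hexp hs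
  have h2 : ∀ s : ℝ, |s| < t / 2 → s ∈ interior (integrableExpSet Y ν) := fun s hs =>
    mem_interior_integrableExpSet hu.neg hu2.neg hY hexp hs
  let U : Set ℂ := {z | |z.re| < t / 2}
  have hU : U = Complex.re ⁻¹' Set.Ioo (-(t / 2)) (t / 2) := by
    ext z
    exact abs_lt (a := z.re)
  have hUc : IsPreconnected U := by
    rw [hU]
    exact ((convex_Ioo (-(t / 2)) (t / 2)).linear_preimage Complex.reLm).isPreconnected
  have hA : AnalyticOnNhd ℂ (complexMGF Y μ) U := fun z hz => analyticAt_complexMGF (h1 _ hz)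
  have hB : AnalyticOnNhd ℂ (complexMGF Y ν) U := fun z hz => analyticAt_complexMGF (h2 _ hz)
  have h0 : (0 : ℂ) ∈ U := by simp [U, ht]
  have hI : Complex.I ∈ U := by simp [U, ht]
  have h01 : (0 : ℝ) ∈ interior (integrableExpSet Y μ) := h1 0 (by simp [ht])
  have h02 : (0 : ℝ) ∈ interior (integrableExpSet Y ν) := h2 0 (by simp [ht])
  have hder : ∀ n : ℕ, iteratedDeriv n (complexMGF Y μ) 0 = iteratedDeriv n (complexMGF Y ν) 0 := by
    intro n
    rw [iteratedDeriv_complexMGF (by simpa using h01),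
      iteratedDeriv_complexMGF (by simpa using h02)]
    simp only [zero_mul, Complex.exp_zero, mul_one, ← Complex.ofReal_pow]
    rw [integral_complex_ofReal, integral_complex_ofReal, hμ, hν, integral_withDensity_ofReal hu,
      integral_withDensity_ofReal hu']
    have i1 := integrable_pow_of_mem_interior_integrableExpSet h01 n
    have i2 := integrable_pow_of_mem_interior_integrableExpSet h02 n
    rw [hμ, integrable_withDensity_ofReal hu] at i1
    rw [hν, integrable_withDensity_ofReal hu'] at i2
    congr 1
    rw [← sub_eq_zero, ← integral_sub i1 i2]
    refine Eq.trans ?_ (hmom n)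
    congr 1 with ω
    rw [smul_eq_mul, smul_eq_mul, ← sub_mul, mul_comm]
    congr 1
    rcases le_total (u ω) 0 with h | h
    · rw [max_eq_right h, max_eq_left (by linarith)]
      ring
    · rw [max_eq_left h, max_eq_right (by linarith)]
      ring
  have hev : complexMGF Y μ =ᶠ[nhds 0] complexMGF Y ν := by
    have e1 := (hA 0 h0).hasFPowerSeriesAt
    have e2 := (hB 0 h0).hasFPowerSeriesAt
    simp_rw [hder] at e1
    have e3 := e1.sub e2
    rw [sub_self] at e3
    filter_upwards [e3.eventually_eq_zero] with z hz
    exact sub_eq_zero.1 hz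
  exact hA.eqOn_of_preconnected_of_eventuallyEq hB hUc h0 hev hI

end

/-! ### Density of polynomials -/

variable {X : Type*} [MeasurableSpace X] {α : Measure X} {p : ℝ} {ρ : Measure (Config X)}

/-- The sets of finite reference measure. -/
abbrev FiniteSets (α : Measure X) : Type _ := {B : Set X // MeasurableSet B ∧ α B < ∞}

/-- The counting variables generate the σ-algebra up to passage to sets of finite measure. -/
theorem measurableSpace_config_le [SigmaFinite α] :
    (inferInstance : MeasurableSpace (Config X)) ≤
      MeasurableSpace.comap (fun (η : Config X) (B : FiniteSets α) => η.1 B.1)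
        MeasurableSpace.pi := by
  set m' := MeasurableSpace.comap (fun (η : Config X) (B : FiniteSets α) => η.1 B.1)
    MeasurableSpace.pi with hm'
  have h1 : ∀ B : FiniteSets α, Measurable[m'] fun η : Config X => η.1 B.1 := fun B =>
    (measurable_pi_apply B).comp
      (comap_measurable fun (η : Config X) (B : FiniteSets α) => η.1 B.1)
  have h2 : Measurable[m'] (Subtype.val : Config X → Measure X) := by
    refine @Measure.measurable_of_measurable_coe _ _ _ m' _ fun B hB => ?_
    have e : (fun η : Config X => η.1 B) = fun η : Config X =>
        ⨆ n : ℕ, η.1 (B ∩ spanningSets α n) := by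
      funext η
      rw [← Monotone.measure_iUnion, ← Set.inter_iUnion, iUnion_spanningSets, Set.inter_univ]
      exact fun i j hij => Set.inter_subset_inter_right _ (monotone_spanningSets α hij)
    rw [e]
    refine Measurable.iSup fun n => ?_
    exact h1 ⟨B ∩ spanningSets α n, hB.inter (measurableSet_spanningSets α n),
      (measure_mono Set.inter_subset_right).trans_lt (measure_spanningSets_lt_top α n)⟩
  exact measurable_iff_comap_le.1 h2

/-- A finite measure on configurations that is absolutely continuous with respect to the Pascal law
is determined by the characteristic functions of the counting variables. -/
theorem measure_ext_of_complexMGF [SigmaFinite α] (hρ : IsPascalLaw p α ρ) (hp0 : 0 < p)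
    (hp1 : p < 1) {μ ν : Measure (Config X)} [IsFiniteMeasure μ] [IsFiniteMeasure ν] (hμ : μ ≪ ρ)
    (hν : ν ≪ ρ)
    (h : ∀ (I : Finset (FiniteSets α)) (t : I → ℝ),
      complexMGF (fun η => ∑ j : I, t j * (η.1 j.1.1).toReal) μ Complex.I =
        complexMGF (fun η => ∑ j : I, t j * (η.1 j.1.1).toReal) ν Complex.I) : μ = ν := by
  let Φ : Config X → FiniteSets α → ℝ≥0∞ := fun η B => η.1 B.1
  have hΦ : Measurable Φ := measurable_pi_lambda _ fun B => measurable_count B.2.1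
  have hmarg : ∀ I : Finset (FiniteSets α),
      (μ.map Φ).map I.restrict = (ν.map Φ).map I.restrict := by
    intro I
    -- Characteristic functions determine laws on a Euclidean space, so the counts are made real. As
    -- they are almost surely finite, `ENNReal.ofReal` recovers them afterwards.
    let V : Config X → EuclideanSpace ℝ I := fun η => WithLp.toLp 2 fun j => (η.1 j.1.1).toReal
    have hV : Measurable V := (WithLp.measurable_toLp 2 _).comp
      (measurable_pi_lambda _ fun j => measurable_count_toReal j.1.2.1)
    have hVeq : μ.map V = ν.map V := by
      refine Measure.ext_of_charFun (funext fun t => ?_)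
      have e : ∀ κ : Measure (Config X), charFun (κ.map V) t =
          complexMGF (fun η => ∑ j : I, t j * (η.1 j.1.1).toReal) κ Complex.I := by
        intro κ
        rw [charFun_apply, integral_map hV.aemeasurable (by fun_prop), complexMGF]
        congr 1 with η
        rw [mul_comm]
        congr 3
      rw [e, e, h]
    let f : EuclideanSpace ℝ I → I → ℝ≥0∞ := fun v j => ENNReal.ofReal (v j)
    have hf : Measurable f := measurable_pi_lambda _ fun j => by fun_prop
    have hae : ∀ᵐ η ∂ρ, (I.restrict ∘ Φ) η = (f ∘ V) η := by
      filter_upwards [ae_all_iff.2 fun j : I => hρ.ae_count_lt_top hp0 hp1 j.1.2.1 j.1.2.2]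
        with η hη
      funext j
      exact (ENNReal.ofReal_toReal (hη j).ne).symm
    have e : ∀ κ : Measure (Config X), κ ≪ ρ → (κ.map Φ).map I.restrict = (κ.map V).map f := by
      intro κ hκ
      rw [Measure.map_map (Finset.measurable_restrict I) hΦ, Measure.map_map hf hV]
      exact Measure.map_congr (hκ.ae_le hae)
    rw [e μ hμ, e ν hν, hVeq]
  have hmap : μ.map Φ = ν.map Φ :=
    IsProjectiveLimit.unique (P := fun I => (ν.map Φ).map I.restrict) hmarg fun I => rfl
  ext A hA
  obtain ⟨E, hE, rfl⟩ := measurableSpace_config_le (α := α) A hA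
  rw [← Measure.map_apply hΦ hE, ← Measure.map_apply hΦ hE, hmap]

/-- Exponential moments of linear combinations of counting variables. -/
theorem IsPascalLaw.exists_integrable_exp_sum (hρ : IsPascalLaw p α ρ) (hp0 : 0 < p) (hp1 : p < 1)
    (I : Finset (FiniteSets α)) (t : I → ℝ) :
    ∃ s > 0, Integrable (fun η : Config X =>
      Real.exp (s * |∑ j : I, t j * (η.1 j.1.1).toReal|)) ρ := by
  let S : Set X := ⋃ j : I, j.1.1
  have hS : MeasurableSet S := MeasurableSet.iUnion fun j => j.1.2.1
  have hSα : α S < ∞ := (measure_iUnion_le _).trans_lt (by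
    rw [tsum_fintype]
    exact ENNReal.sum_lt_top.2 fun j _ => j.1.2.2)
  obtain ⟨r, hr, hint⟩ := hρ.exists_integrable_exp hp0 hp1 hS hSα
  -- The summand 1 keeps K positive when all coefficients vanish.
  let K : ℝ := 1 + ∑ j : I, |t j|
  have hK0 : 0 ≤ ∑ j : I, |t j| := Finset.sum_nonneg fun j _ => abs_nonneg _
  have hK : 0 < K := by positivity
  have hm : Measurable fun η : Config X => ∑ j : I, t j * (η.1 j.1.1).toReal :=
    Finset.measurable_sum _ fun j _ => (measurable_count_toReal j.1.2.1).const_mul _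
  refine ⟨r / K, by positivity,
    hint.mono' (by exact (hm.norm.const_mul _).exp.aestronglyMeasurable) ?_⟩
  filter_upwards [hρ.ae_count_lt_top hp0 hp1 hS hSα] with η hη
  rw [Real.norm_eq_abs, Real.abs_exp, Real.exp_le_exp]
  have h1 : |∑ j : I, t j * (η.1 j.1.1).toReal| ≤ K * (η.1 S).toReal := by
    refine (Finset.abs_sum_le_sum_abs _ _).trans (le_trans (Finset.sum_le_sum fun j _ => ?_)
      (b := ∑ j : I, |t j| * (η.1 S).toReal) ?_)
    · rw [abs_mul, abs_of_nonneg ENNReal.toReal_nonneg]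
      exact mul_le_mul_of_nonneg_left (ENNReal.toReal_mono hη.ne
        (measure_mono (Set.subset_iUnion (fun j : I => j.1.1) j))) (abs_nonneg _)
    · rw [← Finset.sum_mul]
      exact mul_le_mul_of_nonneg_right (by linarith) ENNReal.toReal_nonneg
  calc r / K * |∑ j : I, t j * (η.1 j.1.1).toReal| ≤ r / K * (K * (η.1 S).toReal) :=
        mul_le_mul_of_nonneg_left h1 (by positivity)
    _ = r * (η.1 S).toReal := by field_simp

/-- A square-integrable function that is orthogonal to all powers of linear combinations of counting
variables vanishes. -/
theorem IsPascalLaw.ae_eq_zero_of_moments [SigmaFinite α] [IsProbabilityMeasure ρ]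
    (hρ : IsPascalLaw p α ρ) (hp0 : 0 < p) (hp1 : p < 1) {u : Config X → ℝ} (hu : Measurable u)
    (hu2 : MemLp u 2 ρ)
    (h : ∀ (I : Finset (FiniteSets α)) (t : I → ℝ) (n : ℕ),
      ∫ η : Config X, (∑ j : I, t j * (η.1 j.1.1).toReal) ^ n * u η ∂ρ = 0) : u =ᵐ[ρ] 0 := by
  have hi : Integrable u ρ := hu2.integrable (by norm_num)
  have : IsFiniteMeasure (ρ.withDensity fun η => ENNReal.ofReal (u η)) :=
    isFiniteMeasure_withDensity_ofReal hi.2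
  have : IsFiniteMeasure (ρ.withDensity fun η => ENNReal.ofReal (-u η)) :=
    isFiniteMeasure_withDensity_ofReal hi.neg.2
  have key := measure_ext_of_complexMGF hρ hp0 hp1
    (withDensity_absolutelyContinuous ρ fun η => ENNReal.ofReal (u η))
    (withDensity_absolutelyContinuous ρ fun η => ENNReal.ofReal (-u η)) fun I t => by
      obtain ⟨s, hs, hexp⟩ := hρ.exists_integrable_exp_sum hp0 hp1 I t
      exact complexMGF_eq_of_moments hu hu2
        (Finset.measurable_sum _ fun j _ => (measurable_count_toReal j.1.2.1).const_mul _)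
        hs hexp (h I t)
  have hu' : Measurable fun η => -u η := hu.neg
  rw [withDensity_eq_iff hu.ennreal_ofReal.aemeasurable hu'.ennreal_ofReal.aemeasurable
    hi.lintegral_lt_top.ne] at key
  filter_upwards [key] with η hη
  have h1 := congrArg ENNReal.toReal hη
  rw [ENNReal.toReal_ofReal', ENNReal.toReal_ofReal'] at h1
  rcases le_total (u η) 0 with h2 | h2
  · rw [max_eq_right h2, max_eq_left (by linarith)] at h1
    exact neg_eq_zero.1 h1.symm
  · rw [max_eq_left h2, max_eq_right (by linarith)] at h1
    exact h1

theorem integral_indicatorTest {B : Set X} (hB : MeasurableSet B) (hα : α B < ∞)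
    (μ : Measure X) : ∫ x, (indicatorTest α B hB hα : X → ℂ) x ∂μ = (μ B).toReal := by
  change ∫ x, B.indicator (fun _ => (1 : ℂ)) x ∂μ = _
  rw [integral_indicator_const _ hB, Complex.real_smul, mul_one]
  rfl

/-- Polynomials are dense. -/
theorem IsPascalLaw.dense_polyDomain [SigmaFinite α] [IsProbabilityMeasure ρ]
    (hρ : IsPascalLaw p α ρ) (hp0 : 0 < p) (hp1 : p < 1) :
    Dense (polyDomain α ρ : Set (Lp ℂ 2 ρ)) := by
  -- A vector g orthogonal to all polynomials is orthogonal to powers of real combinations of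
  -- counts. These being real, the real and imaginary parts of g inherit the property separately and
  -- vanish.
  rw [Submodule.dense_iff_topologicalClosure_eq_top, Submodule.topologicalClosure_eq_top_iff,
    Submodule.eq_bot_iff]
  intro g hg
  have hgm : Measurable (g : Config X → ℂ) := (Lp.stronglyMeasurable g).measurable
  have hg2 : MemLp (g : Config X → ℂ) 2 ρ := Lp.memLp g
  have hmom : ∀ (I : Finset (FiniteSets α)) (t : I → ℝ) (n : ℕ),
      Integrable (fun η : Config X =>
        (((∑ j : I, t j * (η.1 j.1.1).toReal) ^ n : ℝ) : ℂ) * g η) ρ ∧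
      ∫ η : Config X, (((∑ j : I, t j * (η.1 j.1.1).toReal) ^ n : ℝ) : ℂ) * g η ∂ρ = 0 := by
    intro I t n
    have hF : (fun η : Config X => (((∑ j : I, t j * (η.1 j.1.1).toReal) ^ n : ℝ) : ℂ)) ∈
        polyFun α := by
      have : (∑ j : I, (t j : ℂ) • fun η : Config X =>
          ∫ x, (indicatorTest α j.1.1 j.1.2.1 j.1.2.2 : X → ℂ) x ∂η.1) ^ n ∈ polyFun α :=
        pow_mem (sum_mem fun j _ => (polyFun α).smul_mem (integral_mem_polyFun _) _) n
      convert this using 1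
      funext η
      simp only [Pi.pow_apply, Finset.sum_apply, Pi.smul_apply, integral_indicatorTest,
        smul_eq_mul]
      push_cast
      rfl
    obtain ⟨f, hf⟩ := exists_polyDomain hρ hp0 hp1 hF Filter.EventuallyEq.rfl
    have e : (fun η => inner ℂ ((f : Lp ℂ 2 ρ) η) (g η)) =ᵐ[ρ] fun η : Config X =>
        (((∑ j : I, t j * (η.1 j.1.1).toReal) ^ n : ℝ) : ℂ) * g η := by
      filter_upwards [hf] with η hη
      rw [hη, RCLike.inner_apply, Complex.conj_ofReal, mul_comm]
    exact ⟨(L2.integrable_inner (𝕜 := ℂ) (f : Lp ℂ 2 ρ) g).congr e, by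
      rw [← integral_congr_ae e, ← L2.inner_def]
      exact (Submodule.mem_orthogonal _ _).1 hg f f.2⟩
  have hre : (fun η => (g η).re) =ᵐ[ρ] 0 :=
    hρ.ae_eq_zero_of_moments hp0 hp1 (Complex.measurable_re.comp hgm) hg2.re fun I t n => by
      have h := Complex.reCLM.integral_comp_comm (hmom I t n).1
      rw [(hmom I t n).2, map_zero] at h
      simpa only [Complex.reCLM_apply, Complex.re_ofReal_mul] using h
  have him : (fun η => (g η).im) =ᵐ[ρ] 0 :=
    hρ.ae_eq_zero_of_moments hp0 hp1 (Complex.measurable_im.comp hgm) hg2.im fun I t n => by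
      have h := Complex.imCLM.integral_comp_comm (hmom I t n).1
      rw [(hmom I t n).2, map_zero] at h
      simpa only [Complex.imCLM_apply, Complex.im_ofReal_mul] using h
  refine (Lp.eq_zero_iff_ae_eq_zero).2 ?_
  filter_upwards [hre, him] with η h1 h2
  exact Complex.ext h1 h2

end

section

namespace IsShiftSystem

/-! ### The currents of raising, lowering and neutral operators -/

variable {𝒞 D : Type*} [NonUnitalCommRing 𝒞] [Module ℂ 𝒞] [AddCommGroup D] [Module ℂ D]
  {Ap Am M : 𝒞 →ₗ[ℂ] Module.End ℂ D} {a : 𝒞 →ₗ[ℂ] ℂ} {Ψ : D} {p : ℝ}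

/-- The current of the raising operators. -/
noncomputable abbrev raisingCurrent (p : ℝ) (Ap Am M : 𝒞 →ₗ[ℂ] Module.End ℂ D) (a : 𝒞 →ₗ[ℂ] ℂ) :
    𝒞 →ₗ[ℂ] Module.End ℂ D :=
  current Ap Am M a (1 / (cConst p : ℂ) * p) (1 / (cConst p : ℂ) * (p : ℂ)⁻¹)
    (-(1 / (cConst p : ℂ)))

/-- The current of the lowering operators. -/
noncomputable abbrev loweringCurrent (p : ℝ) (Ap Am M : 𝒞 →ₗ[ℂ] Module.End ℂ D) (a : 𝒞 →ₗ[ℂ] ℂ) :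
    𝒞 →ₗ[ℂ] Module.End ℂ D :=
  current Ap Am M a (1 / (cConst p : ℂ)) (1 / (cConst p : ℂ)) (-(1 / (cConst p : ℂ)))

/-- The current of the neutral operators. -/
noncomputable abbrev neutralCurrent (p : ℝ) (Ap Am M : 𝒞 →ₗ[ℂ] Module.End ℂ D) (a : 𝒞 →ₗ[ℂ] ℂ) :
    𝒞 →ₗ[ℂ] Module.End ℂ D :=
  current Ap Am M a (-(1 / (cConst p : ℂ)) * (√p : ℂ)) (-(1 / (cConst p : ℂ)) * (√p : ℂ)⁻¹)
    (1 / (cConst p : ℂ) * (((√p : ℂ) + (√p : ℂ)⁻¹) / 2))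

theorem smul_current (s x y z : ℂ) :
    s • current Ap Am M a x y z = current Ap Am M a (s * x) (s * y) (s * z) := by
  simp only [current, smul_add, smul_smul]

theorem current_zero : current Ap Am M a 0 0 0 = 0 := by
  simp [current]

theorem lie_current_self (h : IsShiftSystem Ap Am M a Ψ) (x y z : ℂ) (φ θ : 𝒞) :
    ⁅current Ap Am M a x y z φ, current Ap Am M a x y z θ⁆ = 0 := by
  have e : ∀ u v : ℂ, 2 * (u * v - v * u) = 0 ∧ u * v - v * u = 0 := fun u v =>
    ⟨by ring, by ring⟩
  rw [h.lie_current, (e x z).1, (e z y).1, (e x y).2, current_zero, LinearMap.zero_apply]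

theorem sqrt_ne_zero (hp0 : 0 < p) : (√p : ℂ) ≠ 0 := by
  exact_mod_cast (Real.sqrt_pos.2 hp0).ne'

theorem sq_sqrt (hp0 : 0 < p) : (√p : ℂ) ^ 2 = p := by
  exact_mod_cast Real.sq_sqrt hp0.le

theorem cConst_ne_zero (hp0 : 0 < p) (hp1 : p < 1) : (cConst p : ℂ) ≠ 0 := by
  exact_mod_cast (cConst_pos hp0 hp1).ne'

theorem cConst_eq : (cConst p : ℂ) = (√p : ℂ)⁻¹ - √p := by
  simp [cConst]

theorem cConst_mul_sqrt (hp0 : 0 < p) : (cConst p : ℂ) * √p = 1 - p := by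
  rw [cConst_eq, _root_.sub_mul, inv_mul_cancel₀ (sqrt_ne_zero hp0), ← sq, sq_sqrt hp0]

/-- The three coefficients are compared; each identity reduces to c√p = 1 - p. -/
theorem lie_lowering_raising (h : IsShiftSystem Ap Am M a Ψ) (hp0 : 0 < p) (hp1 : p < 1) (φ θ : 𝒞) :
    ⁅loweringCurrent p Ap Am M a φ, raisingCurrent p Ap Am M a θ⁆ =
      (2 : ℂ) • neutralCurrent p Ap Am M a (φ * θ) := by
  have hr := sqrt_ne_zero hp0
  have hc := cConst_ne_zero hp0 hp1
  have hpr := sq_sqrt hp0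
  have h1 := cConst_mul_sqrt hp0
  rw [← LinearMap.smul_apply, smul_current, h.lie_current, ← hpr]
  rw [← hpr] at h1
  congr 2
  · field_simp
    linear_combination h1
  · field_simp
    linear_combination h1
  · field_simp
    linear_combination (-(√p : ℂ) ^ 2 - 1) * h1

theorem lie_neutral_raising (h : IsShiftSystem Ap Am M a Ψ) (hp0 : 0 < p) (hp1 : p < 1) (φ θ : 𝒞) :
    ⁅neutralCurrent p Ap Am M a φ, raisingCurrent p Ap Am M a θ⁆ =
      raisingCurrent p Ap Am M a (φ * θ) := by
  have hr := sqrt_ne_zero hp0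
  have hc := cConst_ne_zero hp0 hp1
  have hpr := sq_sqrt hp0
  have h1 := cConst_mul_sqrt hp0
  rw [raisingCurrent, h.lie_current, ← hpr]
  rw [← hpr] at h1
  congr 2
  · field_simp
    linear_combination -h1
  · field_simp
    linear_combination -h1
  · field_simp
    linear_combination h1

theorem lie_neutral_lowering (h : IsShiftSystem Ap Am M a Ψ) (hp0 : 0 < p) (hp1 : p < 1) (φ θ : 𝒞) :
    ⁅neutralCurrent p Ap Am M a φ, loweringCurrent p Ap Am M a θ⁆ =
      -loweringCurrent p Ap Am M a (φ * θ) := by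
  have hr := sqrt_ne_zero hp0
  have hc := cConst_ne_zero hp0 hp1
  have hpr := sq_sqrt hp0
  have h1 := cConst_mul_sqrt hp0
  rw [h.lie_current, ← LinearMap.neg_apply, ← neg_one_smul ℂ (loweringCurrent p Ap Am M a),
    smul_current]
  rw [← hpr] at h1
  congr 2
  · field_simp
    linear_combination h1
  · field_simp
    linear_combination h1
  · field_simp
    linear_combination -h1

/-- The sum is (p + 1/p - 2)/c = c. This is the leading coefficient that cyclicity requires to be
non-zero. -/
theorem raising_coeff_ne_zero (hp0 : 0 < p) (hp1 : p < 1) :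
    1 / (cConst p : ℂ) * p + 1 / (cConst p : ℂ) * (p : ℂ)⁻¹ + 2 * -(1 / (cConst p : ℂ)) ≠ 0 := by
  have hc := cConst_ne_zero hp0 hp1
  have h2 : (cConst p : ℂ) ^ 2 = p + (p : ℂ)⁻¹ - 2 := by
    exact_mod_cast congrArg Complex.ofReal (cConst_sq hp0)
  have e : 1 / (cConst p : ℂ) * p + 1 / (cConst p : ℂ) * (p : ℂ)⁻¹ + 2 * -(1 / (cConst p : ℂ)) =
      1 / (cConst p : ℂ) * (cConst p : ℂ) ^ 2 := by
    rw [h2]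
    ring
  rw [e]
  exact mul_ne_zero (one_div_ne_zero hc) (pow_ne_zero _ hc)

end IsShiftSystem

open IsShiftSystem

variable {X : Type*} [MeasurableSpace X] {α : Measure X} {p : ℝ} {ρ : Measure (Config X)}

/-! ### The formulas for the operators -/

theorem IsShift.integral_sub {m : Config X → Measure X} {σ : Config X → X → Config X} {s : ℂ}
    (h : IsShift α ρ m σ s) (φ : TestFunctions α) {F : Config X → ℂ} (hF : F ∈ polyFun α) :
    ∀ᵐ η ∂ρ, ∫ x, (φ : X → ℂ) x * (F (σ η x) - F η) ∂m η =
      shiftInt m σ φ F η - (∫ x, (φ : X → ℂ) x ∂m η) * F η := by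
  filter_upwards [h.ae_integrable φ hF, h.integrable φ] with η h1 h2
  simp only [mul_sub]
  rw [MeasureTheory.integral_sub h1 (h2.mul_const _), integral_mul_const]
  rfl

theorem TestFunctions.ae_integral_add (φ : TestFunctions α) (hρ : IsPascalLaw p α ρ) (hp0 : 0 < p)
    (hp1 : p < 1) : ∀ᵐ η ∂ρ, ∫ x, (φ : X → ℂ) x ∂(α + η.1) =
      refInt α φ + ∫ x, (φ : X → ℂ) x ∂η.1 := by
  filter_upwards [TestFunctions.ae_integrable φ hρ hp0 hp1] with η hη
  exact integral_add_measure (TestFunctions.integrable φ) hη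

section

variable {Ap Am M : TestFunctions α →ₗ[ℂ] Module.End ℂ (polyDomain α ρ)}

theorem coeFn_current (hAp : Represents Ap fun φ => shiftInt (fun η => α + η.1) Config.add φ)
    (hAm : Represents Am fun φ => shiftInt (fun η => η.1) Config.sub φ)
    (hM : Represents M countMul) (x y z : ℂ) (φ : TestFunctions α) (f : polyDomain α ρ)
    {F : Config X → ℂ} (hF : F ∈ polyFun α) (h : (f : Lp ℂ 2 ρ) =ᵐ[ρ] F) :
    (current Ap Am M (refInt α) x y z φ f : Lp ℂ 2 ρ) =ᵐ[ρ] fun η =>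
      x * shiftInt (fun η => α + η.1) Config.add φ F η +
        y * shiftInt (fun η => η.1) Config.sub φ F η +
        z * (2 * (∫ t, (φ : X → ℂ) t ∂η.1) + refInt α φ) * F η := by
  have e : current Ap Am M (refInt α) x y z φ f =
      x • Ap φ f + y • Am φ f + ((2 * z) • M φ f + (z * refInt α φ) • f) := by
    simp only [current_apply, LinearMap.add_apply, LinearMap.smul_apply, mulOp_apply]
    module
  rw [e]
  filter_upwards [coeFn_polyDomain_add (x • Ap φ f + y • Am φ f)
      ((2 * z) • M φ f + (z * refInt α φ) • f), coeFn_polyDomain_add (x • Ap φ f) (y • Am φ f),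
    coeFn_polyDomain_add ((2 * z) • M φ f) ((z * refInt α φ) • f),
    coeFn_polyDomain_smul x (Ap φ f), coeFn_polyDomain_smul y (Am φ f),
    coeFn_polyDomain_smul (2 * z) (M φ f), coeFn_polyDomain_smul (z * refInt α φ) f,
    hAp φ f F hF h, hAm φ f F hF h, hM φ f F hF h, h] with η h1 h2 h3 h4 h5 h6 h7 h8 h9 h10 h11
  rw [h1, Pi.add_apply, h2, h3, Pi.add_apply, Pi.add_apply, h4, h5, h6, h7]
  simp only [Pi.smul_apply, smul_eq_mul]
  rw [h8, h9, h10, h11, countMul]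
  ring

theorem givenBy_raising (hAp : Represents Ap fun φ => shiftInt (fun η => α + η.1) Config.add φ)
    (hAm : Represents Am fun φ => shiftInt (fun η => η.1) Config.sub φ)
    (hM : Represents M countMul) :
    GivenBy (fun φ => raisingCurrent p Ap Am M (refInt α) φ) (raising p α) := by
  intro φ f F hF h
  filter_upwards [coeFn_current hAp hAm hM (1 / (cConst p : ℂ) * p)
    (1 / (cConst p : ℂ) * (p : ℂ)⁻¹) (-(1 / (cConst p : ℂ))) φ f hF h] with η hη
  rw [hη, raising, add_comm η.1 α]
  simp only [shiftInt, refInt, LinearMap.coe_mk, AddHom.coe_mk]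
  ring

/-- The two subtracted terms integrate to α + 2η on the conjugate of φ, which is the multiplication
part of the current. -/
theorem givenBy_lowering [MeasurableSingletonClass X] [IsProbabilityMeasure ρ]
    (hρ : IsPascalLaw p α ρ) (hp0 : 0 < p) (hp1 : p < 1)
    (hAp : Represents Ap fun φ => shiftInt (fun η => α + η.1) Config.add φ)
    (hAm : Represents Am fun φ => shiftInt (fun η => η.1) Config.sub φ)
    (hM : Represents M countMul) :
    GivenBy (fun φ => loweringCurrent p Ap Am M (refInt α) (star φ)) (lowering p α) := by
  intro φ f F hF h
  filter_upwards [coeFn_current hAp hAm hM (1 / (cConst p : ℂ)) (1 / (cConst p : ℂ))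
    (-(1 / (cConst p : ℂ))) (star φ) f hF h, (isShift_add hρ hp0 hp1).integral_sub (star φ) hF,
    (isShift_sub hρ hp0 hp1).integral_sub (star φ) hF,
    TestFunctions.ae_integral_add (star φ) hρ hp0 hp1] with η hη h1 h2 h3
  rw [h3] at h1
  rw [hη]
  refine Eq.trans ?_ (congrArg₂ (fun u v => 1 / (cConst p : ℂ) * (u + v)) h1 h2).symm
  ring

theorem givenBy_neutral [MeasurableSingletonClass X] [IsProbabilityMeasure ρ]
    (hρ : IsPascalLaw p α ρ) (hp0 : 0 < p) (hp1 : p < 1)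
    (hAp : Represents Ap fun φ => shiftInt (fun η => α + η.1) Config.add φ)
    (hAm : Represents Am fun φ => shiftInt (fun η => η.1) Config.sub φ)
    (hM : Represents M countMul) :
    GivenBy (fun φ => neutralCurrent p Ap Am M (refInt α) φ) (neutral p α) := by
  intro φ f F hF h
  filter_upwards [coeFn_current hAp hAm hM (-(1 / (cConst p : ℂ)) * (√p : ℂ))
    (-(1 / (cConst p : ℂ)) * (√p : ℂ)⁻¹) (1 / (cConst p : ℂ) * (((√p : ℂ) + (√p : ℂ)⁻¹) / 2)) φ f
    hF h, (isShift_add hρ hp0 hp1).integral_sub φ hF, (isShift_sub hρ hp0 hp1).integral_sub φ hF,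
    TestFunctions.ae_integral_add φ hρ hp0 hp1] with η hη h1 h2 h3
  have hc := cConst_ne_zero hp0 hp1
  -- This merges α(φ)/2 with the α-part of the subtracted terms: √p/c + 1/2 = (√p + 1/√p)/(2c).
  have e : (√p : ℂ)⁻¹ = cConst p + √p := by rw [cConst_eq]; ring
  rw [h3] at h1
  rw [hη, neutral, h1, h2, one_div (√p : ℂ), e]
  change _ = _ + 1 / 2 * refInt α φ * F η
  field_simp
  ring

/-! ### Products of Meixner polynomials -/

theorem coeFn_aeval (hM : Represents M countMul) (φ : TestFunctions α) (Q : ℂ[X]) :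
    ∀ F ∈ polyFun α, ∀ f : polyDomain α ρ, (f : Lp ℂ 2 ρ) =ᵐ[ρ] F →
      (fun η => Q.eval (∫ x, (φ : X → ℂ) x ∂η.1) * F η) ∈ polyFun α ∧
      (aeval (M φ) Q f : Lp ℂ 2 ρ) =ᵐ[ρ] fun η => Q.eval (∫ x, (φ : X → ℂ) x ∂η.1) * F η := by
  induction Q using Polynomial.induction_on with
  | C c =>
    intro F hF f hf
    simp only [eval_C, aeval_C, Module.algebraMap_end_apply]
    exact ⟨(polyFun α).smul_mem hF c, (coeFn_polyDomain_smul c f).trans (hf.const_smul c)⟩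
  | add P Q hP hQ =>
    intro F hF f hf
    simp only [eval_add, map_add, LinearMap.add_apply, _root_.add_mul]
    exact ⟨add_mem (hP F hF f hf).1 (hQ F hF f hf).1,
      (coeFn_polyDomain_add _ _).trans ((hP F hF f hf).2.add (hQ F hF f hf).2)⟩
  | monomial n c ih =>
    intro F hF f hf
    have h := ih _ (countMul_mem φ hF) _ (hM φ f F hF hf)
    rw [pow_succ, ← mul_assoc, map_mul, aeval_X, Module.End.mul_apply]
    have e : ∀ η : Config X,
        ((C c * Polynomial.X ^ n) * Polynomial.X : ℂ[X]).eval (∫ x, (φ : X → ℂ) x ∂η.1) *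
        F η = (C c * Polynomial.X ^ n : ℂ[X]).eval (∫ x, (φ : X → ℂ) x ∂η.1) * countMul φ F η :=
        fun η => by
      rw [eval_mul_X, mul_assoc, countMul]
    simp only [e]
    exact h

theorem coeFn_prod_aeval [IsProbabilityMeasure ρ] (hM : Represents M countMul) {l : ℕ}
    (φ : Fin l → TestFunctions α) (Q : Fin l → ℂ[X]) :
    (fun η => ∏ j, (Q j).eval (∫ x, (φ j : X → ℂ) x ∂η.1)) ∈ polyFun α ∧
    ((List.ofFn fun j => aeval (M (φ j)) (Q j)).prod (vacuum α ρ) : Lp ℂ 2 ρ) =ᵐ[ρ]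
      fun η => ∏ j, (Q j).eval (∫ x, (φ j : X → ℂ) x ∂η.1) := by
  induction l with
  | zero => simpa using ⟨one_mem_polyFun, coeFn_vacuum (α := α) (ρ := ρ)⟩
  | succ l ih =>
    have h := ih (fun j => φ j.succ) fun j => Q j.succ
    simp only [Fin.prod_univ_succ, List.ofFn_succ, List.prod_cons, Module.End.mul_apply]
    exact coeFn_aeval hM (φ 0) (Q 0) _ h.1 _ h.2

end

theorem indicatorTest_mul_self {B : Set X} (hB : MeasurableSet B) (hα : α B < ∞) :
    indicatorTest α B hB hα * indicatorTest α B hB hα = indicatorTest α B hB hα := by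
  refine Subtype.ext (funext fun x => ?_)
  change B.indicator (1 : X → ℂ) x * B.indicator (1 : X → ℂ) x = B.indicator (1 : X → ℂ) x
  by_cases hx : x ∈ B <;> simp [hx]

theorem indicatorTest_mul_of_disjoint {B B' : Set X} (hB : MeasurableSet B) (hα : α B < ∞)
    (hB' : MeasurableSet B') (hα' : α B' < ∞) (h : Disjoint B B') :
    indicatorTest α B hB hα * indicatorTest α B' hB' hα' = 0 := by
  refine Subtype.ext (funext fun x => ?_)
  change B.indicator (1 : X → ℂ) x * B'.indicator (1 : X → ℂ) x = 0
  by_cases hx : x ∈ B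
  · simp [Set.disjoint_left.1 h hx]
  · simp [hx]

end

section

open IsShiftSystem

variable {X : Type*} [MeasurableSpace X] {α : Measure X} {p : ℝ} {ρ : Measure (Config X)}
  {Ap Am M : TestFunctions α →ₗ[ℂ] Module.End ℂ (polyDomain α ρ)}

/-! ### The Fock representation -/

theorem isFockRepresentation [MeasurableSingletonClass X] [SigmaFinite α] [IsProbabilityMeasure ρ]
    (hρ : IsPascalLaw p α ρ) (hp0 : 0 < p) (hp1 : p < 1)
    (hAp : Represents Ap fun φ => shiftInt (fun η => α + η.1) Config.add φ)
    (hAm : Represents Am fun φ => shiftInt (fun η => η.1) Config.sub φ)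
    (hM : Represents M countMul) :
    IsFockRepresentation α (polyDomain α ρ) (fun φ => raisingCurrent p Ap Am M (refInt α) φ)
      (fun φ => loweringCurrent p Ap Am M (refInt α) (star φ))
      (fun φ => neutralCurrent p Ap Am M (refInt α) φ) (vacuum α ρ) := by
  have h := isShiftSystem hρ hp0 hp1 hAp hAm hM
  have hp : (p : ℂ) ≠ 0 := by exact_mod_cast hp0.ne'
  exact {
    dense_domain := hρ.dense_polyDomain hp0 hp1
    kp_add := fun φ θ => map_add _ _ _
    kp_smul := fun z φ => map_smul _ _ _
    k0_add := fun φ θ => map_add _ _ _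
    k0_smul := fun z φ => map_smul _ _ _
    km_add := fun φ θ => by rw [star_add, map_add]
    km_smul := fun z φ => by rw [star_smul, map_smul]; rfl
    comm_km_kp := fun φ θ => h.lie_lowering_raising hp0 hp1 _ _
    comm_k0_kp := fun φ θ => h.lie_neutral_raising hp0 hp1 _ _
    comm_k0_km := fun φ θ => by
      rw [h.lie_neutral_lowering hp0 hp1, star_mul, star_star, _root_.mul_comm φ]
    comm_kp_kp := fun φ θ => h.lie_current_self _ _ _ _ _
    comm_km_km := fun φ θ => h.lie_current_self _ _ _ _ _
    comm_k0_k0 := fun φ θ => h.lie_current_self _ _ _ _ _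
    adjoint_k0 := fun φ f g => by
      have e := inner_current hρ hp0 hp1 hAp hAm hM (-(1 / cConst p) * √p)
        (-(1 / cConst p) * (√p)⁻¹) (1 / cConst p * ((√p + (√p)⁻¹) / 2)) φ f g
      push_cast at e
      have hr := sqrt_ne_zero hp0
      -- The adjoint sends (x, y, z) to (py, x/p, z); the neutral triple is fixed, as its first two
      -- entries have ratio p.
      have h1 : (p : ℂ) * (-(1 / (cConst p : ℂ)) * (√p : ℂ)⁻¹) =
          -(1 / (cConst p : ℂ)) * (√p : ℂ) := by
        rw [← sq_sqrt hp0]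
        field_simp
      have h2 : (p : ℂ)⁻¹ * (-(1 / (cConst p : ℂ)) * (√p : ℂ)) =
          -(1 / (cConst p : ℂ)) * (√p : ℂ)⁻¹ := by
        rw [← h1, inv_mul_cancel_left₀ hp]
      rw [h1, h2] at e
      exact e
    adjoint_kp := fun φ f g => by
      have e := inner_current hρ hp0 hp1 hAp hAm hM (1 / cConst p * p)
        (1 / cConst p * p⁻¹) (-(1 / cConst p)) φ f g
      push_cast at e
      -- The same rule takes the raising triple (p, 1/p, -1)/c to the lowering triple (1, 1, -1)/c.
      rw [mul_left_comm (p : ℂ), mul_inv_cancel₀ hp, mul_one, mul_left_comm (p : ℂ)⁻¹,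
        inv_mul_cancel₀ hp, mul_one] at e
      exact e
    norm_vacuum := by
      refine (Lp.norm_const (μ := ρ) (p := 2) (c := (1 : ℂ)) (by norm_num)).trans ?_
      simp
    km_vacuum := fun φ => by
      simp only [loweringCurrent, current_apply, LinearMap.add_apply, LinearMap.smul_apply,
        mulOp_apply, h.add_vacuum, h.sub_vacuum]
      module
    cyclic := by
      -- The words lie in the polynomial domain and span it algebraically, so their density is that
      -- of the domain.
      have e : {v : Lp ℂ 2 ρ | ∃ l : List (TestFunctions α),
          v = ((l.map fun φ => raisingCurrent p Ap Am M (refInt α) φ).prod (vacuum α ρ) :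
            polyDomain α ρ)} =
          (polyDomain α ρ).subtype '' {v | ∃ l : List (TestFunctions α),
            v = (l.map (raisingCurrent p Ap Am M (refInt α))).prod (vacuum α ρ)} := by
        ext v
        constructor
        · rintro ⟨l, rfl⟩
          exact ⟨_, ⟨l, rfl⟩, rfl⟩
        · rintro ⟨_, ⟨l, rfl⟩, rfl⟩
          exact ⟨l, rfl⟩
      rw [e, Submodule.span_image, h.span_current_words (raising_coeff_ne_zero hp0 hp1),
        Submodule.map_top, Submodule.range_subtype]
      exact hρ.dense_polyDomain hp0 hp1 }

theorem coeFn_prod_raising [MeasurableSingletonClass X] [IsProbabilityMeasure ρ]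
    (hρ : IsPascalLaw p α ρ) (hp0 : 0 < p) (hp1 : p < 1)
    (hAp : Represents Ap fun φ => shiftInt (fun η => α + η.1) Config.add φ)
    (hAm : Represents Am fun φ => shiftInt (fun η => η.1) Config.sub φ)
    (hM : Represents M countMul) {l : ℕ} {B : Fin l → Set X} (hB : ∀ j, MeasurableSet (B j))
    (hdisj : Pairwise fun i j => Disjoint (B i) (B j)) (hfin : ∀ j, α (B j) < ∞) (n : Fin l → ℕ) :
    ((List.ofFn fun j => raisingCurrent p Ap Am M (refInt α)
        (indicatorTest α (B j) (hB j) (hfin j)) ^ n j).prod (vacuum α ρ) : Lp ℂ 2 ρ) =ᵐ[ρ]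
      fun η => ∏ j, ((cConst p ^ n j *
        (meixner (α (B j)).toReal p (n j)).eval (η.1 (B j)).toReal : ℝ) : ℂ) := by
  have h := isShiftSystem hρ hp0 hp1 hAp hAm hM
  rw [raisingCurrent, h.prod_current_pow_vacuum hp0 hp1
    (fun j => indicatorTest α (B j) (hB j) (hfin j)) (fun j => indicatorTest_mul_self _ _)
    (fun i j hij => indicatorTest_mul_of_disjoint _ _ _ _ (hdisj hij))
    (fun j => (α (B j)).toReal) (fun j => integral_indicatorTest (hB j) (hfin j) α)]
  filter_upwards [(coeFn_prod_aeval hM (fun j => indicatorTest α (B j) (hB j) (hfin j))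
    fun j => (C (cConst p ^ n j) * meixner (α (B j)).toReal p (n j)).map Complex.ofRealHom).2]
    with η hη
  rw [hη]
  refine Finset.prod_congr rfl fun j _ => ?_
  rw [integral_indicatorTest, ← Complex.ofRealHom_eq_coe, eval_map_apply, eval_mul, eval_C,
    Complex.ofRealHom_eq_coe]

end

end PascalCurrent

theorem theorem3p6 {X : Type*} [MeasurableSpace X] [StandardBorelSpace X]
    (α : Measure X) [SigmaFinite α] (p : ℝ) (hp0 : 0 < p) (hp1 : p < 1)
    (ρ : Measure (Config X)) [IsProbabilityMeasure ρ] (hρ : IsPascalLaw p α ρ) :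
    -- polynomials are square-integrable, and the integrals defining the operators converge
    (∀ F ∈ polyFun α, MemLp F 2 ρ) ∧
    (∀ (φ : TestFunctions α), ∀ F ∈ polyFun α, ∀ᵐ η ∂ρ, IntegralsConverge α φ F η) ∧
    -- the monic Meixner polynomials are well defined
    (∀ a : ℝ, 0 < a → ∃! M : ℕ → ℝ[X], IsMonicMeixner a p M) ∧
    ∃ Kp Km K0 : TestFunctions α → Module.End ℂ (polyDomain α ρ),
      GivenBy Kp (raising p α) ∧ GivenBy Km (lowering p α) ∧ GivenBy K0 (neutral p α) ∧
      IsFockRepresentation α (polyDomain α ρ) Kp Km K0 (vacuum α ρ) ∧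
      ∀ (l : ℕ) (B : Fin l → Set X) (hB : ∀ j, MeasurableSet (B j))
        (_ : Pairwise fun i j => Disjoint (B i) (B j))
        (_ : ∀ j, 0 < α (B j)) (hfin : ∀ j, α (B j) < ∞) (n : Fin l → ℕ)
        (M : Fin l → ℕ → ℝ[X]) (_ : ∀ j, IsMonicMeixner (α (B j)).toReal p (M j)),
        ((List.ofFn fun j => Kp (indicatorTest α (B j) (hB j) (hfin j)) ^ n j).prod
            (vacuum α ρ) : Lp ℂ 2 ρ)
          =ᵐ[ρ] fun η => ∏ j, ((cConst p ^ n j * (M j (n j)).eval (η.1 (B j)).toReal : ℝ) : ℂ) := by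
  obtain ⟨Ap, hAp⟩ := (isShift_add (α := α) hρ hp0 hp1).exists_represents hρ hp0 hp1
    fun φ _ hF h0 => shiftInt_add_eq_zero hρ hp0 hp1 φ hF h0
  obtain ⟨Am, hAm⟩ := (isShift_sub (α := α) hρ hp0 hp1).exists_represents hρ hp0 hp1
    fun φ _ hF h0 => shiftInt_sub_eq_zero hρ hp0 hp1 φ hF h0
  obtain ⟨M, hM⟩ := exists_countMul (α := α) hρ hp0 hp1
  refine ⟨fun F hF => memLp_of_mem_tempered (polyFun_le_tempered hρ hp0 hp1 hF),
    fun φ F hF => ae_integralsConverge hρ hp0 hp1 φ hF,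
    fun a ha => ⟨meixner a p, isMonicMeixner_meixner ha.le hp0 hp1,
      fun N hN => hN.eq_meixner ha hp0 hp1⟩,
    _, _, _, givenBy_raising hAp hAm hM, givenBy_lowering hρ hp0 hp1 hAp hAm hM,
    givenBy_neutral hρ hp0 hp1 hAp hAm hM, isFockRepresentation hρ hp0 hp1 hAp hAm hM, ?_⟩
  intro l B hB hdisj hpos hfin n N hN
  filter_upwards [coeFn_prod_raising hρ hp0 hp1 hAp hAm hM hB hdisj hfin n] with η hη
  rw [hη]
  refine Finset.prod_congr rfl fun j _ => ?_
  -- Positivity of α (B j) enters here: it makes the weights strictly positive, so that the Meixner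
  -- family is unique.
  rw [(hN j).eq_meixner (ENNReal.toReal_pos (hpos j).ne' (hfin j).ne) hp0 hp1]
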